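/- **Setting.** Let $d,m\ge 1$, $T>0$, let $(\Omega,\mathcal F,\mathbf P)$ be a probability space with expectation $E$, and let $\mathbb S^d$ be the unit sphere of $\mathbb R^{d+1}$. The Fourier transform is $\mathcal F(g)(\xi)=\int e^{-2\pi i x\cdot\xi}g(x)\,dx$; $\mathcal F_{\mathbf x}$ and $\mathcal F_t$ denote it in $\mathbf x\in\mathbb R^d$ and in $t$ (functions of $t\in(0,T)$ being extended by zero to $\mathbb R$). We write $\boldsymbol\xi=(\xi_0,\boldsymbol\xi')\in\mathbb R\times\mathbb R^d$. Functions $\phi,\phi_1,\phi_2,\psi,f$ are complex-valued. Let $u_n=u_n(\omega,t,\mathbf x,\lambda):\Omega\times(0,T)\times\mathbb R^d\times\mathbb R^m\to\mathbb R$, $n\in\mathbb N$, be measurable functions such that * $\sup_n\|u_n\|_{L^\infty(\Omega\times(0,T)\times\mathbb R^d\times\mathbb R^m)}<\infty$ and $\sup_n\|u_n\|_{L^2(\Omega\times(0,T)\times\mathbb R^d\times\mathbb R^m)}<\infty$; * for some compact $K\subset\mathbb R^d$, all $u_n$ vanish a.e. on $\{\mathbf x\notin K\}$; * $u_n\to0$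 almost surely in $L^2_t(L^2_w(\mathbb R^d\times\mathbb R^m))$, i.e. for every $g\in L^2(\mathbb R^d\times\mathbb R^m)$, almost surely, $\int_0^T\bigl|\int_{\mathbb R^{d+m}}u_n(\omega,t,\mathbf x,\lambda)g(\mathbf x,\lambda)\,d\mathbf x\,d\lambda\bigr|^2dt\to0$. **Claim.** There is a subsequence of $(u_n)$ (not relabelled) such that for each $\phi\in L^1(\mathbb R)$ there are a continuous linear functional $\mu_\phi\in\bigl(L^2(\mathbb R^{2m};C_0(\mathbb R^d\times\mathbb S^d))\bigr)'$, a family $\nu\in L^1_{\rm loc}(\mathbb R^d;\mathcal M(\mathbb S^d))$, that is, a weakly measurable family $\mathbf x\mapsto\nu_{\mathbf x}$ of finite nonnegative Radon measures on $\mathbb S^d$ with $\int_C\nu_{\mathbf x}(\mathbb S^d)\,d\mathbf x<\infty$ for all compact $C\subset\mathbb R^d$, and a measurable function $f=f(\mathbf p,\mathbf q,\mathbf x,\boldsymbol\xi)\in L^2(\mathbb R^{2m};L^1_\nu(\mathbb R^d\times\mathbb S^d))$, that is, with $d\nu(\mathbf x,\boldsymbol\xi)=d\nu_{\mathbf x}(\boldsymbol\xi)\,d\mathbf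 x$, $$\int_{\mathbb R^{2m}}\Bigl(\int_{\mathbb R^d\times\mathbb S^d}|f(\mathbf p,\mathbf q,\mathbf x,\boldsymbol\xi)|\,d\nu(\mathbf x,\boldsymbol\xi)\Bigr)^2d\mathbf p\,d\mathbf q<\infty ,$$ with the following two properties. 1. $\mu_\phi=f\,d\nu$: for every $\Phi\in L^2(\mathbb R^{2m};C_0(\mathbb R^d\times\mathbb S^d))$ one has, with an absolutely convergent integral, $$\mu_\phi(\Phi)=\int_{\mathbb R^{2m}}\int_{\mathbb R^d\times\mathbb S^d}\Phi(\mathbf p,\mathbf q)(\mathbf x,\boldsymbol\xi)\,f(\mathbf p,\mathbf q,\mathbf x,\boldsymbol\xi)\,d\nu(\mathbf x,\boldsymbol\xi)\,d\mathbf p\,d\mathbf q .$$ 2. Let $r>2$, $\phi_1\in L^r(\mathbb R^d\times\mathbb R^m)$, $\phi_2\in C_c(\mathbb R^d\times\mathbb R^m)$ and $\psi\in C^d(\mathbb S^d)$, and suppose that for some compact $L\subset\mathbb R^m$ all products $\phi_1(\mathbf x,\mathbf p)u_n(\omega,t,\mathbf x,\mathbf p)$ vanish for a.e. $(\omega,t,\mathbf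 x,\mathbf p)$ with $\mathbf p\notin L$ (for instance, $\phi_1$ has compact support in $\mathbf p$, or the $u_n$ are supported in one fixed compact set with respect to $\lambda$). Then $$\int_{\mathbb R^{2m}}\int_{\mathbb R^d\times\mathbb S^d}\phi_1(\mathbf x,\mathbf p)\overline{\phi_2(\mathbf x,\mathbf q)}\,\psi(\boldsymbol\xi)\,f(\mathbf p,\mathbf q,\mathbf x,\boldsymbol\xi)\,d\nu(\mathbf x,\boldsymbol\xi)\,d\mathbf p\,d\mathbf q$$ $$=\lim_{n\to\infty}E\Bigl[\int_{\mathbb R^{2m+d+1}}\psi\Bigl(\frac{\boldsymbol\xi}{|\boldsymbol\xi|}\Bigr)\phi(\xi_0)\,\mathcal F_t\Bigl(\mathcal F_{\mathbf x}\bigl(\phi_1(\cdot,\mathbf p)u_n(\cdot,\cdot,\cdot,\mathbf p)\bigr)\overline{\mathcal F_{\mathbf x}\bigl(\phi_2(\cdot,\mathbf q)u_n(\cdot,\cdot,\cdot,\mathbf q)\bigr)}\Bigr)(\boldsymbol\xi)\,d\boldsymbol\xi\,d\mathbf p\,d\mathbf q\Bigr],$$ where all integrals converge absolutely. In particular the limit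 equals $\mu_\phi(\Phi)$ whenever $\Phi(\mathbf p,\mathbf q)(\mathbf x,\boldsymbol\xi)=\phi_1(\mathbf x,\mathbf p)\overline{\phi_2(\mathbf x,\mathbf q)}\psi(\boldsymbol\xi)$ defines an element of $L^2(\mathbb R^{2m};C_0(\mathbb R^d\times\mathbb S^d))$. -/

import Mathlib

open MeasureTheory ProbabilityTheory Filter Set
open scoped Topology ENNReal FourierTransform Manifold ZeroAtInfty ComplexConjugate
open scoped EuclideanSpace

noncomputable section

namespace HMeasure

/-- The Euclidean space `ℝᵏ`. -/
abbrev E (k : ℕ) : Type := EuclideanSpace ℝ (Fin k)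

/-- The unit sphere `𝕊ᵈ` of `ℝᵈ⁺¹`. -/
abbrev S (d : ℕ) : Type := Metric.sphere (0 : E (d + 1)) 1

/-- The point `ξ = (ξ₀, ξ')` of `ℝᵈ⁺¹`, for `ξ₀ ∈ ℝ` and `ξ' ∈ ℝᵈ`. -/
def joinFreq {d : ℕ} (ξ₀ : ℝ) (ξ' : E d) : E (d + 1) :=
  WithLp.toLp 2 (Fin.cons ξ₀ (fun i => ξ' i))

/-- The symbol `ξ ↦ ψ (ξ / |ξ|)` on `ℝᵈ⁺¹` (its value at the origin is set to be `0`). -/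
def radialSymbol {d : ℕ} (ψ : S d → ℂ) (ξ : E (d + 1)) : ℂ :=
  if h : ξ = 0 then 0
  else ψ ⟨‖ξ‖⁻¹ • ξ, by
    have h' : ‖ξ‖ ≠ 0 := norm_ne_zero_iff.mpr h
    simp [norm_smul, h']⟩

/-- The standing assumptions on `uₙ = uₙ(ω, t, x, λ)`, with `t ∈ (0, T)`, `x ∈ ℝᵈ`, `λ ∈ ℝᵐ`. -/
structure IsAdmissible {Ω : Type*} [MeasurableSpace Ω] (P : Measure Ω) {d m : ℕ} (T : ℝ)
    (u : ℕ → Ω → ℝ → E d → E m → ℝ) : Prop where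
  /-- each `uₙ` is measurable in all its variables -/
  measurable : ∀ n, Measurable (fun w : Ω × ℝ × E d × E m => u n w.1 w.2.1 w.2.2.1 w.2.2.2)
  /-- the `uₙ` are bounded in `L^∞`, uniformly in `n` -/
  bounded : ∃ C : ℝ, ∀ n,
    ∀ᵐ w ∂(P.prod ((volume.restrict (Ioo 0 T)).prod (volume : Measure (E d × E m)))),
      |u n w.1 w.2.1 w.2.2.1 w.2.2.2| ≤ C
  /-- the `uₙ` are supported in one fixed compact set with respect to `x` -/
  support : ∃ K : Set (E d), IsCompact K ∧ ∀ n,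
    ∀ᵐ w ∂(P.prod ((volume.restrict (Ioo 0 T)).prod (volume : Measure (E d × E m)))),
      w.2.2.1 ∉ K → u n w.1 w.2.1 w.2.2.1 w.2.2.2 = 0
  /-- the `uₙ` are bounded in `L²(Ω × (0, T) × ℝᵈ × ℝᵐ)`, uniformly in `n` -/
  boundedL2 : ∃ C : ℝ≥0∞, C < ∞ ∧ ∀ n,
    ∫⁻ w, ‖u n w.1 w.2.1 w.2.2.1 w.2.2.2‖ₑ ^ 2
      ∂(P.prod ((volume.restrict (Ioo 0 T)).prod (volume : Measure (E d × E m)))) ≤ C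
  /-- `uₙ → 0` almost surely, strongly in `t` and weakly in `(x, λ)` -/
  tendsto : ∀ g : E d × E m → ℝ, MemLp g 2 volume → ∀ᵐ ω ∂P,
    Tendsto (fun n => ∫⁻ t in Ioo 0 T, ‖∫ z : E d × E m, u n ω t z.1 z.2 * g z‖ₑ ^ 2)
      atTop (𝓝 0)

/-- For one function `v = v(t, x, λ)`, the integrand
`ψ(ξ/|ξ|) φ(ξ₀) 𝓕ₜ( 𝓕ₓ(φ₁(·,p) v(·,·,p)) conj 𝓕ₓ(φ₂(·,q) v(·,·,q)) )(ξ)`, with `ξ = (ξ₀, ξ')`,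
where functions of `t ∈ (0, T)` are extended by zero to `ℝ`. -/
def integrand {d m : ℕ} (T : ℝ) (v : ℝ → E d → E m → ℝ) (φ : ℝ → ℂ)
    (φ₁ φ₂ : E d × E m → ℂ) (ψ : S d → ℂ) (ξ₀ : ℝ) (ξ' : E d) (p q : E m) : ℂ :=
  radialSymbol ψ (joinFreq ξ₀ ξ') * φ ξ₀ *
    𝓕 ((Ioo 0 T).indicator (fun t : ℝ =>
      𝓕 (fun x : E d => φ₁ (x, p) * (v t x p : ℂ)) ξ' *
        conj (𝓕 (fun x : E d => φ₂ (x, q) * (v t x q : ℂ)) ξ'))) ξ₀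

/-- `E ∫_{ℝ^{2m+d+1}} ψ(ξ/|ξ|) φ(ξ₀) 𝓕ₜ( 𝓕ₓ(φ₁(·,p) v(·,·,p)) conj 𝓕ₓ(φ₂(·,q) v(·,·,q)) )(ξ)
dξ dp dq` for a random function `v = v(ω, t, x, λ)`. -/
def expectation {Ω : Type*} [MeasurableSpace Ω] (P : Measure Ω) {d m : ℕ} (T : ℝ)
    (v : Ω → ℝ → E d → E m → ℝ) (φ : ℝ → ℂ) (φ₁ φ₂ : E d × E m → ℂ) (ψ : S d → ℂ) : ℂ :=
  ∫ ω, (∫ w : (ℝ × E d) × E m × E m,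
    integrand T (v ω) φ φ₁ φ₂ ψ w.1.1 w.1.2 w.2.1 w.2.2) ∂P

/-- The tensor `φ₁(x, p) conj φ₂(x, q) ψ(ξ)`, as a function of `(p, q)` and `(x, ξ)`. -/
def tensor {d m : ℕ} (φ₁ φ₂ : E d × E m → ℂ) (ψ : S d → ℂ)
    (z : E m × E m) (y : E d × S d) : ℂ :=
  φ₁ (y.1, z.1) * conj (φ₂ (y.1, z.2)) * ψ y.2

/-- The space `L²(ℝ²ᵐ; C₀(ℝᵈ × 𝕊ᵈ))` of complex-valued Bochner functions of `(p, q)`. -/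
abbrev TestSpace (d m : ℕ) : Type :=
  Lp C₀(E d × S d, ℂ) 2 (volume : Measure (E m × E m))

/-- `ν ∈ L¹_loc(ℝᵈ; M(𝕊ᵈ))`: a measurable family of finite nonnegative (hence Radon) measures
on the sphere whose total variation is locally integrable in `x`. -/
structure IsLocIntegrableFamily {d : ℕ} (ν : Kernel (E d) (S d)) : Prop where
  isSFinite : IsSFiniteKernel ν
  finite : ∀ x, IsFiniteMeasure (ν x)
  locIntegrable : ∀ C : Set (E d), IsCompact C → ∫⁻ x in C, ν x univ < ∞

/-- The measure `dν(x, ξ) = ν_x(dξ) dx` on `ℝᵈ × 𝕊ᵈ`. -/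
def total {d : ℕ} (ν : Kernel (E d) (S d)) : Measure (E d × S d) :=
  (volume : Measure (E d)) ⊗ₘ ν

/-- `f ∈ L²(ℝ²ᵐ; L¹_ν(ℝᵈ × 𝕊ᵈ))`. -/
structure IsDensity {d m : ℕ} (ν : Kernel (E d) (S d))
    (f : E m × E m → E d × S d → ℂ) : Prop where
  measurable : Measurable (Function.uncurry f)
  finite : ∫⁻ z, (∫⁻ y, ‖f z y‖ₑ ∂(total ν)) ^ 2 < ∞

/-- The functional `M` on `L²(ℝ²ᵐ; C₀(ℝᵈ × 𝕊ᵈ))` is `f(p, q, x, ξ) dν(x, ξ)`: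
`M Φ = ∫_{ℝ²ᵐ} ∫_{ℝᵈ × 𝕊ᵈ} Φ f dν dp dq` for all `Φ`, the integral being absolutely convergent. -/
def IsRepresentedBy {d m : ℕ} (M : TestSpace d m →L[ℂ] ℂ) (f : E m × E m → E d × S d → ℂ)
    (ν : Kernel (E d) (S d)) : Prop :=
  ∀ Φ : TestSpace d m,
    Integrable (fun w : (E m × E m) × (E d × S d) => Φ w.1 w.2 * f w.1 w.2)
      ((volume : Measure (E m × E m)).prod (total ν)) ∧
    M Φ = ∫ z : E m × E m, ∫ y, Φ z y * f z y ∂(total ν)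

end HMeasure

end

/-! Integrating out `ξ₀` turns `ψ(ξ/|ξ|) φ(ξ₀)` into a bounded multiplier `symMul` in `(t, ξ')`.
Since `uₙ → 0` strongly in `t` and weakly in `(x, λ)`, bounded frequencies `ξ'` do not contribute to
the limit. For large `|ξ'|` the direction of `(ξ₀, ξ')` is close to that of `(0, ξ')`, so the
multiplier is close to `𝓕φ(t) ψ((0, ξ')/|ξ'|)` (`exists_norm_symMul_sub_le`,
`tendsto_integral_vanishing_multiplier`). Hence `φ` enters the limit only through `𝓕φ(t)`. If the
limit object keeps `t` as a variable, one subsequence serves all `φ`.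

The limit object is a positive measure which also remembers the profile in `p`. A wave packet
transform assigns to each `(ω, t, ξ, z)` a function of `p`. Its square norm, with an integrable
weight `W(p)`, is used as a density, and its coefficients in an orthonormal basis of `L²(ℝᵐ)`,
weighted and normalised by that density, form a point of a compact set. The push-forwards are
measures on one compact part of `State d ι`, so weak limits exist, and the correlation of two
coefficients is the integral of a continuous function. Three bounds survive the limit. The `L^∞`
bound and the integrability of `W` dominate the marginal in `x` by Lebesgue measure; the
normalisation bounds the profile on every ball in `p`; the `L²` bound controls the unweighted
energy.

The window is a trigonometric polynomial with frequencies in a box of a lattice. Correlations of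
packets are therefore exact finite sums of correlations of Fourier transforms
(`integral_packet_mul_conj`). Asymptotically these agree with the wanted amplitude up to a factor
which tends to `1` as the box grows (`exists_subseq_amplitude`).

By `exists_superposition` the coefficients of a point of the state space are those of a function
`F(X, ·)`, with `F` in `L²(N × ℝᵐ)`. The limit for `φ₁, φ₂` is the integral of `𝓕φ(t) ψ(ξ) (∫ φ₁ F
dp) conj (∫ φ₂ F dq)` against `N`. This is checked for Fourier modes times basis functions and
extended by density and uniform bounds (`IsTameSeq.exists_profile`).

Finally `ν` disintegrates the marginal of `N` in `(x, ξ)`, and `f(p, q, ·)` is the conditional mean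
of `𝓕φ(t) F(X, p) conj F(X, q)` given `(x, ξ)` (`IsProfile.isDensity`,
`IsProfile.integrable_and_integral_eq`). As only the products `φ₁ uₙ` are supported in a compact set
of `p`, `F` is restricted to the points at which some `uₙ` is active; there `φ₁` itself may be cut
off. -/

namespace HMeasure

/-! ### Plancherel's theorem for Fourier integrals. -/

section Plancherel

variable {V : Type*} [NormedAddCommGroup V] [InnerProductSpace ℝ V] [FiniteDimensional ℝ V]
  [MeasurableSpace V] [BorelSpace V]

/-- The Fourier integral of an `L¹ ∩ L²` function represents its `L²` Fourier transform. -/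
theorem fourier_ae_eq_fourier_toLp {f : V → ℂ} (hf : Integrable f) (hf2 : MemLp f 2) :
    𝓕 f =ᵐ[volume] (𝓕 (hf2.toLp f) : Lp ℂ 2 (volume : Measure V)) := by
  have hcont : Continuous (𝓕 f) :=
    VectorFourier.fourierIntegral_continuous Real.continuous_fourierChar
      (by exact continuous_inner) hf
  have h1 : LocallyIntegrable (𝓕 f) := hcont.locallyIntegrable
  have h2 : LocallyIntegrable
      ((𝓕 (hf2.toLp f) : Lp ℂ 2 (volume : Measure V)) : V → ℂ) volume :=
    (Lp.memLp _).locallyIntegrable (by norm_num)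
  -- It suffices to test against smooth compactly supported `g`. The `L¹` transform is moved onto
  -- `g` by the multiplication formula `e2`, the `L²` transform by its compatibility with tempered
  -- distributions `e`.
  refine ae_eq_of_integral_contDiff_smul_eq h1 h2 fun g hg hgc => ?_
  let G0 : V → ℂ := fun x => (g x : ℂ)
  have hG0 : ContDiff ℝ ((⊤ : ℕ∞) : WithTop ℕ∞) G0 := Complex.ofRealCLM.contDiff.comp hg
  have hG0c : HasCompactSupport G0 := hgc.comp_left (g := Complex.ofReal) (by simp)
  let G : SchwartzMap V ℂ := hG0c.toSchwartzMap hG0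
  have e := congrArg (fun D => D G) (Lp.fourier_toTemperedDistribution_eq (hf2.toLp f))
  simp only [TemperedDistribution.fourier_apply, Lp.toTemperedDistribution_apply] at e
  have e2 : ∫ ξ, 𝓕 f ξ * G ξ = ∫ x, f x * 𝓕 (G : V → ℂ) x := by
    have := VectorFourier.integral_fourierIntegral_smul_eq_flip (μ := (volume : Measure V))
      (ν := (volume : Measure V)) (L := innerₗ V)
      Real.continuous_fourierChar (by exact continuous_inner) hf G.integrable
    simpa [Real.fourier_eq, VectorFourier.fourierIntegral, real_inner_comm] using this
  have e3 : ∫ x, 𝓕 (G : V → ℂ) x * f x = ∫ x, (𝓕 G) x • (hf2.toLp f : V → ℂ) x := by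
    refine integral_congr_ae ?_
    filter_upwards [hf2.coeFn_toLp] with x hx
    simp [hx, SchwartzMap.fourier_coe]
  calc ∫ x, g x • 𝓕 f x = ∫ ξ, 𝓕 f ξ * G ξ := by
        refine integral_congr_ae (Eventually.of_forall fun x => ?_)
        simp [G, G0, mul_comm]
    _ = ∫ x, 𝓕 (G : V → ℂ) x * f x := by rw [e2]; simp_rw [mul_comm]
    _ = _ := by
        rw [e3, e]
        refine integral_congr_ae (Eventually.of_forall fun x => ?_)
        simp [G, G0]

theorem lintegral_enorm_sq_eq_eLpNorm_sq {α E : Type*} [MeasurableSpace α] [NormedAddCommGroup E]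
    (μ : Measure α) (f : α → E) : ∫⁻ x, ‖f x‖ₑ ^ 2 ∂μ = eLpNorm f 2 μ ^ 2 := by
  rw [eLpNorm_eq_lintegral_rpow_enorm_toReal (by norm_num) (by norm_num), ← ENNReal.rpow_natCast,
    ← ENNReal.rpow_mul]
  simp

/-- Plancherel's theorem for `L¹ ∩ L²` functions. -/
theorem lintegral_enorm_sq_fourier {f : V → ℂ} (hf : Integrable f) (hf2 : MemLp f 2) :
    ∫⁻ ξ, ‖𝓕 f ξ‖ₑ ^ 2 = ∫⁻ x, ‖f x‖ₑ ^ 2 := by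
  rw [lintegral_enorm_sq_eq_eLpNorm_sq, lintegral_enorm_sq_eq_eLpNorm_sq,
    eLpNorm_congr_ae (fourier_ae_eq_fourier_toLp hf hf2),
    ← eLpNorm_congr_ae hf2.coeFn_toLp, ← Lp.enorm_def, ← Lp.enorm_def]
  congr 1
  rw [← ofReal_norm, ← ofReal_norm, Lp.norm_fourier_eq]

end Plancherel

/-! ### The Cauchy–Schwarz inequality for lower integrals. -/

section CauchySchwarz

variable {α : Type*} [MeasurableSpace α] {μ : Measure α}

theorem sq_lintegral_mul_le {f g : α → ℝ≥0∞} (hf : AEMeasurable f μ) (hg : AEMeasurable g μ) :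
    (∫⁻ x, f x * g x ∂μ) ^ 2 ≤ (∫⁻ x, f x ^ 2 ∂μ) * ∫⁻ x, g x ^ 2 ∂μ := by
  have h := ENNReal.lintegral_mul_le_Lp_mul_Lq μ Real.HolderConjugate.two_two hf hg
  calc (∫⁻ x, f x * g x ∂μ) ^ 2
      ≤ ((∫⁻ x, f x ^ (2 : ℝ) ∂μ) ^ (1 / (2 : ℝ)) * (∫⁻ x, g x ^ (2 : ℝ) ∂μ) ^ (1 / (2 : ℝ))) ^ 2 := by
        gcongr; simpa using h
    _ = _ := by
        rw [mul_pow, ← ENNReal.rpow_natCast, ← ENNReal.rpow_natCast, ← ENNReal.rpow_mul,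
          ← ENNReal.rpow_mul]
        simp

theorem sq_setLIntegral_le {f : α → ℝ≥0∞} {s : Set α} (hf : AEMeasurable f (μ.restrict s)) :
    (∫⁻ x in s, f x ∂μ) ^ 2 ≤ μ s * ∫⁻ x in s, f x ^ 2 ∂μ := by
  have := sq_lintegral_mul_le (μ := μ.restrict s) (f := fun _ => 1) aemeasurable_const hf
  simpa using this

end CauchySchwarz


/-! ### Convergence of bounded sesquilinear maps. -/

section Sesquilinear

theorem tendsto_of_forall_approx {α F : Type*} [SeminormedAddCommGroup F] {l : Filter α} {a : α → F}
    {b : F} (h : ∀ ε > 0, ∃ (a' : α → F) (b' : F), Tendsto a' l (𝓝 b') ∧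
      (∀ n, ‖a n - a' n‖ ≤ ε) ∧ ‖b - b'‖ ≤ ε) : Tendsto a l (𝓝 b) := by
  rw [Metric.tendsto_nhds]
  intro ε hε
  obtain ⟨a', b', ht, ha, hb⟩ := h (ε / 4) (by positivity)
  filter_upwards [Metric.tendsto_nhds.1 ht (ε / 4) (by positivity)] with n hn
  rw [dist_eq_norm] at hn ⊢
  calc ‖a n - b‖ = ‖(a n - a' n) + (a' n - b') - (b - b')‖ := by congr 1; abel
    _ ≤ ‖a n - a' n‖ + ‖a' n - b'‖ + ‖b - b'‖ :=
        (norm_sub_le _ _).trans (by gcongr; exact norm_add_le _ _)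
    _ < ε := by linarith [ha n]

/-- A sesquilinear map bounded by `C`. -/
structure IsBddSesq {H : Type*} [NormedAddCommGroup H] [NormedSpace ℂ H] (b : H → H → ℂ)
    (C : ℝ) : Prop where
  add_left : ∀ x y z, b (x + y) z = b x z + b y z
  smul_left : ∀ (c : ℂ) x z, b (c • x) z = c * b x z
  add_right : ∀ x y z, b x (y + z) = b x y + b x z
  smul_right : ∀ (c : ℂ) x z, b x (c • z) = conj c * b x z
  bound : ∀ x y, ‖b x y‖ ≤ C * ‖x‖ * ‖y‖

variable {H : Type*} [NormedAddCommGroup H] [NormedSpace ℂ H]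

theorem IsBddSesq.sub_left {b : H → H → ℂ} {C : ℝ} (h : IsBddSesq b C) (x y z : H) :
    b (x - y) z = b x z - b y z := by
  have := h.add_left x ((-1 : ℂ) • y) z
  rw [h.smul_left] at this
  rw [sub_eq_add_neg, ← neg_one_smul ℂ y, this]; ring

theorem IsBddSesq.sub_right {b : H → H → ℂ} {C : ℝ} (h : IsBddSesq b C) (x y z : H) :
    b x (y - z) = b x y - b x z := by
  have := h.add_right x y ((-1 : ℂ) • z)
  rw [h.smul_right] at this
  rw [sub_eq_add_neg, ← neg_one_smul ℂ z, this]; simp; ring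

/-- Uniformly bounded sesquilinear maps which converge on a set with dense span converge
everywhere. -/
theorem IsBddSesq.tendsto_of_dense {b : ℕ → H → H → ℂ} {b' : H → H → ℂ} {C : ℝ}
    (h : ∀ n, IsBddSesq (b n) C) (h' : IsBddSesq b' C) {G : Set H}
    (hG : Dense (Submodule.span ℂ G : Set H))
    (ht : ∀ x ∈ G, ∀ y ∈ G, Tendsto (fun n => b n x y) atTop (𝓝 (b' x y))) (x y : H) :
    Tendsto (fun n => b n x y) atTop (𝓝 (b' x y)) := by
  have hδ : ∀ (z : H) (ε : ℝ), 0 < ε → ∃ δ > 0, C * δ * ‖z‖ ≤ ε := by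
    intro z ε hε
    refine ⟨ε / ((|C| + 1) * (‖z‖ + 1)), by positivity, ?_⟩
    have h1 : C * ‖z‖ ≤ (|C| + 1) * (‖z‖ + 1) := by
      calc C * ‖z‖ ≤ |C| * ‖z‖ := by gcongr; exact le_abs_self C
        _ ≤ _ := by gcongr <;> linarith
    calc C * (ε / ((|C| + 1) * (‖z‖ + 1))) * ‖z‖ = ε * ((C * ‖z‖) / ((|C| + 1) * (‖z‖ + 1))) := by
          ring
      _ ≤ ε * 1 := by
          gcongr
          exact div_le_one_of_le₀ h1 (by positivity)
      _ = ε := mul_one ε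
  -- The sign of `C` is not prescribed; a negative `C` forces every vector to be zero.
  have hC : ∀ (δ : ℝ) (z : H) , 0 ≤ C ∨ ‖z‖ = 0 := by
    intro δ z
    by_contra! hh
    have := (norm_nonneg _).trans (h'.bound z z)
    have h3 : 0 < ‖z‖ := lt_of_le_of_ne (norm_nonneg _) (Ne.symm hh.2)
    nlinarith [mul_pos h3 h3]
  have hb : ∀ (g : H → H → ℂ), IsBddSesq g C → ∀ x z δ ε, C * δ * ‖z‖ ≤ ε → ‖x‖ ≤ δ → 0 ≤ ε →
      ‖g x z‖ ≤ ε ∧ ‖g z x‖ ≤ ε := by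
    intro g hg x z δ ε h1 h2 h3
    rcases hC δ z with hc | hc
    · have : C * ‖x‖ * ‖z‖ ≤ ε := le_trans (by gcongr) h1
      refine ⟨(hg.bound x z).trans this, (hg.bound z x).trans (le_of_eq_of_le (by ring) this)⟩
    · refine ⟨(hg.bound x z).trans ?_, (hg.bound z x).trans ?_⟩ <;> simp [hc, h3]
  -- One argument at a time: with `y` in `G` the other argument passes from `G` to its span and to
  -- the closure, after which the same is done in `y`.
  have hleft : ∀ y ∈ G, ∀ x, Tendsto (fun n => b n x y) atTop (𝓝 (b' x y)) := by
    intro y hy x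
    have hspan : ∀ x ∈ Submodule.span ℂ G, Tendsto (fun n => b n x y) atTop (𝓝 (b' x y)) := by
      intro x hx
      induction hx using Submodule.span_induction with
      | mem x hx => exact ht x hx y hy
      | zero =>
        have : ∀ (g : H → H → ℂ), IsBddSesq g C → g 0 y = 0 := fun g hg => by
          simpa using hg.smul_left 0 0 y
        simp [this _ h', this _ (h _)]
      | add u v _ _ hu hv => simpa only [(h _).add_left, h'.add_left] using hu.add hv
      | smul c u _ hu => simpa only [(h _).smul_left, h'.smul_left] using hu.const_mul c
    refine tendsto_of_forall_approx fun ε hε => ?_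
    obtain ⟨δ, hδ0, hδ⟩ := hδ y ε hε
    obtain ⟨x', hx', hd⟩ := Metric.mem_closure_iff.1 (hG x) δ hδ0
    rw [dist_eq_norm] at hd
    refine ⟨_, _, hspan x' hx', fun n => ?_, ?_⟩
    · rw [← (h n).sub_left]; exact (hb _ (h n) _ _ _ _ hδ hd.le hε.le).1
    · rw [← h'.sub_left]; exact (hb _ h' _ _ _ _ hδ hd.le hε.le).1
  have hspan : ∀ y ∈ Submodule.span ℂ G, Tendsto (fun n => b n x y) atTop (𝓝 (b' x y)) := by
    intro y hy
    induction hy using Submodule.span_induction with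
    | mem y hy => exact hleft y hy x
    | zero =>
      have : ∀ (g : H → H → ℂ), IsBddSesq g C → g x 0 = 0 := fun g hg => by
        simpa using hg.smul_right 0 x 0
      simp [this _ h', this _ (h _)]
    | add u v _ _ hu hv => simpa only [(h _).add_right, h'.add_right] using hu.add hv
    | smul c u _ hu => simpa only [(h _).smul_right, h'.smul_right] using hu.const_mul (conj c)
  refine tendsto_of_forall_approx fun ε hε => ?_
  obtain ⟨δ, hδ0, hδ⟩ := hδ x ε hε
  obtain ⟨y', hy', hd⟩ := Metric.mem_closure_iff.1 (hG y) δ hδ0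
  rw [dist_eq_norm] at hd
  refine ⟨_, _, hspan y' hy', fun n => ?_, ?_⟩
  · rw [← (h n).sub_right]; exact (hb _ (h n) _ _ _ _ hδ hd.le hε.le).2
  · rw [← h'.sub_right]; exact (hb _ h' _ _ _ _ hδ hd.le hε.le).2

end Sesquilinear

/-! ### Weak compactness of measures on a compact space. -/

section Compactness

variable {X : Type*} [TopologicalSpace X] [CompactSpace X] [TopologicalSpace.MetrizableSpace X]
  [MeasurableSpace X] [BorelSpace X]

/-- Simultaneous extraction of weak limits, for countably many sequences of measures of bounded
mass on a compact metrizable space. -/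
theorem exists_subseq_tendsto_integral (μ : ℕ → ℕ → Measure X) (C : ℝ)
    [∀ n j, IsFiniteMeasure (μ n j)] (hC : ∀ n j, (μ n j).real univ ≤ C) :
    ∃ σ : ℕ → ℕ, StrictMono σ ∧ ∃ μ' : ℕ → Measure X,
      (∀ j, IsFiniteMeasure (μ' j)) ∧ (∀ j, (μ' j).real univ ≤ C) ∧
      ∀ (j : ℕ) (g : X → ℂ), Continuous g →
        Tendsto (fun n => ∫ x, g x ∂(μ (σ n) j)) atTop (𝓝 (∫ x, g x ∂(μ' j))) := by
  rcases isEmpty_or_nonempty X with hX | hX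
  · refine ⟨id, strictMono_id, fun _ => 0, fun j => inferInstance, fun j => ?_, fun j g hg => ?_⟩
    · simpa using measureReal_nonneg.trans (hC 0 0)
    · have : ∀ n j, μ n j = 0 := fun n j => Measure.eq_zero_of_isEmpty _
      simp [this]
  let _ : MetricSpace X := TopologicalSpace.metrizableSpaceMetric X
  let F : ℕ → ℕ → FiniteMeasure X := fun n j => ⟨μ n j, inferInstance⟩
  -- Masses and normalised measures lie in a countable product of compact metrizable spaces, so one
  -- extraction serves all `j`. The normalisation of a zero measure is arbitrary, which is harmless
  -- because its mass multiplies it.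
  let x : ℕ → (ℕ → Icc (0 : ℝ) C × ProbabilityMeasure X) := fun n j =>
    (⟨(μ n j).real univ, measureReal_nonneg, hC n j⟩, (F n j).normalize)
  obtain ⟨a, σ, hσ, ha⟩ := SeqCompactSpace.tendsto_subseq x
  rw [tendsto_pi_nhds] at ha
  refine ⟨σ, hσ, fun j => ENNReal.ofReal (a j).1 • ((a j).2 : Measure X), fun j => ?_, fun j => ?_,
    fun j g hg => ?_⟩
  · exact Measure.smul_finite _ ENNReal.ofReal_ne_top
  · simpa [measureReal_def, (a j).1.2.1] using (a j).1.2.2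
  · have h1 : Tendsto (fun n => (μ (σ n) j).real univ) atTop (𝓝 ((a j).1 : ℝ)) :=
      (continuous_subtype_val.comp continuous_fst).continuousAt.tendsto.comp (ha j)
    have h2 : Tendsto (fun n => (F (σ n) j).normalize) atTop (𝓝 (a j).2) :=
      continuous_snd.continuousAt.tendsto.comp (ha j)
    have h3 := (ProbabilityMeasure.tendsto_iff_forall_integral_rclike_tendsto ℂ).1 h2
      (BoundedContinuousFunction.mkOfCompact ⟨g, hg⟩)
    have h4 := (Complex.continuous_ofReal.continuousAt.tendsto.comp h1).mul h3
    have h5 : ∀ n, ∫ x, g x ∂(μ n j) = ((μ n j).real univ : ℂ) *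
        ∫ x, g x ∂((F n j).normalize : Measure X) := by
      intro n
      have e : (μ n j) = (((F n j).mass • (F n j).normalize.toFiniteMeasure : FiniteMeasure X) :
          Measure X) := by
        rw [← FiniteMeasure.self_eq_mass_smul_normalize]; rfl
      conv_lhs => rw [e]
      rw [FiniteMeasure.toMeasure_smul, integral_smul_nnreal_measure]
      rfl
    simp only [h5, integral_smul_measure, ENNReal.toReal_ofReal (a j).1.2.1]
    exact h4

end Compactness

/-! ### Disintegration over Lebesgue measure. -/

section Disintegration

/-- A finite measure on a product whose first marginal is absolutely continuous is disintegrated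
by a locally integrable family of finite measures. -/
theorem exists_kernel_total_eq {d : ℕ} (μ : Measure (E d × S d)) [IsFiniteMeasure μ]
    (h : μ.fst ≪ volume) :
    ∃ ν : Kernel (E d) (S d), IsLocIntegrableFamily ν ∧ total ν = μ := by
  have : Nonempty (S d) := by
    have : Nontrivial (E (d + 1)) := inferInstance
    exact (NormedSpace.sphere_nonempty (x := (0 : E (d+1))) (r := 1)).2 zero_le_one |>.to_subtype
  -- Passing through `toReal` makes the density finite at every point, so that every `ν x` is a
  -- finite measure; it changes the derivative on a null set only.
  let r : E d → ℝ≥0∞ := fun x => ENNReal.ofReal (μ.fst.rnDeriv volume x).toReal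
  have hr : Measurable r := (Measure.measurable_rnDeriv _ _).ennreal_toReal.ennreal_ofReal
  have hr2 : Measurable (Function.uncurry fun (x : E d) (_ : S d) => r x) := hr.comp measurable_fst
  let ν : Kernel (E d) (S d) := Kernel.withDensity μ.condKernel (fun x _ => r x)
  have hae : r =ᵐ[volume] μ.fst.rnDeriv volume := by
    filter_upwards [Measure.rnDeriv_lt_top μ.fst volume] with x hx
    exact ENNReal.ofReal_toReal hx.ne
  have hfst : (volume : Measure (E d)).withDensity r = μ.fst := by
    rw [withDensity_congr_ae hae, Measure.withDensity_rnDeriv_eq _ _ h]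
  have hν : ∀ x, ν x = r x • μ.condKernel x := fun x => by
    rw [Kernel.withDensity_apply _ hr2, withDensity_const]
  have htot : total ν = μ := by
    rw [total]
    conv_rhs => rw [← μ.disintegrate μ.condKernel, ← hfst]
    have : IsSFiniteKernel ν := Kernel.IsSFiniteKernel.withDensity _ (fun _ _ => ENNReal.ofReal_ne_top)
    ext s hs
    have hm : Measurable fun x => μ.condKernel x (Prod.mk x ⁻¹' s) :=
      Kernel.measurable_kernel_prodMk_left hs
    rw [Measure.compProd_apply hs, Measure.compProd_apply hs,
      lintegral_withDensity_eq_lintegral_mul _ hr hm]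
    simp [hν]
  have hfin : ∀ x, ν x univ = r x := fun x => by simp [hν]
  refine ⟨ν, ⟨Kernel.IsSFiniteKernel.withDensity _ (fun _ _ => ENNReal.ofReal_ne_top), fun x => ⟨by simp [hfin, r]⟩, fun C _ => ?_⟩, htot⟩
  simp only [hfin]
  refine (setLIntegral_le_lintegral _ _).trans_lt ?_
  rw [← setLIntegral_univ, ← withDensity_apply _ MeasurableSet.univ, hfst]
  exact measure_lt_top _ _

end Disintegration


/-! ### Directions of frequencies and the multiplier in `(t, ξ')`. -/

section Direction

variable {d : ℕ}

/-- The direction `ξ / |ξ|` of `ξ`, with an arbitrary value at the origin. -/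
noncomputable def sdir (ξ : E (d + 1)) : S d :=
  if h : ξ = 0 then ⟨EuclideanSpace.single 0 1, by simp⟩
  else ⟨‖ξ‖⁻¹ • ξ, by
    have h' : ‖ξ‖ ≠ 0 := norm_ne_zero_iff.mpr h
    simp [norm_smul, h']⟩

theorem coe_sdir {ξ : E (d + 1)} (h : ξ ≠ 0) : (sdir ξ : E (d + 1)) = ‖ξ‖⁻¹ • ξ := by
  simp [sdir, h]

theorem radialSymbol_eq (ψ : S d → ℂ) {ξ : E (d + 1)} (h : ξ ≠ 0) :
    radialSymbol ψ ξ = ψ (sdir ξ) := by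
  simp [radialSymbol, sdir, h]

theorem measurable_sdir : Measurable (sdir : E (d + 1) → S d) := by
  refine (MeasurableEmbedding.subtype_coe Metric.isClosed_sphere.measurableSet).measurable_comp_iff.1 ?_
  have : (fun ξ : E (d + 1) => (sdir ξ : E (d + 1))) =
      fun ξ => if ξ = 0 then EuclideanSpace.single 0 1 else ‖ξ‖⁻¹ • ξ := by
    ext1 ξ
    split_ifs with h
    · simp [sdir, h]
    · exact coe_sdir h
  change Measurable fun ξ : E (d + 1) => (sdir ξ : E (d + 1))
  rw [this]
  exact Measurable.ite (measurableSet_singleton 0) measurable_const (by fun_prop)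

theorem measurable_radialSymbol {ψ : S d → ℂ} (hψ : Continuous ψ) : Measurable (radialSymbol ψ) := by
  have : radialSymbol ψ = fun ξ => if ξ = 0 then 0 else ψ (sdir ξ) := by
    ext1 ξ
    split_ifs with h
    · simp [radialSymbol, h]
    · exact radialSymbol_eq ψ h
  rw [this]
  exact Measurable.ite (measurableSet_singleton 0) measurable_const
    (hψ.measurable.comp measurable_sdir)

theorem exists_bound_sphere {ψ : S d → ℂ} (hψ : Continuous ψ) : ∃ C, 0 ≤ C ∧ ∀ ξ, ‖ψ ξ‖ ≤ C := by
  obtain ⟨C, hC⟩ := isCompact_univ.exists_bound_of_continuousOn hψ.continuousOn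
  exact ⟨max C 0, le_max_right _ _, fun ξ => (hC ξ (mem_univ _)).trans (le_max_left _ _)⟩

theorem norm_radialSymbol_le {ψ : S d → ℂ} {C : ℝ} (hC : 0 ≤ C) (h : ∀ ξ, ‖ψ ξ‖ ≤ C)
    (ξ : E (d + 1)) : ‖radialSymbol ψ ξ‖ ≤ C := by
  by_cases h0 : ξ = 0
  · simpa [radialSymbol, h0] using hC
  · rw [radialSymbol_eq ψ h0]; exact h _

/-- The difference `a/|a| - b/|b|` splits into `(a - b)/|a|` and a multiple of `b/|b|` of length
`||b| - |a|| / |a|`; each is at most `|a - b|/|a|`. -/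
theorem dist_sdir_le {a b : E (d + 1)} (ha : a ≠ 0) (hb : b ≠ 0) :
    dist (sdir a) (sdir b) ≤ 2 * ‖a - b‖ / ‖a‖ := by
  have ha' : 0 < ‖a‖ := norm_pos_iff.2 ha
  have hb' : 0 < ‖b‖ := norm_pos_iff.2 hb
  rw [Subtype.dist_eq, coe_sdir ha, coe_sdir hb, dist_eq_norm]
  have e : ‖a‖⁻¹ • a - ‖b‖⁻¹ • b = ‖a‖⁻¹ • (a - b) + ((‖b‖ - ‖a‖) * (‖a‖⁻¹ * ‖b‖⁻¹)) • b := by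
    have : (‖b‖ - ‖a‖) * (‖a‖⁻¹ * ‖b‖⁻¹) = ‖a‖⁻¹ - ‖b‖⁻¹ := by field_simp
    rw [this, smul_sub, sub_smul]; abel
  rw [e]
  refine (norm_add_le _ _).trans ?_
  rw [norm_smul, norm_smul, norm_inv, norm_norm, norm_mul, norm_mul, norm_inv, norm_inv, norm_norm,
    norm_norm]
  have h1 : ‖‖b‖ - ‖a‖‖ ≤ ‖a - b‖ := by rw [norm_sub_rev a b]; exact abs_norm_sub_norm_le b a
  calc _ = ‖a - b‖ / ‖a‖ + ‖‖b‖ - ‖a‖‖ / ‖a‖ := by field_simp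
    _ ≤ ‖a - b‖ / ‖a‖ + ‖a - b‖ / ‖a‖ := by gcongr
    _ = _ := by ring

theorem norm_joinFreq_sq (a : ℝ) (ξ : E d) : ‖joinFreq a ξ‖ ^ 2 = a ^ 2 + ‖ξ‖ ^ 2 := by
  simp [joinFreq, EuclideanSpace.norm_sq_eq, Fin.sum_univ_succ]

theorem norm_le_norm_joinFreq (a : ℝ) (ξ : E d) : ‖ξ‖ ≤ ‖joinFreq a ξ‖ := by
  refine abs_le_of_sq_le_sq' ?_ (norm_nonneg _) |>.2
  rw [norm_joinFreq_sq]; nlinarith [sq_nonneg a]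

theorem joinFreq_sub (a b : ℝ) (ξ η : E d) :
    joinFreq a ξ - joinFreq b η = joinFreq (a - b) (ξ - η) := by
  ext i
  refine Fin.cases ?_ (fun i => ?_) i <;> simp [joinFreq]

theorem continuous_joinFreq : Continuous fun w : ℝ × E d => joinFreq w.1 w.2 := by
  refine (PiLp.continuous_toLp 2 _).comp (continuous_pi fun i => ?_)
  refine Fin.cases ?_ (fun i => ?_) i
  · simpa using continuous_fst
  · simp only [Fin.cons_succ]; fun_prop

/-- The multiplier in `t` and `ξ'` that is obtained by integrating out the frequency `ξ₀`. -/
noncomputable def symMul (φ : ℝ → ℂ) (ψ : S d → ℂ) (t : ℝ) (ξ : E d) : ℂ :=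
  ∫ ξ₀ : ℝ, (𝐞 (-(ξ₀ * t)) : ℂ) * (radialSymbol ψ (joinFreq ξ₀ ξ) * φ ξ₀)

theorem norm_symMul_le {φ : ℝ → ℂ} {ψ : S d → ℂ} {C : ℝ} (hφ : Integrable φ) (hC : 0 ≤ C)
    (h : ∀ ξ, ‖ψ ξ‖ ≤ C) (t : ℝ) (ξ : E d) : ‖symMul φ ψ t ξ‖ ≤ C * ∫ x, ‖φ x‖ := by
  rw [symMul, ← integral_const_mul]
  refine norm_integral_le_of_norm_le (hφ.norm.const_mul C) (Eventually.of_forall fun x => ?_)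
  rw [norm_mul, Circle.norm_coe, one_mul, norm_mul]
  gcongr
  exact norm_radialSymbol_le hC h _

/-- A bounded time frequency and a bounded shift move the frequency by at most `|a| + |τ|`, which is
negligible against `|ξ|`. -/
theorem tendsto_dist_sdir_joinFreq (a : ℝ) (τ : E d) :
    Tendsto (fun ξ : E d => dist (sdir (joinFreq a ξ)) (sdir (joinFreq 0 (ξ + τ))))
      (Bornology.cobounded (E d)) (𝓝 0) := by
  have h1 : Tendsto (fun ξ : E d => 2 * (|a| + ‖τ‖) / ‖ξ‖) (Bornology.cobounded (E d)) (𝓝 0) :=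
    tendsto_const_nhds.div_atTop tendsto_norm_cobounded_atTop
  refine squeeze_zero' (Eventually.of_forall fun _ => dist_nonneg) ?_ h1
  filter_upwards [tendsto_norm_cobounded_atTop.eventually (eventually_gt_atTop ‖τ‖)] with ξ hξ
  have h0 : 0 < ‖ξ‖ := (norm_nonneg _).trans_lt hξ
  have hj : ‖ξ‖ ≤ ‖joinFreq a ξ‖ := norm_le_norm_joinFreq a ξ
  have hA : joinFreq a ξ ≠ 0 := norm_pos_iff.1 (h0.trans_le hj)
  have hB : joinFreq 0 (ξ + τ) ≠ 0 := by
    refine norm_pos_iff.1 (lt_of_lt_of_le ?_ (norm_le_norm_joinFreq 0 (ξ + τ)))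
    have := norm_sub_norm_le ξ (-τ)
    rw [norm_neg, sub_neg_eq_add] at this
    linarith
  refine (dist_sdir_le hA hB).trans ?_
  have h2 : ‖joinFreq a ξ - joinFreq 0 (ξ + τ)‖ ≤ |a| + ‖τ‖ := by
    rw [joinFreq_sub]
    refine abs_le_of_sq_le_sq' ?_ (by positivity) |>.2
    rw [norm_joinFreq_sq]
    have e : ‖ξ - (ξ + τ)‖ = ‖τ‖ := by rw [sub_add_cancel_left, norm_neg]
    rw [e, sub_zero, ← sq_abs a]
    nlinarith [mul_nonneg (abs_nonneg a) (norm_nonneg τ)]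
  gcongr

/-- Dominated convergence in `ξ₀` with majorant a multiple of `|φ|`: for fixed `ξ₀` the direction of
`(ξ₀, ξ)` approaches that of `(0, ξ + τ)`, and `ψ` is uniformly continuous on the sphere. The
estimate is uniform in `t` because the oscillating factor has modulus one. The shift `τ` allows
correlations of translated transforms to be compared. -/
theorem exists_norm_symMul_sub_le {φ : ℝ → ℂ} {ψ : S d → ℂ} (hφ : Integrable φ) (hψ : Continuous ψ)
    (τ : E d) {ε : ℝ} (hε : 0 < ε) :
    ∃ R : ℝ, ∀ (t : ℝ) (ξ : E d), R ≤ ‖ξ‖ →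
      ‖symMul φ ψ t ξ - 𝓕 φ t * ψ (sdir (joinFreq 0 (ξ + τ)))‖ ≤ ε := by
  obtain ⟨C, hC0, hC⟩ := exists_bound_sphere hψ
  have hmeas : ∀ ξ : E d, Measurable fun ξ₀ : ℝ => ψ (sdir (joinFreq ξ₀ ξ)) := fun ξ =>
    hψ.measurable.comp (measurable_sdir.comp
      (continuous_joinFreq.comp (Continuous.prodMk_left ξ)).measurable)
  have hmeas2 : ∀ ξ : E d, Measurable fun ξ₀ : ℝ => radialSymbol ψ (joinFreq ξ₀ ξ) := fun ξ =>
    (measurable_radialSymbol hψ).comp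
      (continuous_joinFreq.comp (Continuous.prodMk_left ξ)).measurable
  -- Dominated convergence along a filter requires a countable basis.
  have hcg : (Bornology.cobounded (E d)).IsCountablyGenerated := by
    rw [← comap_norm_atTop]; infer_instance
  have hlim : Tendsto (fun ξ : E d => ∫ ξ₀ : ℝ,
      ‖ψ (sdir (joinFreq ξ₀ ξ)) - ψ (sdir (joinFreq 0 (ξ + τ)))‖ * ‖φ ξ₀‖)
      (Bornology.cobounded (E d)) (𝓝 (∫ _ : ℝ, (0 : ℝ))) := by
    refine tendsto_integral_filter_of_dominated_convergence (fun x => (2 * C) * ‖φ x‖) ?_ ?_ ?_ ?_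
    · refine Eventually.of_forall fun ξ => ?_
      exact (((hmeas ξ).sub_const _).norm.aestronglyMeasurable).mul hφ.1.norm
    · refine Eventually.of_forall fun ξ => Eventually.of_forall fun x => ?_
      rw [norm_mul, norm_norm, norm_norm]
      gcongr
      have h1 := hC (sdir (joinFreq x ξ))
      have h2 := hC (sdir (joinFreq 0 (ξ + τ)))
      exact (norm_sub_le _ _).trans (by linarith)
    · exact hφ.norm.const_mul _
    · refine Eventually.of_forall fun x => ?_
      have hu := CompactSpace.uniformContinuous_of_continuous hψ
      have h2 : Tendsto (fun ξ : E d =>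
          ‖ψ (sdir (joinFreq x ξ)) - ψ (sdir (joinFreq 0 (ξ + τ)))‖)
          (Bornology.cobounded (E d)) (𝓝 0) := by
        rw [Metric.tendsto_nhds]
        intro δ hδ
        obtain ⟨η, hη, hd⟩ := Metric.uniformContinuous_iff.1 hu δ hδ
        filter_upwards [Metric.tendsto_nhds.1 (tendsto_dist_sdir_joinFreq x τ) η hη] with ξ hξ
        rw [dist_zero_right, Real.norm_of_nonneg dist_nonneg] at hξ
        simpa [dist_eq_norm] using hd hξ
      simpa using h2.mul_const ‖φ x‖
  rw [integral_zero] at hlim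
  have hev := hlim.eventually (gt_mem_nhds hε)
  have hev2 := hev.and ((tendsto_norm_cobounded_atTop (E := E d)).eventually (eventually_gt_atTop 0))
  obtain ⟨R, -, hR⟩ := (Filter.hasBasis_cobounded_norm (E := E d)).mem_iff.1 hev2
  refine ⟨R, fun t ξ hξ => ?_⟩
  obtain ⟨h1, h2⟩ := hR hξ
  have hint : Integrable fun ξ₀ : ℝ => (𝐞 (-(ξ₀ * t)) : ℂ) * (radialSymbol ψ (joinFreq ξ₀ ξ) * φ ξ₀) := by
    refine (hφ.norm.const_mul C).mono' ?_ (Eventually.of_forall fun x => ?_)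
    · have : Continuous fun ξ₀ : ℝ => (𝐞 (-(ξ₀ * t)) : ℂ) := by fun_prop
      exact this.aestronglyMeasurable.mul ((hmeas2 ξ).aestronglyMeasurable.mul hφ.1)
    · rw [norm_mul, Circle.norm_coe, one_mul, norm_mul]
      gcongr
      exact norm_radialSymbol_le hC0 hC _
  have hint2 : Integrable fun ξ₀ : ℝ => (𝐞 (-(ξ₀ * t)) : ℂ) * φ ξ₀ := by
    refine hφ.norm.mono' ?_ (Eventually.of_forall fun x => ?_)
    · have : Continuous fun ξ₀ : ℝ => (𝐞 (-(ξ₀ * t)) : ℂ) := by fun_prop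
      exact this.aestronglyMeasurable.mul hφ.1
    · rw [norm_mul, Circle.norm_coe, one_mul]
  have e : symMul φ ψ t ξ - 𝓕 φ t * ψ (sdir (joinFreq 0 (ξ + τ))) =
      ∫ ξ₀ : ℝ, (𝐞 (-(ξ₀ * t)) : ℂ) *
        ((ψ (sdir (joinFreq ξ₀ ξ)) - ψ (sdir (joinFreq 0 (ξ + τ)))) * φ ξ₀) := by
    rw [Real.fourier_real_eq, symMul]
    simp_rw [Circle.smul_def, smul_eq_mul]
    rw [← integral_mul_const, ← integral_sub hint (hint2.mul_const _)]
    refine integral_congr_ae (Eventually.of_forall fun x => ?_)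
    have : joinFreq x ξ ≠ 0 := norm_pos_iff.1 (lt_of_lt_of_le h2 (norm_le_norm_joinFreq x ξ))
    simp only [radialSymbol_eq ψ this]
    ring
  rw [e]
  refine (norm_integral_le_integral_norm _).trans (le_trans (le_of_eq ?_) h1.le)
  refine integral_congr_ae (Eventually.of_forall fun x => ?_)
  simp only [norm_mul, Circle.norm_coe, one_mul]

end Direction


/-! ### Multipliers which vanish at infinity. -/

section Multiplier

theorem lintegral_mul_le_sqrt {α : Type*} [MeasurableSpace α] {μ : Measure α} {f g : α → ℝ≥0∞}
    {A B : ℝ≥0∞} (hf : AEMeasurable f μ) (hg : AEMeasurable g μ) (hA : ∫⁻ x, f x ^ 2 ∂μ ≤ A)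
    (hB : ∫⁻ x, g x ^ 2 ∂μ ≤ B) : ∫⁻ x, f x * g x ∂μ ≤ (A * B) ^ (1 / 2 : ℝ) := by
  have h := (sq_lintegral_mul_le hf hg).trans (mul_le_mul' hA hB)
  have h2 := ENNReal.rpow_le_rpow h (show (0 : ℝ) ≤ 1 / 2 by norm_num)
  rwa [← ENNReal.rpow_natCast, ← ENNReal.rpow_mul, show ((2 : ℕ) : ℝ) * (1 / 2) = 1 by norm_num,
    ENNReal.rpow_one] at h2

variable {α : Type*} [MeasurableSpace α] {d : ℕ} {ρ : Measure α}

/-- High frequencies are controlled by the smallness of `μ`, low frequencies by `hlow`;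
Cauchy–Schwarz is used on both parts. -/
theorem tendsto_integral_vanishing_multiplier {f g : ℕ → α × E d → ℂ} {μ : α × E d → ℂ}
    {A B : ℝ≥0∞} {C : ℝ}
    (hf : ∀ n, Measurable (f n)) (hg : ∀ n, Measurable (g n))
    (hA : ∀ n, ∫⁻ w, ‖f n w‖ₑ ^ 2 ∂(ρ.prod volume) ≤ A) (hA' : A ≠ ∞)
    (hB : ∀ n, ∫⁻ w, ‖g n w‖ₑ ^ 2 ∂(ρ.prod volume) ≤ B) (hB' : B ≠ ∞)
    (hC : ∀ w, ‖μ w‖ ≤ C) (hv : ∀ ε > 0, ∃ R : ℝ, ∀ w, R ≤ ‖w.2‖ → ‖μ w‖ ≤ ε)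
    (hlow : ∀ R : ℝ, Tendsto (fun n => ∫⁻ w in {w : α × E d | ‖w.2‖ ≤ R}, ‖f n w‖ₑ ^ 2
      ∂(ρ.prod volume)) atTop (𝓝 0)) :
    Tendsto (fun n => ∫ w, μ w * (f n w * conj (g n w)) ∂(ρ.prod volume)) atTop (𝓝 0) := by
  have hM : (A * B) ^ (1 / 2 : ℝ) ≠ ∞ :=
    ENNReal.rpow_ne_top_of_nonneg (by norm_num) (ENNReal.mul_ne_top hA' hB')
  set M : ℝ≥0∞ := (A * B) ^ (1 / 2 : ℝ) with hMdef
  have hCn : ∀ w, ‖μ w‖ₑ ≤ ENNReal.ofReal C := fun w => by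
    rw [← ofReal_norm]; exact ENNReal.ofReal_le_ofReal (hC w)
  have hsplit : ∀ R δ : ℝ, (∀ w, R ≤ ‖w.2‖ → ‖μ w‖ ≤ δ) → ∀ n,
      ‖∫ w, μ w * (f n w * conj (g n w)) ∂(ρ.prod volume)‖ₑ ≤
      ENNReal.ofReal C * ((∫⁻ w in {w : α × E d | ‖w.2‖ ≤ R}, ‖f n w‖ₑ ^ 2 ∂(ρ.prod volume)) * B) ^
        (1 / 2 : ℝ) + ENNReal.ofReal δ * M := by
    intro R δ hR n
    set L : Set (α × E d) := {w | ‖w.2‖ ≤ R}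
    have hL : MeasurableSet L := measurableSet_le (by fun_prop) measurable_const
    calc _ ≤ ∫⁻ w, ‖μ w‖ₑ * (‖f n w‖ₑ * ‖g n w‖ₑ) ∂(ρ.prod volume) := by
          refine (enorm_integral_le_lintegral_enorm _).trans (le_of_eq ?_)
          refine lintegral_congr fun w => ?_
          rw [enorm_mul, enorm_mul, RCLike.enorm_conj]
      _ ≤ ∫⁻ w, (ENNReal.ofReal C * L.indicator (fun w => ‖f n w‖ₑ * ‖g n w‖ₑ) w +
            ENNReal.ofReal δ * (‖f n w‖ₑ * ‖g n w‖ₑ)) ∂(ρ.prod volume) := by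
          refine lintegral_mono fun w => ?_
          by_cases hw : w ∈ L
          · simp only [indicator_of_mem hw]
            exact le_add_right (by gcongr; exact hCn w)
          · refine le_add_left ?_
            gcongr
            rw [← ofReal_norm]
            exact ENNReal.ofReal_le_ofReal (hR w (not_le.1 hw).le)
      _ = ENNReal.ofReal C * ∫⁻ w in L, ‖f n w‖ₑ * ‖g n w‖ₑ ∂(ρ.prod volume) +
            ENNReal.ofReal δ * ∫⁻ w, ‖f n w‖ₑ * ‖g n w‖ₑ ∂(ρ.prod volume) := by
          have hm : Measurable fun w => ‖f n w‖ₑ * ‖g n w‖ₑ := (hf n).enorm.mul (hg n).enorm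
          rw [lintegral_add_right _ (hm.const_mul _), lintegral_const_mul _ (hm.indicator hL),
            lintegral_const_mul _ hm, lintegral_indicator hL]
      _ ≤ _ := by
          gcongr
          · exact lintegral_mul_le_sqrt (hf n).enorm.aemeasurable (hg n).enorm.aemeasurable le_rfl
              ((setLIntegral_le_lintegral _ _).trans (hB n))
          · exact lintegral_mul_le_sqrt (hf n).enorm.aemeasurable (hg n).enorm.aemeasurable (hA n)
              (hB n)
  rw [Metric.tendsto_nhds]
  intro ε hε
  -- The high-frequency part becomes less than `ε / 2`; the summand `1` covers the case `M = 0`.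
  set δ : ℝ := ε / (2 * (M.toReal + 1)) with hδ
  have hδ0 : 0 < δ := by positivity
  obtain ⟨R, hR⟩ := hv δ hδ0
  have ht : Tendsto (fun n => ENNReal.ofReal C * ((∫⁻ w in {w : α × E d | ‖w.2‖ ≤ R}, ‖f n w‖ₑ ^ 2
      ∂(ρ.prod volume)) * B) ^ (1 / 2 : ℝ)) atTop (𝓝 0) := by
    have h1 := ENNReal.Tendsto.mul_const (hlow R) (b := B) (Or.inr hB')
    have h2 := ENNReal.Tendsto.const_mul (a := ENNReal.ofReal C)
      ((ENNReal.continuous_rpow_const (y := (1 / 2 : ℝ))).continuousAt.tendsto.comp h1)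
      (Or.inr ENNReal.ofReal_ne_top)
    simpa using h2
  filter_upwards [ht.eventually (gt_mem_nhds (ENNReal.ofReal_pos.2 (half_pos hε)))] with n hn
  rw [dist_zero_right]
  have h3 := hsplit R δ hR n
  have h4 : ENNReal.ofReal δ * M < ENNReal.ofReal (ε / 2) := by
    rw [← ENNReal.ofReal_toReal hM, ← ENNReal.ofReal_mul hδ0.le]
    rw [ENNReal.ofReal_lt_ofReal_iff (by positivity), hδ, div_mul_eq_mul_div,
      div_lt_div_iff₀ (by positivity) (by positivity)]
    nlinarith [ENNReal.toReal_nonneg (a := M)]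
  have h5 := h3.trans_lt (ENNReal.add_lt_add hn h4)
  rw [← ENNReal.ofReal_add (by positivity) (by positivity), add_halves, ← ofReal_norm] at h5
  exact (ENNReal.ofReal_lt_ofReal_iff hε).1 h5

end Multiplier

/-! ### An orthonormal basis of `L²(ℝᵐ)` adapted to annuli. -/

section AnnularBasis

theorem inner_toLp_toLp {α : Type*} [MeasurableSpace α] {μ : Measure α} {f g : α → ℂ}
    (hf : MemLp f 2 μ) (hg : MemLp g 2 μ) :
    inner ℂ (hf.toLp f) (hg.toLp g) = ∫ x, conj (f x) * g x ∂μ := by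
  rw [L2.inner_def]
  refine integral_congr_ae ?_
  filter_upwards [hf.coeFn_toLp, hg.coeFn_toLp] with x h1 h2
  rw [h1, h2, RCLike.inner_apply, mul_comm]

theorem enorm_toLp_sq {α : Type*} [MeasurableSpace α] {μ : Measure α} {f : α → ℂ}
    (hf : MemLp f 2 μ) : ENNReal.ofReal (‖hf.toLp f‖ ^ 2) = ∫⁻ x, ‖f x‖ₑ ^ 2 ∂μ := by
  rw [lintegral_enorm_sq_eq_eLpNorm_sq, ENNReal.ofReal_pow (norm_nonneg _), Lp.norm_toLp,
    ENNReal.ofReal_toReal hf.2.ne]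

/-- Orthonormal vectors have mutual distance `√2`, so the balls of radius `1/2` around them are
disjoint open sets in a separable space. -/
theorem countable_of_orthonormal {H ι : Type*} [NormedAddCommGroup H] [InnerProductSpace ℂ H]
    [TopologicalSpace.SeparableSpace H] {v : ι → H} (hv : Orthonormal ℂ v) : Countable ι := by
  have hd : Pairwise (fun i j => Disjoint (Metric.ball (v i) (1 / 2)) (Metric.ball (v j) (1 / 2))) := by
    intro i j hij
    refine Metric.ball_disjoint_ball ?_
    rw [dist_eq_norm]
    have h2 : ‖v i - v j‖ ^ 2 = 2 := by
      rw [@norm_sub_sq ℂ, hv.1 i, hv.1 j, hv.2 hij]; norm_num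
    nlinarith [norm_nonneg (v i - v j)]
  exact Pairwise.countable_of_isOpen_disjoint hd (fun i => Metric.isOpen_ball)
    (fun i => ⟨v i, Metric.mem_ball_self (by norm_num)⟩)

/-- An orthonormal basis `h` of `L²(ℝᵐ)`, where `h i` vanishes off the annulus
`l i ≤ |p| < l i + 1`. -/
structure IsAnnularBasis {m : ℕ} {ι : Type*} (h : ι → E m → ℂ) (l : ι → ℕ) : Prop where
  meas : ∀ i, Measurable (h i)
  memLp : ∀ i, MemLp (h i) 2
  supp : ∀ i p, ⌊‖p‖⌋₊ ≠ l i → h i p = 0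
  norm_one : ∀ i, ∫ p, conj (h i p) * h i p = 1
  orth : ∀ i j, i ≠ j → ∫ p, conj (h i p) * h j p = 0
  bessel : ∀ g : E m → ℂ, MemLp g 2 → ∀ I : Finset ι,
    ∑ i ∈ I, ‖∫ p, conj (h i p) * g p‖ₑ ^ 2 ≤ ∫⁻ p, ‖g p‖ₑ ^ 2
  parseval : ∀ g : E m → ℂ, MemLp g 2 → ∀ (N : ℕ) (M : ℝ≥0∞),
    (∀ I : Finset ι, (∀ i ∈ I, l i < N) → ∑ i ∈ I, ‖∫ p, conj (h i p) * g p‖ₑ ^ 2 ≤ M) →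
    ∫⁻ p in {p | ‖p‖ < N}, ‖g p‖ₑ ^ 2 ≤ M

/-- Hilbert bases of the spaces `L²` of the single annuli are extended by zero and collected. A
weight depending on `⌊‖p‖⌋` only is then a constant on the support of each basis function, and balls
of integer radius are unions of annuli. -/
theorem exists_annularBasis (m : ℕ) :
    ∃ (ι : Type) (_ : Countable ι) (h : ι → E m → ℂ) (l : ι → ℕ), IsAnnularBasis h l := by
  classical
  have : Fact ((2 : ℝ≥0∞) ≠ ∞) := ⟨by norm_num⟩
  let A : ℕ → Set (E m) := fun l => {p | ⌊‖p‖⌋₊ = l}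
  have hA : ∀ l, MeasurableSet (A l) := fun l =>
    (Nat.measurable_floor.comp measurable_norm) (measurableSet_singleton l)
  have hb := fun l => exists_hilbertBasis ℂ (Lp ℂ 2 ((volume : Measure (E m)).restrict (A l)))
  choose w b hb using hb
  have hcw : ∀ l, Countable (w l) := fun l => countable_of_orthonormal (b l).orthonormal
  let h : (Σ l, w l) → E m → ℂ := fun i => (A i.1).indicator (b i.1 i.2)
  have hmeas : ∀ i, Measurable (h i) := fun i =>
    (Lp.stronglyMeasurable _).measurable.indicator (hA i.1)
  have hmem : ∀ i, MemLp (h i) 2 := fun i => (memLp_indicator_iff_restrict (hA i.1)).2 (Lp.memLp _)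
  have hcoef : ∀ (i : Σ l, w l) (g : E m → ℂ) (hg : MemLp g 2),
      ∫ p, conj (h i p) * g p = inner ℂ (b i.1 i.2) ((hg.restrict (A i.1)).toLp g) := by
    intro i g hg
    have h1 : ∀ p, conj (h i p) * g p =
        (A i.1).indicator (fun p => conj (b i.1 i.2 p) * g p) p := by
      intro p
      by_cases hp : p ∈ A i.1 <;> simp [h, hp]
    simp_rw [h1]
    rw [integral_indicator (hA i.1), ← inner_toLp_toLp (Lp.memLp _) (hg.restrict _), Lp.toLp_coeFn]
  have hsupp : ∀ i p, ⌊‖p‖⌋₊ ≠ i.1 → h i p = 0 := fun i p hp =>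
    indicator_of_notMem (show p ∉ A i.1 from hp) _
  have hself : ∀ i j : Σ l, w l, i.1 = j.1 → ∫ p, conj (h i p) * h j p = if i = j then 1 else 0 := by
    rintro ⟨l, i⟩ ⟨l', j⟩ (rfl : l = l')
    rw [hcoef _ _ (hmem _)]
    have : ((hmem ⟨l, j⟩).restrict (A l)).toLp (h ⟨l, j⟩) = b l j := by
      refine Lp.ext ?_
      refine (MemLp.coeFn_toLp _).trans ?_
      filter_upwards [ae_restrict_mem (hA l)] with p hp
      simp [h, hp]
    simp only [this]
    rw [orthonormal_iff_ite.1 (b l).orthonormal]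
    by_cases hij : i = j <;> simp [hij]
  have horth : ∀ i j, i ≠ j → ∫ p, conj (h i p) * h j p = 0 := by
    intro i j hij
    by_cases hl : i.1 = j.1
    · rw [hself i j hl, if_neg hij]
    · refine integral_eq_zero_of_ae (Eventually.of_forall fun p => ?_)
      by_cases hp : ⌊‖p‖⌋₊ = i.1
      · simp [hsupp j p (fun h' => hl (hp.symm.trans h'))]
      · simp [hsupp i p hp]
  refine ⟨Σ l, w l, inferInstance, h, Sigma.fst, hmeas, hmem, hsupp, fun i => ?_, horth, ?_, ?_⟩
  · rw [hself i i rfl, if_pos rfl]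
  · intro g hg I
    have ho : Orthonormal ℂ (fun i => (hmem i).toLp (h i)) := by
      rw [orthonormal_iff_ite]
      intro i j
      rw [inner_toLp_toLp]
      by_cases hij : i = j
      · rw [hself i j (by rw [hij])]
      · rw [horth i j hij, if_neg hij]
    have := ho.sum_inner_products_le (hg.toLp g) (s := I)
    rw [← enorm_toLp_sq hg]
    refine le_trans (le_of_eq ?_) (ENNReal.ofReal_le_ofReal this)
    rw [ENNReal.ofReal_sum_of_nonneg (fun i _ => by positivity)]
    refine Finset.sum_congr rfl fun i _ => ?_
    rw [inner_toLp_toLp, ENNReal.ofReal_pow (norm_nonneg _), ofReal_norm]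
  · intro g hg N M hM
    -- Parseval's identity on a single annulus; the ball of radius `N` is the disjoint union of the
    -- annuli with `l < N`.
    have hpart : ∀ l, ∫⁻ p in A l, ‖g p‖ₑ ^ 2 = ∑' i : w l, ‖∫ p, conj (h ⟨l, i⟩ p) * g p‖ₑ ^ 2 := by
      intro l
      rw [← enorm_toLp_sq (hg.restrict (A l))]
      have hs := (b l).hasSum_inner_mul_inner ((hg.restrict (A l)).toLp g)
        ((hg.restrict (A l)).toLp g)
      have hs2 : HasSum (fun i => ‖inner ℂ (b l i) ((hg.restrict (A l)).toLp g)‖ ^ 2)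
          (‖(hg.restrict (A l)).toLp g‖ ^ 2) := by
        rw [← Complex.hasSum_ofReal]
        rw [inner_self_eq_norm_sq_to_K] at hs
        simp_rw [← inner_conj_symm _ (b l _), RCLike.conj_mul] at hs
        simpa using hs
      rw [← hs2.tsum_eq, ENNReal.ofReal_tsum_of_nonneg (fun _ => by positivity) hs2.summable]
      refine tsum_congr fun i => ?_
      rw [hcoef ⟨l, i⟩ g hg, ENNReal.ofReal_pow (norm_nonneg _), ofReal_norm]
    have hU : {p : E m | ‖p‖ < N} = ⋃ l ∈ Finset.range N, A l := by
      ext p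
      simp only [mem_ofPred_eq, Finset.mem_range, mem_iUnion, exists_prop, A]
      rw [exists_eq_right', Nat.floor_lt (norm_nonneg _)]
    rw [hU, lintegral_biUnion_finset (fun i _ j _ hij => ?_) (fun l _ => hA l)]
    · have e : ∑ l ∈ Finset.range N, ∫⁻ p in A l, ‖g p‖ₑ ^ 2 =
          ∑' i : Σ l, w l, if i.1 < N then ‖∫ p, conj (h i p) * g p‖ₑ ^ 2 else 0 := by
        rw [ENNReal.tsum_sigma', tsum_eq_sum (s := Finset.range N)]
        · refine Finset.sum_congr rfl fun l hl => ?_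
          simp [hpart, Finset.mem_range.1 hl]
        · intro l hl
          simp [Finset.mem_range.not.1 hl]
      rw [e, ENNReal.tsum_eq_iSup_sum]
      refine iSup_le fun I => ?_
      rw [← Finset.sum_filter]
      exact hM _ fun i hi => (Finset.mem_filter.1 hi).2
    · refine Set.disjoint_left.2 fun p h1 h2 => hij ?_
      exact (show ⌊‖p‖⌋₊ = i from h1).symm.trans h2

end AnnularBasis

/-! ### Fourier transforms in `x` of averages in `p`. -/

section Amplitude

variable {d m : ℕ}

/-- Lebesgue measure on `K × {|p| < N}`. -/
noncomputable def lam (K : Set (E d)) (m N : ℕ) : Measure (E d × E m) :=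
  (volume.restrict K).prod (volume.restrict {p : E m | ‖p‖ < N})

theorem volume_ball_lt_top (m N : ℕ) : volume {p : E m | ‖p‖ < (N : ℝ)} < ∞ := by
  have : {p : E m | ‖p‖ < (N : ℝ)} = Metric.ball 0 N := by ext; simp
  rw [this]; exact measure_ball_lt_top

theorem measurableSet_normBall (m N : ℕ) : MeasurableSet {p : E m | ‖p‖ < (N : ℝ)} :=
  measurableSet_lt (by fun_prop) measurable_const

theorem lam_eq_restrict (K : Set (E d)) (m N : ℕ) :
    lam K m N = (volume : Measure (E d × E m)).restrict (K ×ˢ {p : E m | ‖p‖ < N}) := by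
  rw [lam, Measure.prod_restrict]; rfl

theorem isFiniteMeasure_lam {K : Set (E d)} (hK : volume K ≠ ∞) (m N : ℕ) :
    IsFiniteMeasure (lam K m N) := by
  have : IsFiniteMeasure ((volume : Measure (E d)).restrict K) := ⟨by simpa using hK.lt_top⟩
  have : IsFiniteMeasure ((volume : Measure (E m)).restrict {p : E m | ‖p‖ < N}) :=
    ⟨by simpa using volume_ball_lt_top m N⟩
  rw [lam]; infer_instance

/-- The Fourier transform in `x` of `∫ φ(x, p) v(x, p) dp`, the integral being over `|p| < N`. -/
noncomputable def vhat (K : Set (E d)) (N : ℕ) (φ v : E d × E m → ℂ) (ξ : E d) : ℂ :=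
  ∫ y, (𝐞 (-(inner ℝ y.1 ξ)) : ℂ) * (φ y * v y) ∂(lam K m N)

/-- The Fourier transform in `x` of `v(x, p)`. -/
noncomputable def ftx (v : E d × E m → ℂ) (p : E m) (ξ : E d) : ℂ := 𝓕 (fun x => v (x, p)) ξ

/-- The Fourier transform in `x` of `∫ v(x, p) conj h(p) dp`. -/
noncomputable def coef (h : E m → ℂ) (v : E d × E m → ℂ) (ξ : E d) : ℂ :=
  ∫ p, conj (h p) * ftx v p ξ

attribute [irreducible] vhat ftx coef

/-- Measurable functions bounded by `C` and vanishing for `x ∉ K`. -/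
structure IsTameFun (K : Set (E d)) (C : ℝ) (v : E d × E m → ℂ) : Prop where
  meas : Measurable v
  bound : ∀ y, ‖v y‖ ≤ C
  supp : ∀ y, y.1 ∉ K → v y = 0

variable {K : Set (E d)} {C : ℝ} {v φ : E d × E m → ℂ} {N : ℕ}

theorem IsTameFun.integrable_mul (hv : IsTameFun K C v) (hφ : Integrable φ (lam K m N)) :
    Integrable (fun y => φ y * v y) (lam K m N) := by
  refine (hφ.norm.const_mul C).mono' (hφ.1.mul hv.meas.aestronglyMeasurable)
    (Eventually.of_forall fun y => ?_)
  rw [norm_mul, mul_comm]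
  gcongr
  exact hv.bound y

theorem IsTameFun.norm_vhat_le (hv : IsTameFun K C v) (hφ : Integrable φ (lam K m N)) (ξ : E d) :
    ‖vhat K N φ v ξ‖ ≤ C * ∫ y, ‖φ y‖ ∂(lam K m N) := by
  rw [vhat, ← integral_const_mul]
  refine norm_integral_le_of_norm_le (hφ.norm.const_mul C) (Eventually.of_forall fun y => ?_)
  rw [norm_mul, Circle.norm_coe, one_mul, norm_mul, mul_comm]
  gcongr
  exact hv.bound y

theorem integrable_exp_mul {f : E d × E m → ℂ} {μ : Measure (E d × E m)} (hf : Integrable f μ)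
    (ξ : E d) : Integrable (fun y => (𝐞 (-(inner ℝ y.1 ξ)) : ℂ) * f y) μ := by
  refine hf.norm.mono' ?_ (Eventually.of_forall fun y => ?_)
  · have : Continuous fun y : E d × E m => (𝐞 (-(inner ℝ y.1 ξ)) : ℂ) := by fun_prop
    exact this.aestronglyMeasurable.mul hf.1
  · rw [norm_mul, Circle.norm_coe, one_mul]

theorem vhat_eq_fourier (hv : IsTameFun K C v) (hKm : MeasurableSet K)
    (hφ : Integrable φ (lam K m N)) (ξ : E d) :
    vhat K N φ v ξ = 𝓕 (K.indicator fun x => ∫ p in {p : E m | ‖p‖ < N}, φ (x, p) * v (x, p)) ξ := by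
  rw [Real.fourier_eq, vhat, lam, integral_prod _ (integrable_exp_mul (hv.integrable_mul hφ) ξ),
    ← integral_indicator hKm]
  refine integral_congr_ae (Eventually.of_forall fun x => ?_)
  by_cases hx : x ∈ K
  · simp only [indicator_of_mem hx, Circle.smul_def, smul_eq_mul]
    rw [← integral_const_mul]
  · simp [hx]

theorem integrable_of_memLp_two {α : Type*} [MeasurableSpace α] {μ : Measure α} [IsFiniteMeasure μ]
    {f : α → ℂ} (hf : MemLp f 2 μ) : Integrable f μ := hf.integrable (by norm_num)

/-- Plancherel in `x` for the average over `|p| < N`, which is estimated by Cauchy–Schwarz in `p`;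
the latter costs the volume of the ball. -/
theorem lintegral_enorm_vhat_sq_le (hv : IsTameFun K C v) (hKm : MeasurableSet K)
    (hK : volume K ≠ ∞) (hφ : MemLp φ 2 (lam K m N)) :
    ∫⁻ ξ, ‖vhat K N φ v ξ‖ₑ ^ 2 ≤
      ENNReal.ofReal C ^ 2 * volume {p : E m | ‖p‖ < (N : ℝ)} * ∫⁻ y, ‖φ y‖ₑ ^ 2 ∂(lam K m N) := by
  have := isFiniteMeasure_lam hK m N
  have hφ1 := integrable_of_memLp_two hφ
  have hint := hv.integrable_mul hφ1
  set G : E d → ℂ := K.indicator fun x => ∫ p in {p : E m | ‖p‖ < N}, φ (x, p) * v (x, p) with hG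
  have hG1 : Integrable G := (integrable_indicator_iff hKm).2 (Integrable.integral_prod_left hint)
  have hmain : ∫⁻ x, ‖G x‖ₑ ^ 2 ≤
      ENNReal.ofReal C ^ 2 * volume {p : E m | ‖p‖ < (N : ℝ)} * ∫⁻ y, ‖φ y‖ₑ ^ 2 ∂(lam K m N) := by
    have hφm : AEMeasurable (fun y => ‖φ y‖ₑ ^ 2) (lam K m N) := hφ.1.enorm.pow_const 2
    have h1 : ∀ᵐ x ∂(volume.restrict K), AEMeasurable (fun p => ‖φ (x, p)‖ₑ)
        (volume.restrict {p : E m | ‖p‖ < N}) := by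
      filter_upwards [(hφ.1 : AEStronglyMeasurable φ ((volume.restrict K).prod
        (volume.restrict {p : E m | ‖p‖ < N}))).prodMk_left] with x hx using hx.enorm
    have e : ∀ x, ‖G x‖ₑ ^ 2 = K.indicator (fun x => ‖G x‖ₑ ^ 2) x := by
      intro x
      by_cases hx : x ∈ K
      · rw [indicator_of_mem hx]
      · have : G x = 0 := indicator_of_notMem hx _
        rw [indicator_of_notMem hx, this]; simp
    rw [lintegral_congr e, lintegral_indicator hKm, lam, lintegral_prod _ hφm, mul_assoc, ← lintegral_const_mul'',
      ← lintegral_const_mul'']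
    rotate_left
    · exact hφm.lintegral_prod_right'.const_mul _
    · exact hφm.lintegral_prod_right'
    refine lintegral_mono_ae ?_
    filter_upwards [h1, ae_restrict_mem hKm] with x hx hxK
    calc ‖G x‖ₑ ^ 2 ≤ (∫⁻ p in {p : E m | ‖p‖ < N}, ENNReal.ofReal C * ‖φ (x, p)‖ₑ) ^ 2 := by
          gcongr
          rw [hG, indicator_of_mem hxK]
          refine (enorm_integral_le_lintegral_enorm _).trans (lintegral_mono fun p => ?_)
          rw [enorm_mul, mul_comm]
          gcongr
          rw [← ofReal_norm]; exact ENNReal.ofReal_le_ofReal (hv.bound _)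
      _ = ENNReal.ofReal C ^ 2 * (∫⁻ p in {p : E m | ‖p‖ < N}, ‖φ (x, p)‖ₑ) ^ 2 := by
          rw [lintegral_const_mul'' _ hx, mul_pow]
      _ ≤ _ := by
          gcongr
          exact sq_setLIntegral_le hx
  have hG2 : MemLp G 2 := by
    refine ⟨hG1.1, ?_⟩
    have h3 : ∫⁻ x, ‖G x‖ₑ ^ 2 < ∞ := by
      refine hmain.trans_lt (ENNReal.mul_lt_top (ENNReal.mul_lt_top (by simp)
        (volume_ball_lt_top m N)) ?_)
      rw [lintegral_enorm_sq_eq_eLpNorm_sq]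
      exact ENNReal.pow_lt_top hφ.2
    rw [lintegral_enorm_sq_eq_eLpNorm_sq] at h3
    by_contra hcon
    rw [not_lt, top_le_iff] at hcon
    simp [hcon] at h3
  simp_rw [vhat_eq_fourier hv hKm hφ1]
  rw [lintegral_enorm_sq_fourier hG1 hG2]
  exact hmain

theorem IsTameFun.integrable_slice (hv : IsTameFun K C v) (hKm : MeasurableSet K)
    (hK : volume K ≠ ∞) (p : E m) : Integrable (fun x => v (x, p)) := by
  have hi : Integrable (K.indicator fun _ => C : E d → ℝ) :=
    (integrable_indicator_iff hKm).2 (integrableOn_const hK)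
  refine hi.mono' (hv.meas.comp (by fun_prop)).aestronglyMeasurable (Eventually.of_forall fun x => ?_)
  by_cases hx : x ∈ K
  · simpa [hx] using hv.bound (x, p)
  · simp [hv.supp (x, p) hx, hx]

theorem IsTameFun.norm_ftx_le (hv : IsTameFun K C v) (hKm : MeasurableSet K)
    (hK : volume K ≠ ∞) (p : E m) (ξ : E d) : ‖ftx v p ξ‖ ≤ C * volume.real K := by
  have hi : Integrable (K.indicator fun _ => C : E d → ℝ) :=
    (integrable_indicator_iff hKm).2 (integrableOn_const hK)
  rw [ftx, Real.fourier_eq]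
  refine (norm_integral_le_of_norm_le hi (Eventually.of_forall fun x => ?_)).trans (le_of_eq ?_)
  · rw [Circle.norm_smul]
    by_cases hx : x ∈ K
    · simpa [hx] using hv.bound (x, p)
    · simp [hv.supp (x, p) hx, hx]
  · rw [integral_indicator hKm, setIntegral_const, smul_eq_mul, mul_comm]

/-- For a function of the form `e(κ · x) conj h(p)`, the amplitude is a translate of `coef`. -/
theorem vhat_exp_mul (hv : IsTameFun K C v) (hKm : MeasurableSet K) (hK : volume K ≠ ∞)
    {h : E m → ℂ} (hh : MemLp h 2) (hs : ∀ p, (N : ℝ) ≤ ‖p‖ → h p = 0) (κ ξ : E d) :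
    vhat K N (fun y => (𝐞 (inner ℝ κ y.1) : ℂ) * conj (h y.2)) v ξ = coef h v (ξ - κ) := by
  set L : Set (E m) := {p : E m | ‖p‖ < N} with hL
  have hLm : MeasurableSet L := measurableSet_normBall m N
  have : IsFiniteMeasure ((volume : Measure (E d)).restrict K) := ⟨by simpa using hK.lt_top⟩
  have : IsFiniteMeasure ((volume : Measure (E m)).restrict L) :=
    ⟨by simpa using volume_ball_lt_top m N⟩
  have hh1 : Integrable h (volume.restrict L) := integrable_of_memLp_two (hh.restrict L)
  have hb : Integrable (fun y : E d × E m => conj (h y.2)) ((volume.restrict K).prod (volume.restrict L)) := by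
    have : Integrable (fun p => conj (h p)) (volume.restrict L) := by
      refine hh1.norm.mono' ?_ (Eventually.of_forall fun p => by simp)
      exact RCLike.continuous_conj.comp_aestronglyMeasurable hh1.1
    exact this.comp_snd _
  have hint : Integrable (fun y : E d × E m => (𝐞 (-(inner ℝ y.1 (ξ - κ))) : ℂ) *
      (conj (h y.2) * v y)) ((volume.restrict K).prod (volume.restrict L)) :=
    integrable_exp_mul (hv.integrable_mul hb) _
  have e1 : ∀ y : E d × E m, (𝐞 (-(inner ℝ y.1 ξ)) : ℂ) * ((𝐞 (inner ℝ κ y.1) : ℂ) * conj (h y.2) * v y) =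
      (𝐞 (-(inner ℝ y.1 (ξ - κ))) : ℂ) * (conj (h y.2) * v y) := by
    intro y
    have : (𝐞 (-(inner ℝ y.1 (ξ - κ))) : ℂ) = (𝐞 (-(inner ℝ y.1 ξ)) : ℂ) * (𝐞 (inner ℝ κ y.1) : ℂ) := by
      rw [← Circle.coe_mul, ← AddChar.map_add_eq_mul, inner_sub_right, real_inner_comm κ y.1]
      congr 2; ring
    rw [this]; ring
  rw [vhat, lam]
  simp_rw [e1]
  rw [integral_prod_symm _ hint, coef]
  rw [← integral_indicator hLm]
  refine integral_congr_ae (Eventually.of_forall fun p => ?_)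
  by_cases hp : p ∈ L
  · simp only [indicator_of_mem hp]
    rw [ftx, Real.fourier_eq, ← integral_const_mul, ← integral_indicator hKm]
    refine integral_congr_ae (Eventually.of_forall fun x => ?_)
    by_cases hx : x ∈ K
    · simp only [indicator_of_mem hx, Circle.smul_def, smul_eq_mul]; ring
    · simp [hx, hv.supp (x, p) hx]
  · simp [hp, hs p (not_lt.1 hp)]

end Amplitude

/-! ### Lattice frequencies and windows on a cube. -/

section Window

variable {d : ℕ}

/-- The frequency `k / (2R)`, for `k ∈ ℤᵈ`. -/
noncomputable def freq (R : ℝ) (k : Fin d → ℤ) : E d := WithLp.toLp 2 fun i => (k i : ℝ) / (2 * R)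

/-- The cube `[-R, R]ᵈ`. -/
def cube (d : ℕ) (R : ℝ) : Set (E d) := {x | ∀ i, x i ∈ Icc (-R) R}

theorem isClosed_cube (R : ℝ) : IsClosed (cube d R) := by
  have : cube d R = ⋂ i, (fun x : E d => x i) ⁻¹' Icc (-R) R := by ext; simp [cube]
  rw [this]
  exact isClosed_iInter fun i => isClosed_Icc.preimage (by fun_prop)

theorem measurableSet_cube (R : ℝ) : MeasurableSet (cube d R) := (isClosed_cube R).measurableSet

theorem cube_eq_preimage (R : ℝ) :
    cube d R = (WithLp.ofLp : E d → Fin d → ℝ) ⁻¹' Set.pi univ fun _ => Icc (-R) R := by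
  ext; simp [cube, Pi.le_def, forall_and]

theorem isCompact_cube (R : ℝ) : IsCompact (cube d R) := by
  rw [cube_eq_preimage]
  exact (PiLp.homeomorph 2 (fun _ : Fin d => ℝ)).isCompact_preimage.2
    (isCompact_univ_pi fun _ => isCompact_Icc)

theorem exists_cube_superset {K : Set (E d)} (hK : IsCompact K) : ∃ R > 0, ∀ x ∈ K, ∀ i, |x i| < R := by
  obtain ⟨R, hR⟩ := hK.isBounded.exists_norm_le
  refine ⟨max R 0 + 1, by positivity, fun x hx i => ?_⟩
  have h1 : |x i| ≤ ‖x‖ := by simpa using PiLp.norm_apply_le x i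
  linarith [hR x hx, le_max_left R 0]

theorem inner_freq (R : ℝ) (k : Fin d → ℤ) (x : E d) :
    inner ℝ (freq R k) x = ∑ i, (k i : ℝ) / (2 * R) * x i := by
  simp [freq, PiLp.inner_apply, mul_comm]

theorem freq_sub (R : ℝ) (k l : Fin d → ℤ) : freq R (k - l) = freq R k - freq R l := by
  ext i; simp [freq, sub_div]

theorem freq_add (R : ℝ) (k l : Fin d → ℤ) : freq R (k + l) = freq R k + freq R l := by
  ext i; simp [freq, add_div]

theorem freq_zero (R : ℝ) : freq R (0 : Fin d → ℤ) = 0 := by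
  ext i; simp [freq]

/-- With frequency `k / (2R)` the interval of length `2R` holds a whole number of periods. -/
theorem integral_exp_one_dim {R : ℝ} (hR : 0 < R) (k : ℤ) :
    ∫ x in Icc (-R) R, (𝐞 ((k : ℝ) / (2 * R) * x) : ℂ) = if k = 0 then ((2 * R : ℝ) : ℂ) else 0 := by
  rw [integral_Icc_eq_integral_Ioc, ← intervalIntegral.integral_of_le (by linarith)]
  split_ifs with hk
  · subst hk; simp; ring
  · have hc : (2 * Real.pi * (k / (2 * R)) : ℂ) * Complex.I ≠ 0 := by
      have : (k : ℂ) ≠ 0 := by exact_mod_cast hk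
      have h2 : (R : ℂ) ≠ 0 := by exact_mod_cast hR.ne'
      have h3 : (Real.pi : ℂ) ≠ 0 := by exact_mod_cast Real.pi_ne_zero
      simp [this, h2, h3]
    have e : ∀ x : ℝ, (𝐞 ((k : ℝ) / (2 * R) * x) : ℂ) =
        Complex.exp ((2 * Real.pi * (k / (2 * R)) : ℂ) * Complex.I * x) := by
      intro x; rw [Real.fourierChar_apply]; congr 1; push_cast; ring
    simp_rw [e]
    rw [integral_exp_mul_complex hc, div_eq_zero_iff]
    left
    have h2 : (R : ℂ) ≠ 0 := by exact_mod_cast hR.ne'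
    have e2 : (2 * Real.pi * (k / (2 * R)) : ℂ) * Complex.I * R =
        (2 * Real.pi * (k / (2 * R)) : ℂ) * Complex.I * (-R : ℝ) + k * (2 * Real.pi * Complex.I) := by
      push_cast; field_simp; ring
    rw [e2, Complex.exp_add, Complex.exp_int_mul_two_pi_mul_I, mul_one, sub_self]

theorem integral_cube_exp {R : ℝ} (hR : 0 < R) (k : Fin d → ℤ) :
    ∫ x in cube d R, (𝐞 (inner ℝ (freq R k) x) : ℂ) = if k = 0 then (((2 * R) ^ d : ℝ) : ℂ) else 0 := by
  have h1 : ∀ x : E d, (cube d R).indicator (fun x => (𝐞 (inner ℝ (freq R k) x) : ℂ)) x =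
      ∏ i, (Icc (-R) R).indicator (fun y => (𝐞 ((k i : ℝ) / (2 * R) * y) : ℂ)) (x i) := by
    intro x
    by_cases hx : x ∈ cube d R
    · rw [indicator_of_mem hx, inner_freq,
        Finset.prod_congr rfl fun i _ => indicator_of_mem (hx i) _]
      simp_rw [Real.fourierChar_apply]
      rw [← Complex.exp_sum]
      push_cast
      rw [Finset.mul_sum, Finset.sum_mul]
    · rw [indicator_of_notMem hx]
      simp only [cube, mem_ofPred_eq, not_forall] at hx
      obtain ⟨i, hi⟩ := hx
      exact (Finset.prod_eq_zero (Finset.mem_univ i) (indicator_of_notMem hi _)).symm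
  rw [← integral_indicator (measurableSet_cube R)]
  simp_rw [h1]
  have h2 := (PiLp.volume_preserving_ofLp (Fin d)).integral_comp
    (MeasurableEquiv.toLp 2 (Fin d → ℝ)).symm.measurableEmbedding
    (fun x : Fin d → ℝ => ∏ i, (Icc (-R) R).indicator (fun y => (𝐞 ((k i : ℝ) / (2 * R) * y) : ℂ)) (x i))
  rw [h2, integral_fintype_prod_volume_eq_prod
    (f := fun i y => (Icc (-R) R).indicator (fun y => (𝐞 ((k i : ℝ) / (2 * R) * y) : ℂ)) y)]
  simp_rw [integral_indicator measurableSet_Icc, integral_exp_one_dim hR]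
  split_ifs with hk
  · subst hk; simp
  · obtain ⟨i, hi⟩ := Function.ne_iff.1 hk
    exact Finset.prod_eq_zero (Finset.mem_univ i) (if_neg hi)

/-- The box `{0, …, N - 1}ᵈ`. -/
noncomputable def box (d N : ℕ) : Finset (Fin d → ℤ) := Fintype.piFinset fun _ => Finset.Ico 0 (N : ℤ)

theorem card_box (d N : ℕ) : (box d N).card = N ^ d := by simp [box]

/-- Boxes are a Følner sequence in `ℤᵈ`: for large `N` the overlap with a translate is a box of
sides `N - |kᵢ|`. The ratio is the factor by which windowed correlations fall short of the true
ones. -/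
theorem tendsto_card_box_filter (k : Fin d → ℤ) :
    Tendsto (fun N : ℕ => (((box d N).filter fun l => l + k ∈ box d N).card : ℝ) / (box d N).card)
      atTop (𝓝 1) := by
  have h : ∀ᶠ N : ℕ in atTop, ∏ i, (((N : ℝ) - |(k i : ℝ)|) / N) =
      (((box d N).filter fun l => l + k ∈ box d N).card : ℝ) / (box d N).card := by
    have hev : ∀ᶠ N : ℕ in atTop, ∀ i, |k i| ≤ (N : ℤ) := by
      rw [eventually_all]
      intro i
      filter_upwards [eventually_ge_atTop (k i).natAbs] with N hN
      rw [Int.abs_eq_natAbs]; omega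
    filter_upwards [hev] with N hN
    have e : (box d N).filter (fun l => l + k ∈ box d N) =
        Fintype.piFinset fun i => Finset.Ico (max 0 (-k i)) (min (N : ℤ) (N - k i)) := by
      ext l
      simp only [box, Finset.mem_filter, Fintype.mem_piFinset, Finset.mem_Ico, Pi.add_apply]
      constructor
      · rintro ⟨h1, h2⟩ i; have := h1 i; have := h2 i; omega
      · intro h1; exact ⟨fun i => by have := h1 i; omega, fun i => by have := h1 i; omega⟩
    rw [e, card_box, Fintype.card_piFinset, Finset.prod_div_distrib]
    simp only [Finset.prod_const, Finset.card_univ, Fintype.card_fin, Int.card_Ico]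
    push_cast
    congr 1
    refine Finset.prod_congr rfl fun i _ => ?_
    have h1 : min (N : ℤ) (N - k i) - max 0 (-k i) = N - |k i| := by
      rcases abs_cases (k i) with h | h <;> omega
    have h2 : (((min (N : ℤ) (N - k i) - max 0 (-k i)).toNat : ℤ) : ℝ) = ((N - |k i| : ℤ) : ℝ) := by
      rw [h1, Int.toNat_of_nonneg (by have := hN i; omega)]
    push_cast at h2
    exact h2.symm
  refine Tendsto.congr' h ?_
  have : Tendsto (fun N : ℕ => ∏ i, (((N : ℝ) - |(k i : ℝ)|) / N)) atTop (𝓝 (∏ _i : Fin d, 1)) := by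
    refine tendsto_finsetProd _ fun i _ => ?_
    have h1 : Tendsto (fun N : ℕ => 1 - |(k i : ℝ)| / N) atTop (𝓝 (1 - 0)) :=
      tendsto_const_nhds.sub (tendsto_const_div_atTop_nhds_zero_nat _)
    rw [sub_zero] at h1
    refine h1.congr' ?_
    filter_upwards [eventually_gt_atTop 0] with N hN
    have : (N : ℝ) ≠ 0 := by exact_mod_cast hN.ne'
    field_simp
  simpa using this

/-- The window, normalised in `L²` of the cube. -/
noncomputable def window (R : ℝ) (B : Finset (Fin d → ℤ)) (y : E d) : ℂ :=
  ((Real.sqrt (B.card * (2 * R) ^ d))⁻¹ : ℝ) * ∑ k ∈ B, (𝐞 (inner ℝ (freq R k) y) : ℂ)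

theorem continuous_window (R : ℝ) (B : Finset (Fin d → ℤ)) : Continuous (window R B) := by
  unfold window; fun_prop

theorem window_mul_conj {R : ℝ} (hR : 0 < R) (B : Finset (Fin d → ℤ)) (y : E d) :
    window R B y * conj (window R B y) = ((B.card * (2 * R) ^ d : ℝ) : ℂ)⁻¹ *
      ∑ k ∈ B, ∑ l ∈ B, (𝐞 (inner ℝ (freq R (k - l)) y) : ℂ) := by
  have h1 : ∀ k l : Fin d → ℤ, (𝐞 (inner ℝ (freq R (k - l)) y) : ℂ) =
      (𝐞 (inner ℝ (freq R k) y) : ℂ) * conj (𝐞 (inner ℝ (freq R l) y) : ℂ) := by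
    intro k l
    rw [freq_sub, inner_sub_left, AddChar.map_sub_eq_div, Circle.coe_div, ← Circle.coe_inv_eq_conj,
      Circle.coe_inv, div_eq_mul_inv]
  simp_rw [h1]
  rw [window, map_mul, Complex.conj_ofReal, map_sum, ← Finset.sum_mul_sum, mul_mul_mul_comm]
  congr 1
  rw [← Complex.ofReal_mul, ← mul_inv, Real.mul_self_sqrt (by positivity), Complex.ofReal_inv]

/-- Off-diagonal products of characters integrate to zero over the period cube, wherever the window
is translated. Both signs of `c` are needed, since `x - z` is integrated once in `x` and once in the
centre `z`. -/
theorem lintegral_window_sq {R : ℝ} (hR : 0 < R) {B : Finset (Fin d → ℤ)} (hB : B.Nonempty)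
    (a : E d) {c : ℝ} (hc : c = 1 ∨ c = -1) :
    ∫⁻ x in cube d R, ‖window R B (c • x + a)‖ₑ ^ 2 = 1 := by
  have hcard : (B.card : ℝ) ≠ 0 := by exact_mod_cast hB.card_pos.ne'
  have hcont : Continuous fun x : E d => window R B (c • x + a) :=
    (continuous_window R B).comp (by fun_prop)
  have hint : IntegrableOn (fun x : E d => ‖window R B (c • x + a)‖ ^ 2) (cube d R) :=
    (hcont.norm.pow 2).continuousOn.integrableOn_compact (isCompact_cube R)
  have hcplx : ∫ x in cube d R, ((‖window R B (c • x + a)‖ ^ 2 : ℝ) : ℂ) = 1 := by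
    have e1 : ∀ x : E d, ((‖window R B (c • x + a)‖ ^ 2 : ℝ) : ℂ) =
        ((B.card * (2 * R) ^ d : ℝ) : ℂ)⁻¹ * ∑ k ∈ B, ∑ l ∈ B,
          (𝐞 (inner ℝ (freq R (k - l)) (c • x + a)) : ℂ) := by
      intro x; rw [← window_mul_conj hR, RCLike.mul_conj]; push_cast; rfl
    have e2 : ∀ (k l : Fin d → ℤ), ∫ x in cube d R, (𝐞 (inner ℝ (freq R (k - l)) (c • x + a)) : ℂ) =
        if k = l then (((2 * R) ^ d : ℝ) : ℂ) else 0 := by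
      intro k l
      have e3 : ∀ x : E d, (𝐞 (inner ℝ (freq R (k - l)) (c • x + a)) : ℂ) =
          (𝐞 (inner ℝ (freq R (if c = 1 then k - l else l - k)) x) : ℂ) *
            (𝐞 (inner ℝ (freq R (k - l)) a) : ℂ) := by
        intro x
        rw [inner_add_right, AddChar.map_add_eq_mul, Circle.coe_mul]
        congr 3
        rcases hc with rfl | rfl
        · simp
        · have : (-1 : ℝ) ≠ 1 := by norm_num
          rw [if_neg this, freq_sub, freq_sub]; simp [inner_sub_left]
      simp_rw [e3]
      rw [integral_mul_const, integral_cube_exp hR]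
      by_cases hkl : k = l
      · subst hkl; simp [freq_zero]
      · have h1 : (if c = 1 then k - l else l - k) ≠ 0 := by
          split_ifs
          · exact sub_ne_zero.2 hkl
          · exact sub_ne_zero.2 (Ne.symm hkl)
        rw [if_neg h1, if_neg hkl, zero_mul]
    have hi : ∀ k l : Fin d → ℤ, IntegrableOn
        (fun x : E d => (𝐞 (inner ℝ (freq R (k - l)) (c • x + a)) : ℂ)) (cube d R) := fun k l => by
      have : Continuous fun x : E d => (𝐞 (inner ℝ (freq R (k - l)) (c • x + a)) : ℂ) := by fun_prop
      exact this.continuousOn.integrableOn_compact (isCompact_cube R)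
    simp_rw [e1]
    rw [integral_const_mul, integral_finsetSum _ fun k _ => integrable_finsetSum _ fun l _ => hi k l]
    simp_rw [integral_finsetSum B fun l _ => hi _ l, e2]
    have h3 : ((2 * R : ℝ) : ℂ) ^ d ≠ 0 := by
      have : (2 * R) ≠ 0 := by positivity
      exact pow_ne_zero _ (by exact_mod_cast this)
    have h4 : (B.card : ℂ) ≠ 0 := by exact_mod_cast hcard
    simp only [Finset.sum_ite_eq, Finset.sum_ite_mem, Finset.inter_self, Finset.sum_const, nsmul_eq_mul]
    push_cast at h3 ⊢
    field_simp
  have hreal : ∫ x in cube d R, ‖window R B (c • x + a)‖ ^ 2 = 1 := by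
    rw [integral_complex_ofReal] at hcplx
    exact_mod_cast hcplx
  have := ofReal_integral_eq_lintegral_ofReal hint (Eventually.of_forall fun x => by positivity)
  rw [hreal, ENNReal.ofReal_one] at this
  rw [this]
  refine lintegral_congr fun x => ?_
  rw [ENNReal.ofReal_pow (norm_nonneg _), ofReal_norm]

end Window

/-! ### The wave packet transform: coefficients, density and isometry. -/

section Packet

variable {d m : ℕ}

theorem measurable_char : Measurable fun x : ℝ => (𝐞 x : ℂ) := by
  have : Continuous fun x : ℝ => (𝐞 x : ℂ) := by fun_prop
  exact this.measurable
theorem measurable_char_inner {α : Type*} [MeasurableSpace α] {f g : α → E d} (hf : Measurable f) (hg : Measurable g) : Measurable fun w => (𝐞 (-(inner ℝ (f w) (g w))) : ℂ) := 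
  measurable_char.comp (hf.inner hg).neg
theorem measurable_ftx {α : Type*} [MeasurableSpace α] {u : α → E d × E m → ℂ}
    (hu : Measurable (Function.uncurry u)) :
    Measurable fun w : α × E m × E d => ftx (u w.1) w.2.1 w.2.2 := by
  have h : Measurable fun w : (α × E m × E d) × E d =>
      (𝐞 (-(inner ℝ w.2 w.1.2.2)) : ℂ) * u w.1.1 (w.2, w.1.2.1) := by
    have h1 := measurable_char_inner (f := fun w : (α × E m × E d) × E d => w.2) measurable_snd measurable_fst.snd.snd
    have h2 : Measurable fun w : (α × E m × E d) × E d => u w.1.1 (w.2, w.1.2.1) := by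
      have : Measurable fun w : (α × E m × E d) × E d => (w.1.1, (w.2, w.1.2.1)) := by fun_prop
      exact hu.comp this
    exact h1.mul h2
  have e : (fun w : α × E m × E d => ftx (u w.1) w.2.1 w.2.2) = fun w => ∫ x,
      (𝐞 (-(inner ℝ x w.2.2)) : ℂ) * u w.1 (x, w.2.1) := by
    ext w
    rw [ftx, Real.fourier_eq]
    simp_rw [Circle.smul_def, smul_eq_mul]
  rw [e]
  exact h.stronglyMeasurable.integral_prod_right'.measurable

theorem measurable_ftx_comp {α β : Type*} [MeasurableSpace α] [MeasurableSpace β]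
    {u : α → E d × E m → ℂ} (hu : Measurable (Function.uncurry u)) {f : β → α} {p : β → E m}
    {ξ : β → E d} (hf : Measurable f) (hp : Measurable p) (hξ : Measurable ξ) :
    Measurable fun b => ftx (u (f b)) (p b) (ξ b) :=
  (measurable_ftx hu).comp (hf.prodMk (hp.prodMk hξ))

theorem measurable_ftx_left {v : E d × E m → ℂ} (hv : Measurable v) (ξ : E d) :
    Measurable fun p => ftx v p ξ :=
  measurable_ftx_comp (u := fun _ : Unit => v) (hv.comp measurable_snd) (f := fun _ => ())
    measurable_const measurable_id measurable_const

/-- The wave packet transform of `v(·, p)`, with the window centred at `z`. -/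
noncomputable def packet (R : ℝ) (B : Finset (Fin d → ℤ)) (v : E d × E m → ℂ) (p : E m) (z ξ : E d) :
    ℂ :=
  𝓕 (fun x => window R B (x - z) * v (x, p)) ξ

/-- The component of the wave packet transform along `h`. -/
noncomputable def pcoef (R : ℝ) (B : Finset (Fin d → ℤ)) (h : E m → ℂ) (v : E d × E m → ℂ)
    (z ξ : E d) : ℂ := ∫ p, conj (h p) * packet R B v p z ξ

/-- The weighted square of the wave packet transform. -/
noncomputable def dens (W : ℕ → ℝ) (R : ℝ) (B : Finset (Fin d → ℤ)) (v : E d × E m → ℂ)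
    (z ξ : E d) : ℝ≥0∞ := ∫⁻ p, ENNReal.ofReal (W ⌊‖p‖⌋₊) * ‖packet R B v p z ξ‖ₑ ^ 2

attribute [irreducible] packet pcoef dens

variable {K : Set (E d)} {C R : ℝ} {v : E d × E m → ℂ} {B : Finset (Fin d → ℤ)}

/-- Multiplication by a character shifts the frequency, so a window which is a trigonometric
polynomial produces finitely many translates of the Fourier transform. Measurability, bounds and
correlations of packets are read off from this sum. -/
theorem packet_eq_sum (hv : IsTameFun K C v) (hKm : MeasurableSet K) (hK : volume K ≠ ∞)
    (p : E m) (z ξ : E d) :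
    packet R B v p z ξ = ((Real.sqrt (B.card * (2 * R) ^ d))⁻¹ : ℝ) *
      ∑ k ∈ B, (𝐞 (-(inner ℝ (freq R k) z)) : ℂ) * ftx v p (ξ - freq R k) := by
  have hi := hv.integrable_slice hKm hK p
  rw [packet, Real.fourier_eq]
  have e : ∀ x, 𝐞 (-(inner ℝ x ξ)) • (window R B (x - z) * v (x, p)) =
      ((Real.sqrt (B.card * (2 * R) ^ d))⁻¹ : ℝ) *
        ∑ k ∈ B, (𝐞 (-(inner ℝ (freq R k) z)) : ℂ) *
          (𝐞 (-(inner ℝ x (ξ - freq R k))) • v (x, p)) := by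
    intro x
    have : ∀ k, (𝐞 (-(inner ℝ x ξ)) : ℂ) * (𝐞 (inner ℝ (freq R k) (x - z)) : ℂ) =
        (𝐞 (-(inner ℝ (freq R k) z)) : ℂ) * (𝐞 (-(inner ℝ x (ξ - freq R k))) : ℂ) := by
      intro k
      rw [← Circle.coe_mul, ← Circle.coe_mul, ← AddChar.map_add_eq_mul, ← AddChar.map_add_eq_mul,
        inner_sub_right, inner_sub_right, real_inner_comm (freq R k) x]
      congr 2; ring
    simp only [window, Circle.smul_def, smul_eq_mul]
    rw [mul_assoc, mul_left_comm]
    congr 1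
    rw [Finset.sum_mul, Finset.mul_sum]
    refine Finset.sum_congr rfl fun k _ => ?_
    rw [← mul_assoc, this k, mul_assoc]
  simp_rw [e]
  have hi2 : ∀ k, Integrable fun x => 𝐞 (-(inner ℝ x (ξ - freq R k))) • v (x, p) := fun k => by
    simpa using (Real.fourierIntegral_convergent_iff (ξ - freq R k)).2 hi
  rw [integral_const_mul, integral_finsetSum _ fun k _ => (hi2 k).const_mul _]
  congr 1
  refine Finset.sum_congr rfl fun k _ => ?_
  rw [integral_const_mul, ftx, Real.fourier_eq]

theorem measurable_packet {α : Type*} [MeasurableSpace α] {u : α → E d × E m → ℂ}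
    (hu : Measurable (Function.uncurry u)) (hv : ∀ s, IsTameFun K C (u s)) (hKm : MeasurableSet K)
    (hK : volume K ≠ ∞) :
    Measurable fun w : α × E m × E d × E d => packet R B (u w.1) w.2.1 w.2.2.1 w.2.2.2 := by
  simp_rw [fun w : α × E m × E d × E d => packet_eq_sum (R := R) (B := B) (hv w.1) hKm hK
    w.2.1 w.2.2.1 w.2.2.2]
  refine (Finset.measurable_sum _ fun k _ => ?_).const_mul _
  have h1 : Measurable fun w : α × E m × E d × E d => (𝐞 (-(inner ℝ (freq R k) w.2.2.1)) : ℂ) :=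
    measurable_char_inner measurable_const measurable_snd.snd.fst
  have h2 := measurable_ftx_comp hu (f := fun w : α × E m × E d × E d => w.1) measurable_fst
    measurable_snd.fst (measurable_snd.snd.snd.sub_const (freq R k))
  exact h1.mul h2

theorem measurable_packet_comp {α β : Type*} [MeasurableSpace α] [MeasurableSpace β]
    {u : α → E d × E m → ℂ} (hu : Measurable (Function.uncurry u)) (hv : ∀ s, IsTameFun K C (u s))
    (hKm : MeasurableSet K) (hK : volume K ≠ ∞) {f : β → α} {p : β → E m}
    {z ξ : β → E d} (hf : Measurable f) (hp : Measurable p) (hz : Measurable z)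
    (hξ : Measurable ξ) : Measurable fun b => packet R B (u (f b)) (p b) (z b) (ξ b) :=
  (measurable_packet hu hv hKm hK).comp (hf.prodMk (hp.prodMk (hz.prodMk hξ)))

theorem IsTameFun.measurable_packet_comp (hv : IsTameFun K C v) (hKm : MeasurableSet K)
    (hK : volume K ≠ ∞) {β : Type*} [MeasurableSpace β] {p : β → E m}
    {z ξ : β → E d} (hp : Measurable p) (hz : Measurable z)
    (hξ : Measurable ξ) : Measurable fun b => packet R B v (p b) (z b) (ξ b) :=
  HMeasure.measurable_packet_comp (u := fun _ : Unit => v) (hv.meas.comp measurable_snd)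
    (fun _ => hv) hKm hK (f := fun _ => ()) measurable_const hp hz hξ

theorem integrable_conj_mul_ftx (hv : IsTameFun K C v) (hKm : MeasurableSet K) (hK : volume K ≠ ∞)
    {h : E m → ℂ} (hh : Integrable h) (ξ : E d) :
    Integrable fun p => conj (h p) * ftx v p ξ := by
  refine (hh.norm.const_mul (C * volume.real K)).mono' ?_ (Eventually.of_forall fun p => ?_)
  · exact (RCLike.continuous_conj.comp_aestronglyMeasurable hh.1).mul
      (measurable_ftx_left hv.meas ξ).aestronglyMeasurable
  · rw [norm_mul, RCLike.norm_conj, mul_comm]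
    gcongr
    exact hv.norm_ftx_le hKm hK p ξ

theorem pcoef_eq_sum (hv : IsTameFun K C v) (hKm : MeasurableSet K) (hK : volume K ≠ ∞)
    {h : E m → ℂ} (hh : Integrable h) (z ξ : E d) :
    pcoef R B h v z ξ = ((Real.sqrt (B.card * (2 * R) ^ d))⁻¹ : ℝ) *
      ∑ k ∈ B, (𝐞 (-(inner ℝ (freq R k) z)) : ℂ) * coef h v (ξ - freq R k) := by
  have e : ∀ p, conj (h p) * packet R B v p z ξ = ((Real.sqrt (B.card * (2 * R) ^ d))⁻¹ : ℝ) *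
      ∑ k ∈ B, (𝐞 (-(inner ℝ (freq R k) z)) : ℂ) * (conj (h p) * ftx v p (ξ - freq R k)) := by
    intro p
    rw [packet_eq_sum hv hKm hK, mul_left_comm, Finset.mul_sum]
    congr 1
    exact Finset.sum_congr rfl fun k _ => by ring
  rw [pcoef]
  simp_rw [e]
  rw [integral_const_mul, integral_finsetSum _ fun k _ =>
    (integrable_conj_mul_ftx hv hKm hK hh _).const_mul _]
  congr 1
  exact Finset.sum_congr rfl fun k _ => by rw [integral_const_mul, coef]

theorem measurable_packet_left (hv : IsTameFun K C v) (hKm : MeasurableSet K) (hK : volume K ≠ ∞)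
    (z ξ : E d) : Measurable fun p => packet R B v p z ξ :=
  hv.measurable_packet_comp hKm hK measurable_id measurable_const measurable_const

theorem exists_norm_packet_le (hv : IsTameFun K C v) (hKm : MeasurableSet K) (hK : volume K ≠ ∞)
    (z ξ : E d) : ∃ A : ℝ, ∀ p, ‖packet R B v p z ξ‖ ≤ A := by
  refine ⟨‖(((Real.sqrt (B.card * (2 * R) ^ d))⁻¹ : ℝ) : ℂ)‖ * ∑ k ∈ B, C * volume.real K, fun p => ?_⟩
  rw [packet_eq_sum hv hKm hK, norm_mul]
  gcongr
  refine (norm_sum_le _ _).trans (Finset.sum_le_sum fun k _ => ?_)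
  rw [norm_mul, Circle.norm_coe, one_mul]
  exact hv.norm_ftx_le hKm hK _ _

theorem memLp_two_iff {α F : Type*} [MeasurableSpace α] [NormedAddCommGroup F] {μ : Measure α}
    {f : α → F} (hf : AEStronglyMeasurable f μ) : MemLp f 2 μ ↔ ∫⁻ x, ‖f x‖ₑ ^ 2 ∂μ < ∞ := by
  rw [lintegral_enorm_sq_eq_eLpNorm_sq]
  refine ⟨fun h => ENNReal.pow_lt_top h.2, fun h => ⟨hf, ?_⟩⟩
  by_contra hcon
  rw [not_lt, top_le_iff] at hcon
  simp [hcon] at h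

variable {ι : Type*} {h : ι → E m → ℂ} {l : ι → ℕ} {W : ℕ → ℝ}

/-- Bessel's inequality for `√W` times the packet. Since the weight equals `W (l i)` on the annulus
carrying `h i`, it comes out of the `i`-th coefficient. It bounds the normalised coefficients in
`packetState`. -/
theorem bessel_dens (hv : IsTameFun K C v) (hKm : MeasurableSet K) (hK : volume K ≠ ∞)
    (hb : IsAnnularBasis h l) (hW : ∀ n, 0 < W n)
    (hWf : ∫⁻ p : E m, ENNReal.ofReal (W ⌊‖p‖⌋₊) < ∞) (I : Finset ι) (z ξ : E d) :
    ∑ i ∈ I, ENNReal.ofReal (W (l i)) * ‖pcoef R B (h i) v z ξ‖ₑ ^ 2 ≤ dens W R B v z ξ := by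
  set g : E m → ℂ := fun p => (Real.sqrt (W ⌊‖p‖⌋₊) : ℂ) * packet R B v p z ξ with hg
  have hWm : Measurable fun p : E m => W ⌊‖p‖⌋₊ :=
    (measurable_of_countable W).comp (Nat.measurable_floor.comp measurable_norm)
  have hgm : Measurable g := by
    have h1 : Measurable fun p : E m => (Real.sqrt (W ⌊‖p‖⌋₊) : ℂ) :=
      Complex.measurable_ofReal.comp hWm.sqrt
    exact h1.mul (measurable_packet_left hv hKm hK z ξ)
  have hsq : ∀ n, ‖(Real.sqrt (W n) : ℂ)‖ₑ ^ 2 = ENNReal.ofReal (W n) := fun n => by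
    rw [← ofReal_norm, ← ENNReal.ofReal_pow (norm_nonneg _), Complex.norm_real, Real.norm_eq_abs,
      sq_abs, Real.sq_sqrt (hW n).le]
  have hg2 : ∫⁻ p, ‖g p‖ₑ ^ 2 = dens W R B v z ξ := by
    rw [dens]
    refine lintegral_congr fun p => ?_
    rw [hg, enorm_mul, mul_pow, hsq]
  have hfin : dens W R B v z ξ < ∞ := by
    obtain ⟨A, hA⟩ := exists_norm_packet_le (R := R) (B := B) hv hKm hK z ξ
    refine lt_of_le_of_lt (b := ∫⁻ p : E m, ENNReal.ofReal (W ⌊‖p‖⌋₊) * ENNReal.ofReal A ^ 2) ?_ ?_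
    · rw [dens]
      refine lintegral_mono fun p => ?_
      dsimp only
      gcongr
      rw [← ofReal_norm]; exact ENNReal.ofReal_le_ofReal (hA p)
    · rw [lintegral_mul_const _ hWm.ennreal_ofReal]
      exact ENNReal.mul_lt_top hWf (by simp)
  have hgL : MemLp g 2 := (memLp_two_iff hgm.aestronglyMeasurable).2 (hg2 ▸ hfin)
  rw [← hg2]
  refine le_trans (le_of_eq (Finset.sum_congr rfl fun i _ => ?_)) (hb.bessel g hgL I)
  have e : ∫ p, conj (h i p) * g p = (Real.sqrt (W (l i)) : ℂ) * pcoef R B (h i) v z ξ := by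
    rw [pcoef, ← integral_const_mul]
    refine integral_congr_ae (Eventually.of_forall fun p => ?_)
    by_cases hp : ⌊‖p‖⌋₊ = l i
    · simp only [hg, hp]; ring
    · simp [hb.supp i p hp]
  rw [e, enorm_mul, mul_pow, hsq]

theorem bessel_packet (hv : IsTameFun K C v) (hKm : MeasurableSet K) (hK : volume K ≠ ∞)
    (hb : IsAnnularBasis h l) (I : Finset ι) (z ξ : E d) :
    ∑ i ∈ I, ‖pcoef R B (h i) v z ξ‖ₑ ^ 2 ≤ ∫⁻ p, ‖packet R B v p z ξ‖ₑ ^ 2 := by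
  by_cases hfin : ∫⁻ p, ‖packet R B v p z ξ‖ₑ ^ 2 < ∞
  · simp only [pcoef]
    exact hb.bessel _ ((memLp_two_iff
      (measurable_packet_left hv hKm hK z ξ).aestronglyMeasurable).2 hfin) I
  · rw [not_lt, top_le_iff] at hfin
    rw [hfin]; exact le_top

theorem lintegral_packet_sq (hv : IsTameFun K C v) (hKm : MeasurableSet K) (hK : volume K ≠ ∞)
    (p : E m) (z : E d) :
    ∫⁻ ξ, ‖packet R B v p z ξ‖ₑ ^ 2 = ∫⁻ x, ‖window R B (x - z)‖ₑ ^ 2 * ‖v (x, p)‖ₑ ^ 2 := by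
  obtain ⟨A, hA⟩ : ∃ A : ℝ, ∀ y : E d, ‖window R B y‖ ≤ A := by
    refine ⟨‖(((Real.sqrt (B.card * (2 * R) ^ d))⁻¹ : ℝ) : ℂ)‖ * ∑ k ∈ B, 1, fun y => ?_⟩
    rw [window, norm_mul]
    gcongr
    exact (norm_sum_le _ _).trans (Finset.sum_le_sum fun k _ => (Circle.norm_coe _).le)
  have hA0 : 0 ≤ A := (norm_nonneg _).trans (hA 0)
  have hi := hv.integrable_slice hKm hK p
  have hm : AEStronglyMeasurable (fun x => window R B (x - z) * v (x, p)) :=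
    ((continuous_window R B).comp (by fun_prop)).aestronglyMeasurable.mul hi.1
  have h1 : Integrable fun x => window R B (x - z) * v (x, p) := by
    refine (hi.norm.const_mul A).mono' hm (Eventually.of_forall fun x => ?_)
    rw [norm_mul]; gcongr; exact hA _
  have h2 : MemLp (fun x => window R B (x - z) * v (x, p)) 2 := by
    refine (memLp_two_iff hm).2 (lt_of_le_of_lt (b := ∫⁻ x, ENNReal.ofReal (A * C) *
      ‖window R B (x - z) * v (x, p)‖ₑ) (lintegral_mono fun x => ?_) ?_)
    · rw [sq]
      gcongr
      rw [← ofReal_norm, norm_mul]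
      exact ENNReal.ofReal_le_ofReal (by gcongr; exacts [hA _, hv.bound _])
    · rw [lintegral_const_mul' _ _ ENNReal.ofReal_ne_top]
      exact ENNReal.mul_lt_top ENNReal.ofReal_lt_top h1.2
  unfold packet
  rw [lintegral_enorm_sq_fourier h1 h2]
  exact lintegral_congr fun x => by rw [enorm_mul, mul_pow]

/-- Plancherel in `x`, with `|v| ≤ C` and a window of unit norm on the cube. The bound is uniform in
the centre `z`, which will make the spatial marginal absolutely continuous with bounded density; the
integrability of `W` is what makes the integral in `p` finite. -/
theorem lintegral_dens_le (hv : IsTameFun K C v) (hKm : MeasurableSet K) (hK : volume K ≠ ∞)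
    (hR : 0 < R) (hB : B.Nonempty) (hKR : K ⊆ cube d R) (z : E d) :
    ∫⁻ ξ, dens W R B v z ξ ≤ ENNReal.ofReal C ^ 2 * ∫⁻ p : E m, ENNReal.ofReal (W ⌊‖p‖⌋₊) := by
  have hWm : Measurable fun p : E m => ENNReal.ofReal (W ⌊‖p‖⌋₊) :=
    ((measurable_of_countable W).comp (Nat.measurable_floor.comp measurable_norm)).ennreal_ofReal
  have hpm : Measurable fun w : E d × E m => packet R B v w.2 z w.1 :=
    hv.measurable_packet_comp hKm hK measurable_snd measurable_const measurable_fst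
  unfold dens
  rw [lintegral_lintegral_swap]
  swap
  · exact ((hWm.comp measurable_snd).mul (hpm.enorm.pow_const 2)).aemeasurable
  rw [← lintegral_const_mul _ hWm]
  refine lintegral_mono fun p => ?_
  have hpm2 : Measurable fun ξ => ‖packet R B v p z ξ‖ₑ ^ 2 :=
    (hv.measurable_packet_comp hKm hK measurable_const measurable_const
      measurable_id).enorm.pow_const 2
  rw [lintegral_const_mul _ hpm2, mul_comm (ENNReal.ofReal C ^ 2)]
  gcongr
  rw [lintegral_packet_sq hv hKm hK]
  calc ∫⁻ x, ‖window R B (x - z)‖ₑ ^ 2 * ‖v (x, p)‖ₑ ^ 2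
      ≤ ∫⁻ x, (cube d R).indicator (fun x => ‖window R B (x - z)‖ₑ ^ 2 * ENNReal.ofReal C ^ 2) x := by
        refine lintegral_mono fun x => ?_
        by_cases hx : x ∈ cube d R
        · rw [indicator_of_mem hx]
          gcongr
          rw [← ofReal_norm]; exact ENNReal.ofReal_le_ofReal (hv.bound _)
        · simp [hv.supp (x, p) (fun h' => hx (hKR h'))]
    _ = ENNReal.ofReal C ^ 2 := by
        rw [lintegral_indicator (measurableSet_cube R), lintegral_mul_const]
        · have := lintegral_window_sq hR hB (-z) (Or.inl rfl : (1 : ℝ) = 1 ∨ (1 : ℝ) = -1)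
          simp only [one_smul, ← sub_eq_add_neg] at this
          rw [this, one_mul]
        · exact ((continuous_window R B).comp (by fun_prop)).measurable.enorm.pow_const 2

/-- After Plancherel in `x`, integrating the translated window over its centre gives one, so the
transform preserves the `L²` norm. -/
theorem lintegral_lintegral_packet_sq (hv : IsTameFun K C v) (hKm : MeasurableSet K)
    (hK : volume K ≠ ∞) (hR : 0 < R) (hB : B.Nonempty) :
    ∫⁻ z in cube d R, ∫⁻ ξ, ∫⁻ p, ‖packet R B v p z ξ‖ₑ ^ 2 = ∫⁻ y, ‖v y‖ₑ ^ 2 := by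
  have hwm : Measurable fun y : E d => ‖window R B y‖ₑ ^ 2 :=
    (continuous_window R B).measurable.enorm.pow_const 2
  have hvm : Measurable fun y : E d × E m => ‖v y‖ₑ ^ 2 := hv.meas.enorm.pow_const 2
  have h1 : ∀ z, ∫⁻ ξ, ∫⁻ p, ‖packet R B v p z ξ‖ₑ ^ 2 =
      ∫⁻ y : E d × E m, ‖window R B (y.1 - z)‖ₑ ^ 2 * ‖v y‖ₑ ^ 2 := by
    intro z
    rw [lintegral_lintegral_swap]
    · simp_rw [lintegral_packet_sq hv hKm hK]
      rw [Measure.volume_eq_prod, lintegral_prod_symm']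
      exact (hwm.comp (by fun_prop)).mul hvm
    · have : Measurable fun w : E d × E m => packet R B v w.2 z w.1 :=
        hv.measurable_packet_comp hKm hK measurable_snd measurable_const measurable_fst
      exact (this.enorm.pow_const 2).aemeasurable
  simp_rw [h1]
  rw [lintegral_lintegral_swap]
  · refine lintegral_congr fun y => ?_
    have hm : Measurable fun z : E d => ‖window R B (y.1 - z)‖ₑ ^ 2 :=
      hwm.comp (measurable_const.sub measurable_id)
    rw [lintegral_mul_const _ hm]
    have := lintegral_window_sq hR hB y.1 (Or.inr rfl : (-1 : ℝ) = 1 ∨ (-1 : ℝ) = -1)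
    simp only [neg_smul, one_smul, neg_add_eq_sub] at this
    rw [this, one_mul]
  · have : Measurable fun w : E d × (E d × E m) => ‖window R B (w.2.1 - w.1)‖ₑ ^ 2 * ‖v w.2‖ₑ ^ 2 :=
      (hwm.comp (by fun_prop)).mul (hvm.comp measurable_snd)
    exact this.aemeasurable

end Packet

/-! ### Amplitudes of bounded sequences that converge weakly in `(x, p)`. -/

section TameSeq

variable {α : Type*} [MeasurableSpace α] {d m : ℕ}

/-- A bounded sequence of random functions, which vanish for `x ∉ K` and tend to `0` strongly in
the parameter `s` and weakly in `(x, p)`. -/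
structure IsTameSeq (ρ : Measure α) (K : Set (E d)) (C : ℝ) (u : ℕ → α → E d × E m → ℂ) :
    Prop where
  meas : ∀ n, Measurable (Function.uncurry (u n))
  tame : ∀ n s, IsTameFun K C (u n s)
  weak : ∀ g : E d × E m → ℂ, Integrable g → MemLp g 2 →
    Tendsto (fun n => ∫⁻ s, ‖∫ y, u n s y * g y‖ₑ ^ 2 ∂ρ) atTop (𝓝 0)

theorem measurable_vhat {K : Set (E d)} (hK : volume K ≠ ∞) {N : ℕ} {v : α → E d × E m → ℂ}
    (hv : Measurable (Function.uncurry v)) {φ : E d × E m → ℂ} (hφ : Measurable φ) :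
    Measurable fun w : α × E d => vhat K N φ (v w.1) w.2 := by
  have := isFiniteMeasure_lam hK m N
  have h1 := measurable_char_inner (f := fun w : (α × E d) × E d × E m => w.2.1)
    measurable_snd.fst measurable_fst.snd
  have h2 : Measurable fun w : (α × E d) × E d × E m => v w.1.1 w.2 := by
    have : Measurable fun w : (α × E d) × E d × E m => (w.1.1, w.2) := by fun_prop
    exact hv.comp this
  simp only [vhat]
  exact (h1.mul ((hφ.comp measurable_snd).mul h2)).stronglyMeasurable.integral_prod_right'.measurable

theorem measurable_symMul {φ : ℝ → ℂ} {ψ : S d → ℂ} (hφ : AEStronglyMeasurable φ)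
    (hψ : Continuous ψ) : Measurable fun w : ℝ × E d => symMul φ ψ w.1 w.2 := by
  have e : (fun w : ℝ × E d => symMul φ ψ w.1 w.2) = fun w => ∫ ξ₀ : ℝ,
      (𝐞 (-(ξ₀ * w.1)) : ℂ) * (radialSymbol ψ (joinFreq ξ₀ w.2) * hφ.mk φ ξ₀) := by
    ext w
    refine integral_congr_ae ?_
    filter_upwards [hφ.ae_eq_mk] with x hx
    rw [hx]
  rw [e]
  have h1 : Measurable fun w : (ℝ × E d) × ℝ => (𝐞 (-(w.2 * w.1.1)) : ℂ) :=
    measurable_char.comp (by fun_prop)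
  have h2 : Measurable fun w : (ℝ × E d) × ℝ => radialSymbol ψ (joinFreq w.2 w.1.2) := by
    have : Measurable fun w : (ℝ × E d) × ℝ => (w.2, w.1.2) := by fun_prop
    exact (measurable_radialSymbol hψ).comp (continuous_joinFreq.measurable.comp this)
  have h3 : Measurable (hφ.mk φ) := hφ.stronglyMeasurable_mk.measurable
  exact (h1.mul (h2.mul (h3.comp measurable_snd))).stronglyMeasurable.integral_prod_right'.measurable

/-- The limit of the constant in the `L²` bound of `vhat`. -/
noncomputable def vhatBound (ρ : Measure α) (m : ℕ) (C : ℝ) (N : ℕ) : ℝ≥0∞ :=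
  ρ univ * (ENNReal.ofReal C ^ 2 * volume {p : E m | ‖p‖ < (N : ℝ)})

theorem vhatBound_lt_top (ρ : Measure α) [IsFiniteMeasure ρ] (C : ℝ) (N : ℕ) :
    vhatBound ρ m C N < ∞ :=
  ENNReal.mul_lt_top (measure_lt_top _ _) (ENNReal.mul_lt_top (by simp) (volume_ball_lt_top m N))

variable {ρ : Measure α} [IsFiniteMeasure ρ] {K : Set (E d)} {C : ℝ} {u : ℕ → α → E d × E m → ℂ}

omit [IsFiniteMeasure ρ] in
theorem IsTameSeq.lintegral_vhat_sq_le (hu : IsTameSeq ρ K C u) (hKm : MeasurableSet K)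
    (hK : volume K ≠ ∞) {N : ℕ} {φ : E d × E m → ℂ} (hφ : Measurable φ)
    (hφ2 : MemLp φ 2 (lam K m N)) (n : ℕ) :
    ∫⁻ w, ‖vhat K N φ (u n w.1) w.2‖ₑ ^ 2 ∂(ρ.prod volume) ≤
      vhatBound ρ m C N * ∫⁻ y, ‖φ y‖ₑ ^ 2 ∂(lam K m N) := by
  rw [lintegral_prod _ ((measurable_vhat hK (hu.meas n) hφ).enorm.pow_const 2).aemeasurable]
  refine (lintegral_mono fun s => lintegral_enorm_vhat_sq_le (hu.tame n s) hKm hK hφ2).trans ?_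
  rw [lintegral_const, vhatBound, mul_comm, ← mul_assoc]

/-- At a fixed `ξ` the transform is the pairing of `u n` with one fixed function, so its mean square
tends to zero by weak convergence. The uniform bound on `u n` dominates on a ball of frequencies. -/
theorem IsTameSeq.tendsto_low (hu : IsTameSeq ρ K C u) (hKm : MeasurableSet K)
    (hK : volume K ≠ ∞) {N : ℕ} {φ : E d × E m → ℂ} (hφ : Measurable φ)
    (hφ2 : MemLp φ 2 (lam K m N)) (R : ℝ) :
    Tendsto (fun n => ∫⁻ w in {w : α × E d | ‖w.2‖ ≤ R}, ‖vhat K N φ (u n w.1) w.2‖ₑ ^ 2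
      ∂(ρ.prod volume)) atTop (𝓝 0) := by
  have hfin := isFiniteMeasure_lam hK m N
  have hφ1 := integrable_of_memLp_two hφ2
  have hmeas := fun n => (measurable_vhat (N := N) hK (hu.meas n) hφ).enorm.pow_const 2
  have hpt : ∀ ξ : E d, Tendsto (fun n => ∫⁻ s, ‖vhat K N φ (u n s) ξ‖ₑ ^ 2 ∂ρ) atTop (𝓝 0) := by
    intro ξ
    set D : Set (E d × E m) := K ×ˢ {p : E m | ‖p‖ < N}
    have hD : MeasurableSet D := hKm.prod (measurableSet_normBall m N)
    set g : E d × E m → ℂ := D.indicator fun y => (𝐞 (-(inner ℝ y.1 ξ)) : ℂ) * φ y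
    have hgm : Measurable fun y : E d × E m => (𝐞 (-(inner ℝ y.1 ξ)) : ℂ) * φ y :=
      (measurable_char_inner measurable_fst measurable_const).mul hφ
    have hg1 : Integrable g := by
      refine (integrable_indicator_iff hD).2 ?_
      rw [IntegrableOn, ← lam_eq_restrict]
      exact integrable_exp_mul hφ1 ξ
    have hg2 : MemLp g 2 := by
      rw [memLp_indicator_iff_restrict hD, ← lam_eq_restrict]
      refine (memLp_congr_norm hφ2.1 hgm.aestronglyMeasurable (Eventually.of_forall fun y => ?_)).1 hφ2
      rw [norm_mul, Circle.norm_coe, one_mul]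
    refine (hu.weak g hg1 hg2).congr fun n => lintegral_congr fun s => ?_
    have e : vhat K N φ (u n s) ξ = ∫ y, u n s y * g y := by
      rw [vhat, lam_eq_restrict, ← integral_indicator hD]
      refine integral_congr_ae (Eventually.of_forall fun y => ?_)
      by_cases hy : y ∈ D
      · simp only [g, indicator_of_mem hy]; ring
      · simp [g, hy]
    rw [e]
  have hball : volume {ξ : E d | ‖ξ‖ ≤ R} ≠ ∞ := by
    have : {ξ : E d | ‖ξ‖ ≤ R} = Metric.closedBall 0 R := by ext; simp
    rw [this]; exact measure_closedBall_lt_top.ne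
  have h1 : Tendsto (fun n => ∫⁻ ξ in {ξ : E d | ‖ξ‖ ≤ R}, ∫⁻ s, ‖vhat K N φ (u n s) ξ‖ₑ ^ 2 ∂ρ)
      atTop (𝓝 (∫⁻ _ in {ξ : E d | ‖ξ‖ ≤ R}, 0)) := by
    refine tendsto_lintegral_of_dominated_convergence
      (fun _ => ENNReal.ofReal (C * ∫ y, ‖φ y‖ ∂(lam K m N)) ^ 2 * ρ univ) (fun n => ?_) (fun n => ?_) ?_
      (Eventually.of_forall hpt)
    · exact (hmeas n).lintegral_prod_left'
    · refine Eventually.of_forall fun ξ => ?_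
      rw [← lintegral_const]
      refine lintegral_mono fun s => ?_
      gcongr
      rw [← ofReal_norm]
      exact ENNReal.ofReal_le_ofReal ((hu.tame n s).norm_vhat_le hφ1 ξ)
    · rw [setLIntegral_const]
      exact ENNReal.mul_ne_top (ENNReal.mul_ne_top (by simp) (measure_ne_top _ _)) hball
  rw [lintegral_zero] at h1
  refine h1.congr fun n => ?_
  have e : {w : α × E d | ‖w.2‖ ≤ R} = univ ×ˢ {ξ : E d | ‖ξ‖ ≤ R} := by ext; simp
  rw [e, ← Measure.prod_restrict, Measure.restrict_univ, lintegral_prod_symm' _ (hmeas n)]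

/-- The expectation of the integrand, after the inner integrations have been carried out. -/
noncomputable def amplitude (ρ : Measure α) (τ : α → ℝ) (K : Set (E d)) (N : ℕ) (φ : ℝ → ℂ)
    (ψ : S d → ℂ) (v : α → E d × E m → ℂ) (φ₁ φ₂ : E d × E m → ℂ) : ℂ :=
  ∫ w, symMul φ ψ (τ w.1) w.2 * (vhat K N φ₁ (v w.1) w.2 * conj (vhat K N φ₂ (v w.1) w.2))
    ∂(ρ.prod volume)

theorem integrable_mul_conj {β : Type*} [MeasurableSpace β] {μ : Measure β} {k f g : β → ℂ} {A : ℝ}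
    (hk : AEStronglyMeasurable k μ) (hA : ∀ x, ‖k x‖ ≤ A)
    (hf : MemLp f 2 μ) (hg : MemLp g 2 μ) :
    Integrable (fun x => k x * (f x * conj (g x))) μ := by
  have hfg : Integrable (fun x => f x * conj (g x)) μ := by
    have hg' : MemLp (fun x => conj (g x)) 2 μ :=
      (memLp_congr_norm hg.1 (RCLike.continuous_conj.comp_aestronglyMeasurable hg.1)
        (Eventually.of_forall fun x => by simp)).1 hg
    exact hf.integrable_mul hg'
  exact hfg.bdd_mul hk (Eventually.of_forall hA)

theorem norm_integral_mul_conj_le {β : Type*} [MeasurableSpace β] {μ : Measure β} {k f g : β → ℂ}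
    {A : ℝ} (hA : ∀ x, ‖k x‖ ≤ A) (hf : AEMeasurable f μ) (hg : AEMeasurable g μ)
    {F G : ℝ≥0∞} (hF : ∫⁻ x, ‖f x‖ₑ ^ 2 ∂μ ≤ F) (hG : ∫⁻ x, ‖g x‖ₑ ^ 2 ∂μ ≤ G) :
    ‖∫ x, k x * (f x * conj (g x)) ∂μ‖ₑ ≤ ENNReal.ofReal A * (F * G) ^ (1 / 2 : ℝ) := by
  calc _ ≤ ∫⁻ x, ENNReal.ofReal A * (‖f x‖ₑ * ‖g x‖ₑ) ∂μ := by
        refine (enorm_integral_le_lintegral_enorm _).trans (lintegral_mono fun x => ?_)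
        rw [enorm_mul, enorm_mul, RCLike.enorm_conj]
        gcongr
        rw [← ofReal_norm]; exact ENNReal.ofReal_le_ofReal (hA x)
    _ = ENNReal.ofReal A * ∫⁻ x, ‖f x‖ₑ * ‖g x‖ₑ ∂μ := lintegral_const_mul' _ _ ENNReal.ofReal_ne_top
    _ ≤ _ := by
        gcongr
        exact lintegral_mul_le_sqrt hf.enorm hg.enorm hF hG

theorem vhat_add (hK : volume K ≠ ∞) {N : ℕ} {v : E d × E m → ℂ} (hv : IsTameFun K C v)
    (f g : Lp ℂ 2 (lam K m N)) (ξ : E d) :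
    vhat K N (f + g : Lp ℂ 2 (lam K m N)) v ξ = vhat K N f v ξ + vhat K N g v ξ := by
  have := isFiniteMeasure_lam hK m N
  have hi := fun f : Lp ℂ 2 (lam K m N) =>
    integrable_exp_mul (hv.integrable_mul (integrable_of_memLp_two (Lp.memLp f))) ξ
  rw [vhat, vhat, vhat, ← integral_add (hi f) (hi g)]
  refine integral_congr_ae ?_
  filter_upwards [Lp.coeFn_add f g] with y hy
  rw [hy, Pi.add_apply]; ring

theorem vhat_smul {N : ℕ} {v : E d × E m → ℂ} (c : ℂ)
    (f : Lp ℂ 2 (lam K m N)) (ξ : E d) :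
    vhat K N (c • f : Lp ℂ 2 (lam K m N)) v ξ = c * vhat K N f v ξ := by
  rw [vhat, vhat, ← integral_const_mul]
  refine integral_congr_ae ?_
  filter_upwards [Lp.coeFn_smul c f] with y hy
  rw [hy, Pi.smul_apply, smul_eq_mul]; ring

theorem vhat_congr {N : ℕ} {v φ φ' : E d × E m → ℂ} (h : φ =ᵐ[lam K m N] φ') (ξ : E d) :
    vhat K N φ v ξ = vhat K N φ' v ξ := by
  rw [vhat, vhat]
  refine integral_congr_ae ?_
  filter_upwards [h] with y hy
  rw [hy]

theorem IsTameSeq.memLp_vhat (hu : IsTameSeq ρ K C u) (hKm : MeasurableSet K)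
    (hK : volume K ≠ ∞) {N : ℕ} {φ : E d × E m → ℂ} (hφ : Measurable φ)
    (hφ2 : MemLp φ 2 (lam K m N)) (n : ℕ) :
    MemLp (fun w : α × E d => vhat K N φ (u n w.1) w.2) 2 (ρ.prod volume) := by
  refine (memLp_two_iff (measurable_vhat hK (hu.meas n) hφ).aestronglyMeasurable).2
    ((hu.lintegral_vhat_sq_le hKm hK hφ hφ2 n).trans_lt ?_)
  exact ENNReal.mul_lt_top (vhatBound_lt_top ρ C N) ((memLp_two_iff hφ2.1).1 hφ2)

/-- The constant is independent of `n`, as needed for `IsBddSesq.tendsto_of_dense`. -/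
theorem isBddSesq_amplitude (hu : IsTameSeq ρ K C u) (hKm : MeasurableSet K) (hK : volume K ≠ ∞)
    {τ : α → ℝ} (hτ : Measurable τ) {φ : ℝ → ℂ} (hφ : Integrable φ) {ψ : S d → ℂ}
    (hψ : Continuous ψ) (N : ℕ) {A : ℝ} (hA0 : 0 ≤ A) (hA : ∀ ξ, ‖ψ ξ‖ ≤ A) (n : ℕ) :
    IsBddSesq (fun f g : Lp ℂ 2 (lam K m N) => amplitude ρ τ K N φ ψ (u n) f g)
      ((A * ∫ x, ‖φ x‖) * (vhatBound ρ m C N).toReal) := by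
  have hL := fun f : Lp ℂ 2 (lam K m N) => (Lp.stronglyMeasurable f).measurable
  have hm := fun f => hu.memLp_vhat hKm hK (hL f) (Lp.memLp f) n
  have hkm : Measurable fun w : α × E d => symMul φ ψ (τ w.1) w.2 :=
    (measurable_symMul hφ.1 hψ).comp (f := fun w : α × E d => (τ w.1, w.2))
      ((hτ.comp measurable_fst).prodMk measurable_snd)
  have hb : ∀ w : α × E d, ‖symMul φ ψ (τ w.1) w.2‖ ≤ A * ∫ x, ‖φ x‖ := fun w =>
    norm_symMul_le hφ hA0 hA _ _
  have hi := fun f g => integrable_mul_conj hkm.aestronglyMeasurable hb (hm f) (hm g)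
  refine ⟨fun f g h => ?_, fun c f h => ?_, fun f g h => ?_, fun c f h => ?_, fun f g => ?_⟩
  · simp only [amplitude]
    rw [← integral_add (hi f h) (hi g h)]
    refine integral_congr_ae (Eventually.of_forall fun w => ?_)
    simp only [vhat_add hK (hu.tame n w.1)]; ring
  · simp only [amplitude]
    rw [← integral_const_mul]
    refine integral_congr_ae (Eventually.of_forall fun w => ?_)
    simp only [vhat_smul]; ring
  · simp only [amplitude]
    rw [← integral_add (hi f g) (hi f h)]
    refine integral_congr_ae (Eventually.of_forall fun w => ?_)
    simp only [vhat_add hK (hu.tame n w.1), map_add]; ring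
  · simp only [amplitude]
    rw [← integral_const_mul]
    refine integral_congr_ae (Eventually.of_forall fun w => ?_)
    simp only [vhat_smul, map_mul]; ring
  · have hB : 0 ≤ A * ∫ x, ‖φ x‖ := by positivity
    have h1 := norm_integral_mul_conj_le (μ := ρ.prod volume) hb
      (measurable_vhat hK (hu.meas n) (hL f)).aemeasurable
      (measurable_vhat hK (hu.meas n) (hL g)).aemeasurable
      (hu.lintegral_vhat_sq_le hKm hK (hL f) (Lp.memLp f) n)
      (hu.lintegral_vhat_sq_le hKm hK (hL g) (Lp.memLp g) n)
    have e : ∀ f : Lp ℂ 2 (lam K m N), ∫⁻ y, ‖f y‖ₑ ^ 2 ∂(lam K m N) = ENNReal.ofReal (‖f‖ ^ 2) := by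
      intro f
      rw [← enorm_toLp_sq (Lp.memLp f), Lp.toLp_coeFn]
    have hV := (vhatBound_lt_top (m := m) ρ C N).ne
    rw [e, e, ← ENNReal.ofReal_toReal hV, ← ENNReal.ofReal_mul ENNReal.toReal_nonneg,
      ← ENNReal.ofReal_mul ENNReal.toReal_nonneg, ← ENNReal.ofReal_mul (by positivity),
      ENNReal.ofReal_rpow_of_nonneg (by positivity) (by positivity), ← ENNReal.ofReal_mul hB,
      ← ofReal_norm, ENNReal.ofReal_le_ofReal_iff (by positivity)] at h1
    refine h1.trans (le_of_eq ?_)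
    have e2 : (vhatBound ρ m C N).toReal * ‖f‖ ^ 2 * ((vhatBound ρ m C N).toReal * ‖g‖ ^ 2) =
        ((vhatBound ρ m C N).toReal * ‖f‖ * ‖g‖) ^ 2 := by ring
    rw [e2, ← Real.sqrt_eq_rpow, Real.sqrt_sq (by positivity)]
    ring

end TameSeq

/-! ### Inequalities which pass to weak limits of measures. -/

section WeakLimits

/-- Compactness of bounded sequences of measures carried by one compact set. -/
theorem exists_subseq_tendsto_integral_of_isCompact {Y : Type*} [TopologicalSpace Y]
    [TopologicalSpace.MetrizableSpace Y] [MeasurableSpace Y] [BorelSpace Y] {S : Set Y}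
    (hS : IsCompact S) (μ : ℕ → ℕ → Measure Y) {C : ℝ} [∀ n j, IsFiniteMeasure (μ n j)]
    (hC : ∀ n j, (μ n j).real univ ≤ C) (hs : ∀ n j, μ n j Sᶜ = 0) :
    ∃ σ : ℕ → ℕ, StrictMono σ ∧ ∃ μ' : ℕ → Measure Y,
      (∀ j, IsFiniteMeasure (μ' j)) ∧ (∀ j, μ' j Sᶜ = 0) ∧
      ∀ (j : ℕ) (g : Y → ℂ), Continuous g →
        Tendsto (fun n => ∫ x, g x ∂(μ (σ n) j)) atTop (𝓝 (∫ x, g x ∂(μ' j))) := by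
  have hSm : MeasurableSet S := hS.isClosed.measurableSet
  have : CompactSpace S := isCompact_iff_compactSpace.1 hS
  have hemb := MeasurableEmbedding.subtype_coe hSm
  have hμS : ∀ n j, (μ n j).restrict S = μ n j := fun n j =>
    Measure.restrict_eq_self_of_ae_mem (mem_ae_iff.2 (hs n j))
  have hfin : ∀ n j, IsFiniteMeasure ((μ n j).comap (Subtype.val : S → Y)) := fun n j =>
    ⟨by rw [hemb.comap_apply]; exact measure_lt_top _ _⟩
  obtain ⟨σ, hσ, μ', h1, -, h3⟩ := exists_subseq_tendsto_integral
    (fun n j => (μ n j).comap (Subtype.val : S → Y)) C (fun n j => by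
      refine le_trans ?_ (hC n j)
      rw [measureReal_def, hemb.comap_apply]
      exact ENNReal.toReal_mono (measure_ne_top _ _) (measure_mono (subset_univ _)))
  refine ⟨σ, hσ, fun j => (μ' j).map Subtype.val, fun j => ?_, fun j => ?_, fun j g hg => ?_⟩
  · have := h1 j
    infer_instance
  · rw [hemb.map_apply]
    have : (Subtype.val : S → Y) ⁻¹' Sᶜ = ∅ := by ext x; simp
    simp [this]
  · rw [hemb.integral_map]
    refine (h3 j (fun x => g x) (hg.comp continuous_subtype_val)).congr fun n => ?_
    rw [integral_subtype_comap hSm, hμS]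

theorem lintegral_le_of_tendsto {Y : Type*} [TopologicalSpace Y] [TopologicalSpace.MetrizableSpace Y]
    [MeasurableSpace Y] [BorelSpace Y] {S : Set Y} (hS : IsCompact S) {μ : ℕ → Measure Y}
    {μ' : Measure Y} [∀ n, IsFiniteMeasure (μ n)] [IsFiniteMeasure μ'] (hs : ∀ n, μ n Sᶜ = 0)
    (hs' : μ' Sᶜ = 0) (ht : ∀ g : Y → ℂ, Continuous g →
      Tendsto (fun n => ∫ x, g x ∂(μ n)) atTop (𝓝 (∫ x, g x ∂μ'))) {f : Y → ℝ} (hf : Continuous f)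
    (hf0 : ∀ y, 0 ≤ f y) {M : ℝ≥0∞} (hM : ∀ n, ∫⁻ y, ENNReal.ofReal (f y) ∂(μ n) ≤ M) :
    ∫⁻ y, ENNReal.ofReal (f y) ∂μ' ≤ M := by
  have hint : ∀ (ν : Measure Y) [IsFiniteMeasure ν], ν Sᶜ = 0 → Integrable f ν := by
    intro ν _ hν
    obtain ⟨A, hA⟩ := hS.exists_bound_of_continuousOn hf.continuousOn
    refine (integrable_const A).mono' hf.measurable.aestronglyMeasurable ?_
    have : ∀ᵐ y ∂ν, y ∈ S := mem_ae_iff.2 hν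
    exact this.mono hA
  have h1 : Tendsto (fun n => ∫ x, f x ∂(μ n)) atTop (𝓝 (∫ x, f x ∂μ')) := by
    have := (Complex.continuous_re.tendsto _).comp (ht (fun y => (f y : ℂ)) (by fun_prop))
    simpa only [Function.comp_def, integral_complex_ofReal, Complex.ofReal_re] using this
  rw [← ofReal_integral_eq_lintegral_ofReal (hint μ' hs') (Eventually.of_forall hf0)]
  refine le_of_tendsto (ENNReal.tendsto_ofReal h1) (Eventually.of_forall fun n => ?_)
  rw [ofReal_integral_eq_lintegral_ofReal (hint (μ n) (hs n)) (Eventually.of_forall hf0)]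
  exact hM n

/-- Closed sets are reached by thickened indicators, all measurable sets by inner regularity with
respect to closed sets. -/
theorem measure_le_of_forall_continuous {X : Type*} [PseudoEMetricSpace X] [MeasurableSpace X]
    [BorelSpace X] {μ ν : Measure X} [IsFiniteMeasure μ] [IsFiniteMeasure ν]
    (h : ∀ g : X → ℝ, Continuous g → (∀ x, 0 ≤ g x) →
      ∫⁻ x, ENNReal.ofReal (g x) ∂μ ≤ ∫⁻ x, ENNReal.ofReal (g x) ∂ν) : μ ≤ ν := by
  have hcl : ∀ F : Set X, IsClosed F → μ F ≤ ν F := by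
    intro F hF
    have hl := tendsto_lintegral_thickenedIndicator_of_isClosed ν hF
      (δs := fun n : ℕ => 1 / ((n : ℝ) + 1)) (fun n => by positivity)
      tendsto_one_div_add_atTop_nhds_zero_nat
    refine ge_of_tendsto hl (Eventually.of_forall fun n => ?_)
    have h2 := h (fun x => thickenedIndicator (δ := 1 / ((n : ℝ) + 1)) (by positivity) F x)
      (by fun_prop) (fun x => by positivity)
    simp only [ENNReal.ofReal_coe_nnreal] at h2
    exact (measure_le_lintegral_thickenedIndicator μ hF.measurableSet _).trans h2
  refine Measure.le_iff.2 fun A hA => ?_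
  rw [hA.measure_eq_iSup_isClosed_of_ne_top (measure_ne_top _ _)]
  exact iSup₂_le fun F hFA => iSup_le fun hF => (hcl F hF).trans (measure_mono hFA)

end WeakLimits

/-! ### The compact state space and its measures. -/

section PacketMeasure

variable {α : Type*} [MeasurableSpace α] {d m : ℕ} {ι : Type} [Countable ι]

/-- The space that carries the limiting measures: position and direction, time, and the
normalized coefficients of the wave packet transform. -/
abbrev State (d : ℕ) (ι : Type) : Type := (E d × S d) × (ℝ × (ι → ℂ))

/-- The compact part of the state space that carries the measures. -/
def stateSet (d : ℕ) (ι : Type) (R T : ℝ) : Set (State d ι) :=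
  {y | y.1.1 ∈ cube d R ∧ y.2.1 ∈ Icc 0 T ∧ ∀ I : Finset ι, ∑ i ∈ I, ‖y.2.2 i‖ ^ 2 ≤ 1}

omit [Countable ι] in
theorem isCompact_stateSet (R T : ℝ) : IsCompact (stateSet d ι R T) := by
  have hc : IsCompact (((cube d R) ×ˢ (univ : Set (S d))) ×ˢ
      ((Icc 0 T) ×ˢ (Set.pi univ fun _ : ι => Metric.closedBall (0 : ℂ) 1))) :=
    ((isCompact_cube R).prod isCompact_univ).prod
      (isCompact_Icc.prod (isCompact_univ_pi fun _ => isCompact_closedBall _ _))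
  refine hc.of_isClosed_subset ?_ ?_
  · have e : stateSet d ι R T = (fun y : State d ι => y.1.1) ⁻¹' cube d R ∩
        ((fun y : State d ι => y.2.1) ⁻¹' Icc 0 T ∩
          ⋂ I : Finset ι, {y : State d ι | ∑ i ∈ I, ‖y.2.2 i‖ ^ 2 ≤ 1}) := by
      ext; simp [stateSet]
    rw [e]
    refine ((isClosed_cube R).preimage (by fun_prop)).inter ((isClosed_Icc.preimage (by fun_prop)).inter
      (isClosed_iInter fun I => isClosed_le (by fun_prop) continuous_const))
  · rintro y ⟨h1, h2, h3⟩
    refine ⟨⟨h1, mem_univ _⟩, h2, fun i _ => ?_⟩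
    have := h3 {i}
    rw [Finset.sum_singleton] at this
    rw [mem_closedBall_zero_iff]
    nlinarith [norm_nonneg (y.2.2 i)]

/-- The properties of wave packet measures which are inherited by weak limits. -/
structure IsPacketMeasure (W : ℕ → ℝ) (l : ι → ℕ) (R T : ℝ) (C₁ C₂ : ℝ≥0∞) (N : Measure (State d ι)) :
    Prop where
  supp : N (stateSet d ι R T)ᶜ = 0
  marg : ∀ g : E d → ℝ, Continuous g → (∀ x, 0 ≤ g x) → ∫⁻ y, ENNReal.ofReal (g y.1.1) ∂N ≤
    C₁ * ∫⁻ x in cube d R, ENNReal.ofReal (g x)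
  energy : ∀ I : Finset ι, ∫⁻ y, ENNReal.ofReal (∑ i ∈ I, (W (l i))⁻¹ * ‖y.2.2 i‖ ^ 2) ∂N ≤ C₂

variable {W : ℕ → ℝ} {l : ι → ℕ} {R T : ℝ} {C₁ C₂ : ℝ≥0∞}

omit [Countable ι] in
theorem IsPacketMeasure.measure_univ_le {N : Measure (State d ι)}
    (hN : IsPacketMeasure W l R T C₁ C₂ N) : N univ ≤ C₁ * volume (cube d R) := by
  simpa using hN.marg (fun _ => 1) continuous_const (fun _ => zero_le_one)

/-- Each defining property is closed under weak limits: the support is one compact set, and both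
bounds concern nonnegative continuous functions, the energy only through finite sums. -/
theorem IsPacketMeasure.exists_subseq (hC₁ : C₁ ≠ ∞) (hW : ∀ n, 0 < W n) {N : ℕ → ℕ → Measure (State d ι)}
    (hN : ∀ n j, IsPacketMeasure W l R T C₁ C₂ (N n j)) :
    ∃ σ : ℕ → ℕ, StrictMono σ ∧ ∃ N' : ℕ → Measure (State d ι),
      (∀ j, IsPacketMeasure W l R T C₁ C₂ (N' j)) ∧
      ∀ (j : ℕ) (g : State d ι → ℂ), Continuous g →
        Tendsto (fun n => ∫ x, g x ∂(N (σ n) j)) atTop (𝓝 (∫ x, g x ∂(N' j))) := by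
  have hv : C₁ * volume (cube d R) ≠ ∞ :=
    ENNReal.mul_ne_top hC₁ (isCompact_cube R).measure_lt_top.ne
  have hfin : ∀ n j, IsFiniteMeasure (N n j) := fun n j =>
    ⟨(hN n j).measure_univ_le.trans_lt hv.lt_top⟩
  obtain ⟨σ, hσ, N', h1, h2, h3⟩ := exists_subseq_tendsto_integral_of_isCompact
    (isCompact_stateSet R T) N (C := (C₁ * volume (cube d R)).toReal)
    (fun n j => ENNReal.toReal_mono hv (hN n j).measure_univ_le) (fun n j => (hN n j).supp)
  refine ⟨σ, hσ, N', fun j => ⟨h2 j, fun g hg hg0 => ?_, fun I => ?_⟩, h3⟩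
  · exact lintegral_le_of_tendsto (isCompact_stateSet R T) (fun n => (hN (σ n) j).supp) (h2 j) (h3 j)
      (f := fun y => g y.1.1) (by fun_prop) (fun y => hg0 _) (fun n => (hN (σ n) j).marg g hg hg0)
  · exact lintegral_le_of_tendsto (isCompact_stateSet R T) (fun n => (hN (σ n) j).supp) (h2 j) (h3 j)
      (f := fun y => ∑ i ∈ I, (W (l i))⁻¹ * ‖y.2.2 i‖ ^ 2) (by fun_prop)
      (fun y => Finset.sum_nonneg fun i _ => mul_nonneg (inv_nonneg.2 (hW _).le) (sq_nonneg _))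
      (fun n => (hN (σ n) j).energy I)

omit [Countable ι] in
theorem IsPacketMeasure.map_fst_le {N : Measure (State d ι)} (hC₁ : C₁ ≠ ∞)
    (hN : IsPacketMeasure W l R T C₁ C₂ N) :
    N.map (fun y => y.1.1) ≤ C₁ • volume.restrict (cube d R) := by
  have hv : C₁ * volume (cube d R) < ∞ :=
    ENNReal.mul_lt_top hC₁.lt_top (isCompact_cube R).measure_lt_top
  have : IsFiniteMeasure N := ⟨hN.measure_univ_le.trans_lt hv⟩
  have : IsFiniteMeasure (C₁ • (volume : Measure (E d)).restrict (cube d R)) := ⟨by simpa using hv⟩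
  refine measure_le_of_forall_continuous fun g hg hg0 => ?_
  rw [lintegral_map (by fun_prop) (by fun_prop), lintegral_smul_measure]
  exact hN.marg g hg hg0

end PacketMeasure

/-! ### Measures generated by wave packets. -/

section PacketMeasure

variable {α : Type*} [MeasurableSpace α] {d m : ℕ} {ι : Type}
  {K : Set (E d)} {C R T : ℝ} {B : Finset (Fin d → ℤ)} {W : ℕ → ℝ} {h : ι → E m → ℂ} {l : ι → ℕ}

theorem measurable_weight (W : ℕ → ℝ) : Measurable fun p : E m => ENNReal.ofReal (W ⌊‖p‖⌋₊) :=
  ((measurable_of_countable W).comp (Nat.measurable_floor.comp measurable_norm)).ennreal_ofReal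

theorem dens_lt_top {v : E d × E m → ℂ} (hv : IsTameFun K C v) (hKm : MeasurableSet K)
    (hK : volume K ≠ ∞) (hWf : ∫⁻ p : E m, ENNReal.ofReal (W ⌊‖p‖⌋₊) < ∞) (z ξ : E d) :
    dens W R B v z ξ < ∞ := by
  obtain ⟨A, hA⟩ := exists_norm_packet_le (R := R) (B := B) hv hKm hK z ξ
  refine lt_of_le_of_lt (b := ∫⁻ p : E m, ENNReal.ofReal (W ⌊‖p‖⌋₊) * ENNReal.ofReal A ^ 2) ?_ ?_
  · rw [dens]
    refine lintegral_mono fun p => ?_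
    dsimp only
    gcongr
    rw [← ofReal_norm]; exact ENNReal.ofReal_le_ofReal (hA p)
  · rw [lintegral_mul_const _ (measurable_weight W)]
    exact ENNReal.mul_lt_top hWf (by simp)

theorem measurable_dens {u : α → E d × E m → ℂ} (hu : Measurable (Function.uncurry u))
    (hv : ∀ s, IsTameFun K C (u s)) (hKm : MeasurableSet K) (hK : volume K ≠ ∞) :
    Measurable fun w : (α × E d) × E d => dens W R B (u w.1.1) w.2 w.1.2 := by
  have h1 : Measurable fun w : ((α × E d) × E d) × E m =>
      packet R B (u w.1.1.1) w.2 w.1.2 w.1.1.2 :=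
    measurable_packet_comp hu hv hKm hK (f := fun w : ((α × E d) × E d) × E m => w.1.1.1)
      measurable_fst.fst.fst measurable_snd measurable_fst.snd measurable_fst.fst.snd
  simp only [dens]
  exact (((measurable_weight W).comp measurable_snd).mul (h1.enorm.pow_const 2)).lintegral_prod_right'

theorem measurable_pcoef {u : α → E d × E m → ℂ} (hu : Measurable (Function.uncurry u))
    (hv : ∀ s, IsTameFun K C (u s)) (hKm : MeasurableSet K) (hK : volume K ≠ ∞) {h : E m → ℂ}
    (hh : Measurable h) :
    Measurable fun w : (α × E d) × E d => pcoef R B h (u w.1.1) w.2 w.1.2 := by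
  have h1 : Measurable fun w : ((α × E d) × E d) × E m =>
      packet R B (u w.1.1.1) w.2 w.1.2 w.1.1.2 :=
    measurable_packet_comp hu hv hKm hK (f := fun w : ((α × E d) × E d) × E m => w.1.1.1)
      measurable_fst.fst.fst measurable_snd measurable_fst.snd measurable_fst.fst.snd
  simp only [pcoef]
  exact ((RCLike.continuous_conj.measurable.comp
    (hh.comp measurable_snd)).mul h1).stronglyMeasurable.integral_prod_right'.measurable

/-- The state of a wave packet at the point `w = ((s, ξ), z)`. -/
noncomputable def packetState (τ : α → ℝ) (W : ℕ → ℝ) (R : ℝ) (B : Finset (Fin d → ℤ))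
    (h : ι → E m → ℂ) (l : ι → ℕ) (u : α → E d × E m → ℂ) (w : (α × E d) × E d) : State d ι :=
  ((w.2, sdir (joinFreq 0 w.1.2)), (τ w.1.1, fun i =>
    ((Real.sqrt (W (l i)) / Real.sqrt (dens W R B (u w.1.1) w.2 w.1.2).toReal : ℝ) : ℂ) *
      pcoef R B (h i) (u w.1.1) w.2 w.1.2))

/-- The measure on phase space which is given by the wave packet transform. -/
noncomputable def packetMeasure (ρ : Measure α) (τ : α → ℝ) (W : ℕ → ℝ) (R : ℝ)
    (B : Finset (Fin d → ℤ)) (h : ι → E m → ℂ) (l : ι → ℕ) (u : α → E d × E m → ℂ) :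
    Measure (State d ι) :=
  (((ρ.prod volume).prod (volume.restrict (cube d R))).withDensity
    fun w => dens W R B (u w.1.1) w.2 w.1.2).map (packetState τ W R B h l u)

theorem measurable_packetState {τ : α → ℝ} (hτ : Measurable τ) {u : α → E d × E m → ℂ}
    (hu : Measurable (Function.uncurry u))
    (hv : ∀ s, IsTameFun K C (u s)) (hKm : MeasurableSet K) (hK : volume K ≠ ∞)
    (hh : ∀ i, Measurable (h i)) : Measurable (packetState τ W R B h l u) := by
  have hd := (measurable_dens (W := W) (R := R) (B := B) hu hv hKm hK).ennreal_toReal.sqrt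
  have h1 : Measurable fun w : (α × E d) × E d => sdir (joinFreq 0 w.1.2) :=
    measurable_sdir.comp (continuous_joinFreq.measurable.comp
      (measurable_const.prodMk measurable_fst.snd))
  refine (measurable_snd.prodMk h1).prodMk ((hτ.comp measurable_fst.fst).prodMk
    (measurable_pi_lambda _ fun i => ?_))
  exact (Complex.measurable_ofReal.comp (hd.const_div _)).mul (measurable_pcoef hu hv hKm hK (hh i))

section

variable {τ : α → ℝ} {u : α → E d × E m → ℂ} (hτ : Measurable τ) (hu : Measurable (Function.uncurry u))
    (hv : ∀ s, IsTameFun K C (u s)) (hKm : MeasurableSet K) (hK : volume K ≠ ∞)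
    (hb : IsAnnularBasis h l) (hW : ∀ n, 0 < W n)
    (hWf : ∫⁻ p : E m, ENNReal.ofReal (W ⌊‖p‖⌋₊) < ∞)

include hv hKm hK hb hW hWf

omit [MeasurableSpace α] in
theorem bessel_dens_real (I : Finset ι) (s : α) (z ξ : E d) :
    ∑ i ∈ I, W (l i) * ‖pcoef R B (h i) (u s) z ξ‖ ^ 2 ≤ (dens W R B (u s) z ξ).toReal := by
  rw [← ENNReal.ofReal_le_iff_le_toReal (dens_lt_top (hv s) hKm hK hWf z ξ).ne,
    ENNReal.ofReal_sum_of_nonneg fun i _ => mul_nonneg (hW _).le (sq_nonneg _)]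
  refine le_trans (le_of_eq (Finset.sum_congr rfl fun i _ => ?_))
    (bessel_dens (hv s) hKm hK hb hW hWf I z ξ)
  rw [ENNReal.ofReal_mul (hW _).le, ENNReal.ofReal_pow (norm_nonneg _), ofReal_norm]

omit [MeasurableSpace α] in
-- Where the density vanishes, the quotient in `packetState` is `0` by the convention for division
-- by zero. Nothing is lost, because Bessel's inequality forces the coefficient to vanish there too.
theorem pcoef_eq_zero_of_dens (i : ι) (s : α) (z ξ : E d)
    (h0 : (dens W R B (u s) z ξ).toReal = 0) : pcoef R B (h i) (u s) z ξ = 0 := by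
  have := bessel_dens_real (R := R) (B := B) hv hKm hK hb hW hWf {i} s z ξ
  rw [h0, Finset.sum_singleton] at this
  have h2 : ‖pcoef R B (h i) (u s) z ξ‖ ^ 2 ≤ 0 := by
    have := hW (l i)
    nlinarith
  simpa using h2

omit [MeasurableSpace α] in
/-- The normalization of the coefficients is compensated by the density. -/
theorem dens_mul_state_mul (i j : ι) (w : (α × E d) × E d) :
    ((dens W R B (u w.1.1) w.2 w.1.2).toReal : ℂ) * ((packetState τ W R B h l u w).2.2 i *
      conj ((packetState τ W R B h l u w).2.2 j)) =
    ((Real.sqrt (W (l i)) * Real.sqrt (W (l j)) : ℝ) : ℂ) * (pcoef R B (h i) (u w.1.1) w.2 w.1.2 *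
      conj (pcoef R B (h j) (u w.1.1) w.2 w.1.2)) := by
  by_cases h0 : (dens W R B (u w.1.1) w.2 w.1.2).toReal = 0
  · simp [h0, pcoef_eq_zero_of_dens hv hKm hK hb hW hWf i _ _ _ h0]
  · set D := (dens W R B (u w.1.1) w.2 w.1.2).toReal with hD
    have hD0 : 0 < D := lt_of_le_of_ne ENNReal.toReal_nonneg (Ne.symm h0)
    have hs : (Real.sqrt D : ℂ) ≠ 0 := by exact_mod_cast (Real.sqrt_pos.2 hD0).ne'
    have hDs : (D : ℂ) = (Real.sqrt D : ℂ) * (Real.sqrt D : ℂ) := by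
      rw [← Complex.ofReal_mul, Real.mul_self_sqrt hD0.le]
    simp only [packetState, map_mul, Complex.conj_ofReal]
    rw [← hD]
    nth_rw 1 [hDs]
    push_cast
    field_simp

omit [MeasurableSpace α] in
theorem dens_mul_norm_sq (i : ι) (w : (α × E d) × E d) :
    (dens W R B (u w.1.1) w.2 w.1.2).toReal * ‖(packetState τ W R B h l u w).2.2 i‖ ^ 2 =
      W (l i) * ‖pcoef R B (h i) (u w.1.1) w.2 w.1.2‖ ^ 2 := by
  have := dens_mul_state_mul (R := R) (B := B) (τ := τ) hv hKm hK hb hW hWf i i w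
  rw [Complex.mul_conj, Complex.mul_conj, Complex.normSq_eq_norm_sq, Complex.normSq_eq_norm_sq,
    ← Real.sqrt_mul_self (hW (l i)).le] at this
  rw [Real.sqrt_mul_self (hW (l i)).le, Real.mul_self_sqrt (hW (l i)).le] at this
  exact_mod_cast this

omit [MeasurableSpace α] in
theorem packetState_mem (hT : ∀ s, τ s ∈ Icc 0 T) {w : (α × E d) × E d} (hw : w.2 ∈ cube d R) :
    packetState τ W R B h l u w ∈ stateSet d ι R T := by
  refine ⟨hw, hT _, fun I => ?_⟩
  set D := (dens W R B (u w.1.1) w.2 w.1.2).toReal with hD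
  by_cases h0 : D = 0
  · refine (Finset.sum_eq_zero fun i _ => ?_).trans_le zero_le_one
    simp [packetState, pcoef_eq_zero_of_dens hv hKm hK hb hW hWf i _ _ _ h0]
  · have hD0 : 0 < D := lt_of_le_of_ne ENNReal.toReal_nonneg (Ne.symm h0)
    refine le_of_mul_le_mul_left ?_ hD0
    rw [Finset.mul_sum, mul_one]
    refine (Finset.sum_congr rfl fun i _ => ?_).trans_le
      (bessel_dens_real hv hKm hK hb hW hWf I w.1.1 w.2 w.1.2)
    exact dens_mul_norm_sq hv hKm hK hb hW hWf i w

include hτ hu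

omit hW hWf in
theorem lintegral_packetMeasure (ρ : Measure α) {g : State d ι → ℝ≥0∞} (hg : Measurable g) :
    ∫⁻ y, g y ∂(packetMeasure ρ τ W R B h l u) =
      ∫⁻ w, dens W R B (u w.1.1) w.2 w.1.2 * g (packetState τ W R B h l u w)
        ∂((ρ.prod volume).prod (volume.restrict (cube d R))) := by
  have hs := measurable_packetState (W := W) (R := R) (B := B) (l := l) hτ hu hv hKm hK hb.meas
  rw [packetMeasure, lintegral_map hg hs]
  exact lintegral_withDensity_eq_lintegral_mul _ (measurable_dens hu hv hKm hK) (hg.comp hs)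

omit hW in
theorem integral_packetMeasure (ρ : Measure α) [SFinite ρ] {g : State d ι → ℂ} (hg : Measurable g) :
    ∫ y, g y ∂(packetMeasure ρ τ W R B h l u) =
      ∫ w, ((dens W R B (u w.1.1) w.2 w.1.2).toReal : ℂ) * g (packetState τ W R B h l u w)
        ∂((ρ.prod volume).prod (volume.restrict (cube d R))) := by
  have hs := measurable_packetState (W := W) (R := R) (B := B) (l := l) hτ hu hv hKm hK hb.meas
  rw [packetMeasure, integral_map hs.aemeasurable hg.aestronglyMeasurable,
    integral_withDensity_eq_integral_toReal_smul (measurable_dens hu hv hKm hK)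
      (Eventually.of_forall fun w => dens_lt_top (hv _) hKm hK hWf _ _)]
  simp_rw [Complex.real_smul]

/-- The marginal bound integrates `lintegral_dens_le` over the parameter. In the energy the density
and the weights cancel, leaving unweighted coefficients, to which Bessel's inequality and the
isometry of the transform apply. Both constants are independent of the box `B`. -/
theorem isPacketMeasure_packetMeasure [Countable ι] (hT : ∀ s, τ s ∈ Icc 0 T) (hR : 0 < R) (hB : B.Nonempty)
    (hKR : K ⊆ cube d R) (ρ : Measure α) [IsFiniteMeasure ρ] {M : ℝ≥0∞}
    (hM : ∫⁻ s, (∫⁻ y, ‖u s y‖ₑ ^ 2) ∂ρ ≤ M) :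
    IsPacketMeasure W l R T (ρ univ * (ENNReal.ofReal C ^ 2 *
      ∫⁻ p : E m, ENNReal.ofReal (W ⌊‖p‖⌋₊))) M (packetMeasure ρ τ W R B h l u) := by
  have hdm := measurable_dens (W := W) (R := R) (B := B) hu hv hKm hK
  have hsm := measurable_packetState (W := W) (R := R) (B := B) (l := l) hτ hu hv hKm hK hb.meas
  refine ⟨?_, fun g hg hg0 => ?_, fun I => ?_⟩
  · have hSm : MeasurableSet (stateSet d ι R T) := (isCompact_stateSet R T).isClosed.measurableSet
    rw [packetMeasure, Measure.map_apply hsm hSm.compl]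
    refine withDensity_absolutelyContinuous _ _ ?_
    have : ∀ᵐ w ∂((ρ.prod (volume : Measure (E d))).prod (volume.restrict (cube d R))), w.2 ∈ cube d R :=
      Measure.quasiMeasurePreserving_snd.ae (ae_restrict_mem (measurableSet_cube R))
    rw [preimage_compl]
    refine mem_ae_iff.1 ?_
    filter_upwards [this] with w hw
    exact packetState_mem hv hKm hK hb hW hWf hT hw
  · rw [lintegral_packetMeasure hτ hu hv hKm hK hb ρ (by fun_prop)]
    have hgm : Measurable fun z : E d => ENNReal.ofReal (g z) := by fun_prop
    have e : ∀ w : (α × E d) × E d, ENNReal.ofReal (g (packetState τ W R B h l u w).1.1) =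
        ENNReal.ofReal (g w.2) := fun w => rfl
    simp_rw [e]
    have hm2 : Measurable fun w : (α × E d) × E d => dens W R B (u w.1.1) w.2 w.1.2 *
        ENNReal.ofReal (g w.2) := hdm.mul (hgm.comp measurable_snd)
    rw [lintegral_prod_symm' _ hm2, ← lintegral_const_mul _ hgm]
    refine lintegral_mono fun z => ?_
    have hdz : Measurable fun w : α × E d => dens W R B (u w.1) z w.2 :=
      hdm.comp (f := fun w : α × E d => (w, z)) (measurable_id.prodMk measurable_const)
    dsimp only
    rw [lintegral_mul_const _ hdz]
    gcongr
    rw [lintegral_prod _ hdz.aemeasurable]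
    refine (lintegral_mono fun s => lintegral_dens_le (hv s) hKm hK hR hB hKR z).trans ?_
    rw [lintegral_const, mul_comm]
  · rw [lintegral_packetMeasure hτ hu hv hKm hK hb ρ (by fun_prop)]
    have e : ∀ w : (α × E d) × E d, dens W R B (u w.1.1) w.2 w.1.2 *
        ENNReal.ofReal (∑ i ∈ I, (W (l i))⁻¹ * ‖(packetState τ W R B h l u w).2.2 i‖ ^ 2) ≤
        ∫⁻ p, ‖packet R B (u w.1.1) p w.2 w.1.2‖ₑ ^ 2 := by
      intro w
      rw [← ENNReal.ofReal_toReal (dens_lt_top (hv w.1.1) hKm hK hWf w.2 w.1.2).ne,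
        ← ENNReal.ofReal_mul ENNReal.toReal_nonneg, Finset.mul_sum]
      refine le_trans (le_of_eq ?_) (bessel_packet (hv w.1.1) hKm hK hb I w.2 w.1.2)
      rw [ENNReal.ofReal_sum_of_nonneg fun i _ => mul_nonneg ENNReal.toReal_nonneg
        (mul_nonneg (inv_nonneg.2 (hW _).le) (sq_nonneg _))]
      refine Finset.sum_congr rfl fun i _ => ?_
      rw [mul_left_comm, dens_mul_norm_sq hv hKm hK hb hW hWf i w, ← mul_assoc,
        inv_mul_cancel₀ (hW _).ne', one_mul, ENNReal.ofReal_pow (norm_nonneg _), ofReal_norm]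
    refine (lintegral_mono e).trans (le_trans (le_of_eq ?_) hM)
    have hpm : Measurable fun w : ((α × E d) × E d) × E m =>
        ‖packet R B (u w.1.1.1) w.2 w.1.2 w.1.1.2‖ₑ ^ 2 :=
      (measurable_packet_comp hu hv hKm hK (f := fun w : ((α × E d) × E d) × E m => w.1.1.1)
        measurable_fst.fst.fst measurable_snd measurable_fst.snd
        measurable_fst.fst.snd).enorm.pow_const 2
    have hpm2 := hpm.lintegral_prod_right' (ν := (volume : Measure (E m)))
    rw [lintegral_prod _ hpm2.aemeasurable,
      lintegral_prod _ hpm2.lintegral_prod_right'.aemeasurable]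
    refine lintegral_congr fun s => ?_
    rw [← lintegral_lintegral_packet_sq (hv s) hKm hK hR hB, lintegral_lintegral_swap]
    exact (hpm2.comp (f := fun w : E d × E d => ((s, w.1), w.2)) (by fun_prop)).aemeasurable

end

end PacketMeasure

/-! ### Correlations of Fourier modes and extraction of the limit measure. -/

section Modes

theorem continuous_fourier {φ : ℝ → ℂ} (hφ : Integrable φ) : Continuous (𝓕 φ) :=
  VectorFourier.fourierIntegral_continuous Real.continuous_fourierChar
    (by simp only [innerₗ_apply_apply]; exact continuous_inner) hφ

theorem norm_fourier_le (φ : ℝ → ℂ) (t : ℝ) : ‖𝓕 φ t‖ ≤ ∫ x, ‖φ x‖ := by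
  rw [Real.fourier_eq]
  refine (norm_integral_le_integral_norm _).trans (le_of_eq ?_)
  simp_rw [Circle.norm_smul]

variable {α : Type*} [MeasurableSpace α] {d m : ℕ} {ι : Type}
  {K : Set (E d)} {C R T : ℝ} {B : Finset (Fin d → ℤ)} {W : ℕ → ℝ} {h : ι → E m → ℂ} {l : ι → ℕ}

/-- The tensor product of a Fourier mode in `x` and a function of `p`. -/
noncomputable def mode (R : ℝ) (k : Fin d → ℤ) (g : E m → ℂ) (y : E d × E m) : ℂ :=
  (𝐞 (inner ℝ (freq R k) y.1) : ℂ) * conj (g y.2)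

theorem measurable_mode (R : ℝ) (k : Fin d → ℤ) {g : E m → ℂ} (hg : Measurable g) :
    Measurable (mode R k g) :=
  (measurable_char.comp (measurable_const.inner measurable_fst)).mul
    (RCLike.continuous_conj.measurable.comp (hg.comp measurable_snd))

theorem norm_mode (R : ℝ) (k : Fin d → ℤ) (g : E m → ℂ) (y : E d × E m) :
    ‖mode R k g y‖ = ‖g y.2‖ := by
  rw [mode, norm_mul, Circle.norm_coe, one_mul, RCLike.norm_conj]

theorem memLp_mode (hK : volume K ≠ ∞) (N : ℕ) (R : ℝ) (k : Fin d → ℤ) {g : E m → ℂ}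
    (hg : Measurable g) (hg2 : MemLp g 2) : MemLp (mode R k g) 2 (lam K m N) := by
  refine (memLp_two_iff (measurable_mode R k hg).aestronglyMeasurable).2 ?_
  have e : ∀ y : E d × E m, ‖mode R k g y‖ₑ ^ 2 = ‖g y.2‖ₑ ^ 2 := fun y => by
    rw [← ofReal_norm, norm_mode, ofReal_norm]
  simp_rw [e]
  have hgm : Measurable fun y : E d × E m => ‖g y.2‖ₑ ^ 2 :=
    (hg.comp measurable_snd).enorm.pow_const 2
  have hfin : IsFiniteMeasure (volume.restrict K) := ⟨by simpa using hK.lt_top⟩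
  rw [lam, lintegral_prod _ hgm.aemeasurable]
  dsimp only
  rw [lintegral_const]
  refine ENNReal.mul_lt_top (lt_of_le_of_lt (setLIntegral_le_lintegral _ _)
    ((memLp_two_iff hg2.1).1 hg2)) (measure_lt_top _ _)

theorem IsAnnularBasis.eq_zero (hb : IsAnnularBasis h l) {i : ι} {N : ℕ} (hi : l i < N) (p : E m)
    (hp : (N : ℝ) ≤ ‖p‖) : h i p = 0 := by
  refine hb.supp i p fun hl => ?_
  have h1 : N ≤ ⌊‖p‖⌋₊ := Nat.le_floor hp
  omega

theorem vhat_mode {v : E d × E m → ℂ} (hv : IsTameFun K C v) (hKm : MeasurableSet K)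
    (hK : volume K ≠ ∞) (hb : IsAnnularBasis h l) {i : ι} {N : ℕ} (hi : l i < N)
    (R : ℝ) (k : Fin d → ℤ) (ξ : E d) :
    vhat K N (mode R k (h i)) v ξ = coef (h i) v (ξ - freq R k) :=
  vhat_exp_mul hv hKm hK (hb.memLp i) (hb.eq_zero hi) (freq R k) ξ

theorem IsAnnularBasis.integrable (hb : IsAnnularBasis h l) (i : ι) : Integrable (h i) := by
  have hL : MeasurableSet {p : E m | ‖p‖ < ((l i + 1 : ℕ) : ℝ)} := measurableSet_normBall m _
  have hfin : IsFiniteMeasure ((volume : Measure (E m)).restrict {p : E m | ‖p‖ < ((l i + 1 : ℕ) : ℝ)}) :=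
    ⟨by simpa using volume_ball_lt_top m (l i + 1)⟩
  have h1 := integrable_of_memLp_two ((hb.memLp i).restrict {p : E m | ‖p‖ < ((l i + 1 : ℕ) : ℝ)})
  have e : {p : E m | ‖p‖ < ((l i + 1 : ℕ) : ℝ)}.indicator (h i) = h i := by
    refine indicator_eq_self.2 fun p hp => ?_
    by_contra hcon
    exact hp (hb.eq_zero (Nat.lt_succ_self _) p (not_lt.1 hcon))
  rw [← e]
  exact (integrable_indicator_iff hL).2 h1

variable {ρ : Measure α} [IsFiniteMeasure ρ] {u : ℕ → α → E d × E m → ℂ} (hu : IsTameSeq ρ K C u)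
  (hKm : MeasurableSet K) (hK : volume K ≠ ∞) (hb : IsAnnularBasis h l)

include hu hKm hK hb

theorem memLp_coef (i : ι) (k : Fin d → ℤ) (n : ℕ) :
    MemLp (fun w : α × E d => coef (h i) (u n w.1) (w.2 - freq R k)) 2 (ρ.prod volume) := by
  refine (hu.memLp_vhat hKm hK (measurable_mode R k (hb.meas i))
    (memLp_mode hK (l i + 1) R k (hb.meas i) (hb.memLp i)) n).ae_eq (Eventually.of_forall fun w => ?_)
  exact vhat_mode (hu.tame n w.1) hKm hK hb (Nat.lt_succ_self _) R k w.2

/-- Expanding both packets gives a double sum over `a, b` in `B` with the character of index `k - a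
+ b` in `z`. Integration over the cube retains only `a = b + k`, and the volume of the cube cancels
against the normalisation of the window. -/
theorem integral_packet_mul_conj (hR : 0 < R) (n : ℕ) {G : α × E d → ℂ} (hG : Measurable G) {A : ℝ}
    (hA : ∀ w, ‖G w‖ ≤ A) (k : Fin d → ℤ) (i j : ι) :
    ∫ w : (α × E d) × E d, (G w.1 * (𝐞 (inner ℝ (freq R k) w.2) : ℂ)) *
      (pcoef R B (h i) (u n w.1.1) w.2 w.1.2 * conj (pcoef R B (h j) (u n w.1.1) w.2 w.1.2))
        ∂((ρ.prod volume).prod (volume.restrict (cube d R))) =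
    (B.card : ℂ)⁻¹ * ∑ b ∈ B.filter (fun b => b + k ∈ B), ∫ w : α × E d, G w *
      (coef (h i) (u n w.1) (w.2 - freq R (b + k)) * conj (coef (h j) (u n w.1) (w.2 - freq R b)))
        ∂(ρ.prod volume) := by
  set c : ℂ := ((B.card * (2 * R) ^ d : ℝ) : ℂ)⁻¹ with hc
  set H : (Fin d → ℤ) → (Fin d → ℤ) → α × E d → ℂ := fun a b w => G w *
    (coef (h i) (u n w.1) (w.2 - freq R a) * conj (coef (h j) (u n w.1) (w.2 - freq R b))) with hH
  have hpt : ∀ w : (α × E d) × E d, (G w.1 * (𝐞 (inner ℝ (freq R k) w.2) : ℂ)) *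
      (pcoef R B (h i) (u n w.1.1) w.2 w.1.2 * conj (pcoef R B (h j) (u n w.1.1) w.2 w.1.2)) =
      c * ∑ b ∈ B, ∑ a ∈ B, H a b w.1 * (𝐞 (inner ℝ (freq R (k - a + b)) w.2) : ℂ) := by
    intro w
    rw [pcoef_eq_sum (hu.tame n _) hKm hK (hb.integrable i),
      pcoef_eq_sum (hu.tame n _) hKm hK (hb.integrable j)]
    have hs : (((Real.sqrt (B.card * (2 * R) ^ d))⁻¹ : ℝ) : ℂ) *
        (((Real.sqrt (B.card * (2 * R) ^ d))⁻¹ : ℝ) : ℂ) = c := by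
      rw [← Complex.ofReal_mul, ← mul_inv, Real.mul_self_sqrt (by positivity), hc, Complex.ofReal_inv]
    have he : ∀ a b : Fin d → ℤ, (𝐞 (inner ℝ (freq R (k - a + b)) w.2) : ℂ) =
        (𝐞 (inner ℝ (freq R k) w.2) : ℂ) * ((𝐞 (-(inner ℝ (freq R a) w.2)) : ℂ) *
          conj (𝐞 (-(inner ℝ (freq R b) w.2)) : ℂ)) := by
      intro a b
      rw [← Circle.coe_inv_eq_conj, ← AddChar.map_neg_eq_inv, neg_neg, ← Circle.coe_mul,
        ← Circle.coe_mul, ← AddChar.map_add_eq_mul, ← AddChar.map_add_eq_mul, freq_add, freq_sub,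
        inner_add_left, inner_sub_left]
      congr 2; ring
    have alg : ∀ g e r s₁ s₂ : ℂ, g * e * (r * s₁ * (r * s₂)) = r * r * (g * e * (s₁ * s₂)) :=
      fun _ _ _ _ _ => by ring
    rw [map_mul, Complex.conj_ofReal, map_sum, alg, hs, Finset.sum_mul_sum, Finset.sum_comm,
      Finset.mul_sum]
    congr 1
    refine Finset.sum_congr rfl fun b _ => ?_
    rw [Finset.mul_sum]
    refine Finset.sum_congr rfl fun a _ => ?_
    rw [he, map_mul]
    ring
  have hHi : ∀ a b, Integrable (H a b) (ρ.prod volume) := fun a b =>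
    integrable_mul_conj hG.aestronglyMeasurable hA (memLp_coef hu hKm hK hb i a n)
      (memLp_coef hu hKm hK hb j b n)
  have hei : ∀ a : Fin d → ℤ, Integrable (fun z : E d => (𝐞 (inner ℝ (freq R a) z) : ℂ))
      (volume.restrict (cube d R)) := fun a => by
    have : IsFiniteMeasure ((volume : Measure (E d)).restrict (cube d R)) :=
      ⟨by simpa using (isCompact_cube R).measure_lt_top⟩
    refine (integrable_const (1 : ℝ)).mono' (by fun_prop) (Eventually.of_forall fun z => ?_)
    rw [Circle.norm_coe]
  simp_rw [hpt]
  rw [integral_const_mul, integral_finsetSum _ fun b _ => integrable_finsetSum _ fun a _ =>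
    (hHi a b).mul_prod (hei _)]
  have hR0 : ((2 * R) ^ d : ℝ) ≠ 0 := by positivity
  have e2 : ∀ b ∈ B, ∫ w : (α × E d) × E d, ∑ a ∈ B, H a b w.1 *
      (𝐞 (inner ℝ (freq R (k - a + b)) w.2) : ℂ) ∂((ρ.prod volume).prod (volume.restrict (cube d R))) =
      if b + k ∈ B then (∫ w, H (b + k) b w ∂(ρ.prod volume)) * ((2 * R) ^ d : ℝ) else 0 := by
    intro b _
    rw [integral_finsetSum _ fun a _ => (hHi a b).mul_prod (hei _)]
    have e3 : ∀ a ∈ B, ∫ w : (α × E d) × E d, H a b w.1 *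
        (𝐞 (inner ℝ (freq R (k - a + b)) w.2) : ℂ) ∂((ρ.prod volume).prod (volume.restrict (cube d R))) =
        if b + k = a then (∫ w, H a b w ∂(ρ.prod volume)) * ((2 * R) ^ d : ℝ) else 0 := by
      intro a _
      rw [integral_prod_mul (H a b) (fun z : E d => (𝐞 (inner ℝ (freq R (k - a + b)) z) : ℂ)),
        integral_cube_exp hR]
      have : k - a + b = 0 ↔ b + k = a := by
        constructor <;> intro hh
        · have : b + k - a = 0 := by rw [← hh]; abel
          exact sub_eq_zero.1 this
        · rw [← hh]; abel
      simp only [this, mul_ite, mul_zero]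
    rw [Finset.sum_congr rfl e3, Finset.sum_ite_eq]
  rw [Finset.sum_congr rfl e2, ← Finset.sum_filter, ← Finset.sum_mul, hc]
  have : ((2 * R) ^ d : ℝ) ≠ 0 := hR0
  have h3 : (((2 * R) ^ d : ℝ) : ℂ) ≠ 0 := by exact_mod_cast hR0
  rw [Complex.ofReal_mul, mul_inv, mul_assoc, mul_comm (∑ b ∈ _, _), ← mul_assoc _ _ (∑ b ∈ _, _),
    inv_mul_cancel₀ h3, one_mul]
  simp [hH]

/-- The correlations of translated coefficients are asymptotically given by amplitudes. -/
theorem tendsto_correlation_sub_amplitude {τ : α → ℝ} (hτ : Measurable τ) {φ : ℝ → ℂ}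
    (hφ : Integrable φ) {ψ : S d → ℂ} (hψ : Continuous ψ) (η ζ b : Fin d → ℤ) {i j : ι} {N : ℕ}
    (hi : l i < N) (hj : l j < N) :
    Tendsto (fun n => (∫ w : α × E d, (𝓕 φ (τ w.1) * ψ (sdir (joinFreq 0 w.2))) *
      (coef (h i) (u n w.1) (w.2 - freq R (b + (η - ζ))) *
        conj (coef (h j) (u n w.1) (w.2 - freq R b))) ∂(ρ.prod volume)) -
      amplitude ρ τ K N φ ψ (u n) (mode R η (h i)) (mode R ζ (h j))) atTop (𝓝 0) := by
  -- Translating `ξ` by `κ` turns the two shifts `b + (η - ζ)` and `b` into `η` and `ζ`, those of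
  -- the modes in the amplitude. The price is the multiplier at `ξ + κ`, whose difference from
  -- `symMul` vanishes at infinity.
  set κ : E d := freq R b - freq R ζ with hκ
  obtain ⟨A, hA0, hA⟩ := exists_bound_sphere hψ
  have hFc : Continuous (𝓕 φ) := continuous_fourier hφ
  have hFb := norm_fourier_le φ
  have hmul : Measurable fun w : α × E d => 𝓕 φ (τ w.1) * ψ (sdir (joinFreq 0 (w.2 + κ))) :=
    (hFc.measurable.comp (hτ.comp measurable_fst)).mul (hψ.measurable.comp (measurable_sdir.comp
      (continuous_joinFreq.measurable.comp (measurable_const.prodMk (measurable_snd.add_const κ)))))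
  have hmulb : ∀ w : α × E d, ‖𝓕 φ (τ w.1) * ψ (sdir (joinFreq 0 (w.2 + κ)))‖ ≤ A * ∫ x, ‖φ x‖ := by
    intro w
    rw [norm_mul, mul_comm]
    exact mul_le_mul (hA _) (hFb _) (norm_nonneg _) hA0
  have hsm : Measurable fun w : α × E d => symMul φ ψ (τ w.1) w.2 :=
    (measurable_symMul hφ.1 hψ).comp (f := fun w : α × E d => (τ w.1, w.2))
      ((hτ.comp measurable_fst).prodMk measurable_snd)
  have hsb : ∀ w : α × E d, ‖symMul φ ψ (τ w.1) w.2‖ ≤ A * ∫ x, ‖φ x‖ := fun w =>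
    norm_symMul_le hφ hA0 hA _ _
  have hLi := memLp_mode hK N R η (hb.meas i) (hb.memLp i)
  have hLj := memLp_mode hK N R ζ (hb.meas j) (hb.memLp j)
  have hmi := measurable_mode R η (hb.meas i)
  have hmj := measurable_mode R ζ (hb.meas j)
  have key := tendsto_integral_vanishing_multiplier (ρ := ρ)
    (f := fun n w => vhat K N (mode R η (h i)) (u n w.1) w.2)
    (g := fun n w => vhat K N (mode R ζ (h j)) (u n w.1) w.2)
    (μ := fun w => 𝓕 φ (τ w.1) * ψ (sdir (joinFreq 0 (w.2 + κ))) - symMul φ ψ (τ w.1) w.2)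
    (fun n => measurable_vhat hK (hu.meas n) hmi) (fun n => measurable_vhat hK (hu.meas n) hmj)
    (fun n => hu.lintegral_vhat_sq_le hKm hK hmi hLi n)
    (ENNReal.mul_ne_top (vhatBound_lt_top ρ C N).ne ((memLp_two_iff hLi.1).1 hLi).ne)
    (fun n => hu.lintegral_vhat_sq_le hKm hK hmj hLj n)
    (ENNReal.mul_ne_top (vhatBound_lt_top ρ C N).ne ((memLp_two_iff hLj.1).1 hLj).ne)
    (C := A * (∫ x, ‖φ x‖) + A * ∫ x, ‖φ x‖)
    (fun w => (norm_sub_le _ _).trans (add_le_add (hmulb w) (hsb w)))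
    (fun ε hε => by
      obtain ⟨R', hR'⟩ := exists_norm_symMul_sub_le hφ hψ κ hε
      exact ⟨R', fun w hw => by rw [norm_sub_rev]; exact hR' _ _ hw⟩)
    (fun R' => hu.tendsto_low hKm hK hmi hLi R')
  refine key.congr fun n => ?_
  have hshift : MeasurePreserving (fun w : α × E d => (w.1, w.2 + κ)) (ρ.prod volume)
      (ρ.prod volume) :=
    (MeasurePreserving.id ρ).prod (measurePreserving_add_right volume κ)
  have hme : MeasurableEmbedding (fun w : α × E d => (w.1, w.2 + κ)) :=
    ((MeasurableEquiv.refl α).prodCongr (MeasurableEquiv.addRight κ)).measurableEmbedding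
  rw [← hshift.integral_comp hme (fun w : α × E d => (𝓕 φ (τ w.1) * ψ (sdir (joinFreq 0 w.2))) *
      (coef (h i) (u n w.1) (w.2 - freq R (b + (η - ζ))) *
        conj (coef (h j) (u n w.1) (w.2 - freq R b)))), amplitude, ← integral_sub]
  · refine integral_congr_ae (Eventually.of_forall fun w => ?_)
    have e1 : w.2 + κ - freq R (b + (η - ζ)) = w.2 - freq R η := by
      rw [hκ, freq_add, freq_sub]; abel
    have e2 : w.2 + κ - freq R b = w.2 - freq R ζ := by rw [hκ]; abel
    dsimp only
    rw [e1, e2, vhat_mode (hu.tame n w.1) hKm hK hb hi, vhat_mode (hu.tame n w.1) hKm hK hb hj]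
    ring
  · have e : ∀ w : α × E d, w.2 + κ - freq R (b + (η - ζ)) = w.2 - freq R η ∧
        w.2 + κ - freq R b = w.2 - freq R ζ := fun w => by
      constructor
      · rw [hκ, freq_add, freq_sub]; abel
      · rw [hκ]; abel
    simp only [fun w => (e w).1, fun w => (e w).2]
    exact integrable_mul_conj hmul.aestronglyMeasurable hmulb (memLp_coef hu hKm hK hb i η n)
      (memLp_coef hu hKm hK hb j ζ n)
  · exact integrable_mul_conj hsm.aestronglyMeasurable hsb (hu.memLp_vhat hKm hK hmi hLi n)
      (hu.memLp_vhat hKm hK hmj hLj n)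

omit hu hKm hK hb in
/-- The functions on the state space whose integrals are compared with amplitudes. -/
noncomputable def observable (φ : ℝ → ℂ) (ψ : S d → ℂ) (R : ℝ) (k : Fin d → ℤ) (i j : ι)
    (y : State d ι) : ℂ :=
  𝓕 φ y.2.1 * ψ y.1.2 * (𝐞 (inner ℝ (freq R k) y.1.1) : ℂ) * (y.2.2 i * conj (y.2.2 j))

omit hu hKm hK hb in
theorem continuous_observable {φ : ℝ → ℂ} (hφ : Integrable φ) {ψ : S d → ℂ} (hψ : Continuous ψ)
    (R : ℝ) (k : Fin d → ℤ) (i j : ι) : Continuous (observable φ ψ R k i j) := by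
  have h1 := continuous_fourier hφ
  have h2 : Continuous fun y : State d ι => (𝐞 (inner ℝ (freq R k) y.1.1) : ℂ) := by fun_prop
  have h3 : Continuous fun y : State d ι => conj (y.2.2 j) :=
    RCLike.continuous_conj.comp (by fun_prop)
  unfold observable
  exact (((h1.comp (by fun_prop)).mul (hψ.comp (by fun_prop))).mul h2).mul (Continuous.mul (by fun_prop) h3)

variable [Countable ι]

/-- Every `b` in the sum of `integral_packet_mul_conj` contributes asymptotically the same
amplitude. Their number over `B.card` is the overlap ratio, and the square roots of the weights stem
from the normalised coefficients. -/
theorem tendsto_integral_packetMeasure_sub (hR : 0 < R) (hW : ∀ n, 0 < W n)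
    (hWf : ∫⁻ p : E m, ENNReal.ofReal (W ⌊‖p‖⌋₊) < ∞)
    {τ : α → ℝ} (hτ : Measurable τ) {φ : ℝ → ℂ}
    (hφ : Integrable φ) {ψ : S d → ℂ} (hψ : Continuous ψ) (η ζ : Fin d → ℤ) {i j : ι} {N : ℕ}
    (hi : l i < N) (hj : l j < N) :
    Tendsto (fun n => (∫ y, observable φ ψ R (η - ζ) i j y ∂(packetMeasure ρ τ W R B h l (u n))) -
      ((((B.filter fun b => b + (η - ζ) ∈ B).card : ℝ) / B.card : ℝ) : ℂ) *
        (((Real.sqrt (W (l i)) * Real.sqrt (W (l j)) : ℝ) : ℂ) *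
          amplitude ρ τ K N φ ψ (u n) (mode R η (h i)) (mode R ζ (h j)))) atTop (𝓝 0) := by
  obtain ⟨A, hA0, hA⟩ := exists_bound_sphere hψ
  set ω : ℂ := ((Real.sqrt (W (l i)) * Real.sqrt (W (l j)) : ℝ) : ℂ)
  have h1 := ((tendsto_finsetSum (B.filter fun b => b + (η - ζ) ∈ B) fun b _ =>
    tendsto_correlation_sub_amplitude hu hKm hK hb (R := R) hτ hφ hψ η ζ b hi hj).const_mul
      (B.card : ℂ)⁻¹).const_mul ω
  simp only [Finset.sum_const_zero, mul_zero] at h1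
  refine h1.congr fun n => ?_
  have hG : Measurable fun w : α × E d => 𝓕 φ (τ w.1) * ψ (sdir (joinFreq 0 w.2)) :=
    ((continuous_fourier hφ).measurable.comp (hτ.comp measurable_fst)).mul
      (hψ.measurable.comp (measurable_sdir.comp
        (continuous_joinFreq.measurable.comp (measurable_const.prodMk measurable_snd))))
  have hGb : ∀ w : α × E d, ‖𝓕 φ (τ w.1) * ψ (sdir (joinFreq 0 w.2))‖ ≤ (∫ x, ‖φ x‖) * A := by
    intro w
    rw [norm_mul]
    exact mul_le_mul (norm_fourier_le _ _) (hA _) (norm_nonneg _)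
      (integral_nonneg fun _ => norm_nonneg _)
  have e := integral_packet_mul_conj (B := B) hu hKm hK hb hR n hG hGb (η - ζ) i j
  rw [integral_packetMeasure hτ (hu.meas n) (hu.tame n) hKm hK hb hWf ρ
    (continuous_observable hφ hψ R (η - ζ) i j).measurable]
  have e2 : ∀ w : (α × E d) × E d, ((dens W R B (u n w.1.1) w.2 w.1.2).toReal : ℂ) *
      observable φ ψ R (η - ζ) i j (packetState τ W R B h l (u n) w) = ω *
      (((𝓕 φ (τ w.1.1) * ψ (sdir (joinFreq 0 w.1.2))) * (𝐞 (inner ℝ (freq R (η - ζ)) w.2) : ℂ)) *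
      (pcoef R B (h i) (u n w.1.1) w.2 w.1.2 * conj (pcoef R B (h j) (u n w.1.1) w.2 w.1.2))) := by
    intro w
    rw [observable, mul_left_comm, dens_mul_state_mul (hu.tame n) hKm hK hb hW hWf i j w]
    simp only [packetState]
    ring
  simp_rw [e2]
  rw [integral_const_mul, e, Finset.sum_sub_distrib, Finset.sum_const, nsmul_eq_mul]
  push_cast
  ring

/-- A subsequence along which all correlations are described by one measure. -/
theorem exists_subseq_amplitude (hR : 0 < R) (hKR : K ⊆ cube d R) (hW : ∀ n, 0 < W n)
    (hWf : ∫⁻ p : E m, ENNReal.ofReal (W ⌊‖p‖⌋₊) < ∞) {τ : α → ℝ} (hτ : Measurable τ)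
    (hT : ∀ s, τ s ∈ Icc 0 T) {M : ℝ≥0∞} (hM : ∀ n, ∫⁻ s, (∫⁻ y, ‖u n s y‖ₑ ^ 2) ∂ρ ≤ M) :
    ∃ σ : ℕ → ℕ, StrictMono σ ∧ ∃ (C₁ : ℝ≥0∞) (N' : Measure (State d ι)), C₁ ≠ ∞ ∧
      IsPacketMeasure W l R T C₁ M N' ∧
      ∀ (φ : ℝ → ℂ) (ψ : S d → ℂ), Integrable φ → Continuous ψ → ∀ (η ζ : Fin d → ℤ) (i j : ι)
        (N : ℕ), l i < N → l j < N →
        Tendsto (fun n => ((Real.sqrt (W (l i)) * Real.sqrt (W (l j)) : ℝ) : ℂ) *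
          amplitude ρ τ K N φ ψ (u (σ n)) (mode R η (h i)) (mode R ζ (h j))) atTop
          (𝓝 (∫ y, observable φ ψ R (η - ζ) i j y ∂N')) := by
  set C₁ : ℝ≥0∞ := ρ univ * (ENNReal.ofReal C ^ 2 * ∫⁻ p : E m, ENNReal.ofReal (W ⌊‖p‖⌋₊))
  have hC₁ : C₁ ≠ ∞ :=
    ENNReal.mul_ne_top (measure_ne_top _ _) (ENNReal.mul_ne_top (by simp) hWf.ne)
  have hbox : ∀ j, (box d (j + 1)).Nonempty := fun j => by
    rw [← Finset.card_pos, card_box]; positivity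
  -- First the limit in `n`, simultaneously for all boxes, then a limit of the resulting measures as
  -- the box grows. Boxes of side `j + 1` are nonempty.
  obtain ⟨σ, hσ, N₁, hN₁, ht₁⟩ := IsPacketMeasure.exists_subseq hC₁ hW
    (N := fun n j => packetMeasure ρ τ W R (box d (j + 1)) h l (u n)) fun n j =>
    isPacketMeasure_packetMeasure hτ (hu.meas n) (hu.tame n) hKm hK hb hW hWf hT hR (hbox j) hKR ρ (hM n)
  obtain ⟨σ', hσ', N₂, hN₂, ht₂⟩ := IsPacketMeasure.exists_subseq hC₁ hW
    (N := fun n _ => N₁ n) fun n _ => hN₁ n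
  refine ⟨σ, hσ, C₁, N₂ 0, hC₁, hN₂ 0, fun φ ψ hφ hψ η ζ i j N hi hj => ?_⟩
  set a : ℕ → ℂ := fun n => ((Real.sqrt (W (l i)) * Real.sqrt (W (l j)) : ℝ) : ℂ) *
    amplitude ρ τ K N φ ψ (u (σ n)) (mode R η (h i)) (mode R ζ (h j)) with ha
  set r : ℕ → ℝ := fun b => ((((box d (b + 1)).filter fun k => k + (η - ζ) ∈ box d (b + 1)).card : ℝ) /
    (box d (b + 1)).card) with hr
  have hr1 : Tendsto r atTop (𝓝 1) := (tendsto_card_box_filter (η - ζ)).comp (tendsto_add_atTop_nat 1)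
  have hobs := continuous_observable hφ hψ R (η - ζ) i j
  have h1 : ∀ b, Tendsto (fun n => (r b : ℂ) * a n) atTop (𝓝 (∫ y, observable φ ψ R (η - ζ) i j y ∂N₁ b)) := by
    intro b
    have h2 := (tendsto_integral_packetMeasure_sub (B := box d (b + 1)) hu hKm hK hb hR hW hWf hτ
      hφ hψ η ζ hi hj).comp hσ.tendsto_atTop
    have h3 := (ht₁ b _ hobs).sub h2
    rw [sub_zero] at h3
    refine h3.congr fun n => ?_
    simp only [Function.comp, hr, ha]
    ring
  have hr0 : ∀ᶠ b in atTop, r b ≠ 0 := hr1.eventually_ne one_ne_zero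
  -- One box with nonzero overlap already gives convergence of the amplitudes; the limit does not
  -- depend on the box, so letting the box grow identifies it with the integral against `N₂ 0`.
  have h2 : ∀ b, r b ≠ 0 → Tendsto a atTop
      (𝓝 ((r b : ℂ)⁻¹ * ∫ y, observable φ ψ R (η - ζ) i j y ∂N₁ b)) := by
    intro b hb0
    have hb0' : (r b : ℂ) ≠ 0 := by exact_mod_cast hb0
    refine ((h1 b).const_mul (r b : ℂ)⁻¹).congr fun n => ?_
    rw [← mul_assoc, inv_mul_cancel₀ hb0', one_mul]
  obtain ⟨b₀, hb₀⟩ := hr0.exists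
  have h3 : Tendsto (fun n => (r (σ' n) : ℂ)⁻¹ * ∫ y, observable φ ψ R (η - ζ) i j y ∂N₁ (σ' n)) atTop
      (𝓝 (∫ y, observable φ ψ R (η - ζ) i j y ∂N₂ 0)) := by
    have h4 : Tendsto (fun n => (r (σ' n) : ℂ)⁻¹) atTop (𝓝 ((1 : ℝ) : ℂ)⁻¹) :=
      ((Complex.continuous_ofReal.tendsto 1).comp (hr1.comp hσ'.tendsto_atTop)).inv₀ (by simp)
    have h5 := h4.mul (ht₂ 0 _ hobs)
    simpa using h5
  have h4 : Tendsto (fun n => (r (σ' n) : ℂ)⁻¹ * ∫ y, observable φ ψ R (η - ζ) i j y ∂N₁ (σ' n)) atTop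
      (𝓝 ((r b₀ : ℂ)⁻¹ * ∫ y, observable φ ψ R (η - ζ) i j y ∂N₁ b₀)) := by
    refine tendsto_const_nhds.congr' ?_
    filter_upwards [hσ'.tendsto_atTop.eventually hr0] with n hn
    exact tendsto_nhds_unique (h2 b₀ hb₀) (h2 _ hn)
  rw [tendsto_nhds_unique h3 h4]
  exact h2 b₀ hb₀

end Modes

/-! ### Stone–Weierstrass for a group of characters. -/

section Characters

variable {X κ : Type*} [TopologicalSpace X] [AddCommGroup κ]

/-- The span of a group of continuous characters, as a star subalgebra. -/
noncomputable def charSubalgebra [CompactSpace X] (e : κ → C(X, ℂ)) (h0 : e 0 = 1)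
    (hm : ∀ k l, e k * e l = e (k + l)) (hs : ∀ k, star (e k) = e (-k)) :
    StarSubalgebra ℂ C(X, ℂ) where
  carrier := Submodule.span ℂ (range e)
  mul_mem' {a b} ha hb := by
    refine Submodule.span_induction₂ (p := fun a b _ _ => a * b ∈ Submodule.span ℂ (range e))
      ?_ ?_ ?_ ?_ ?_ ?_ ?_ ha hb
    · rintro _ _ ⟨k, rfl⟩ ⟨l, rfl⟩
      rw [hm]; exact Submodule.subset_span ⟨_, rfl⟩
    · intro x _; simp
    · intro x _; simp
    · intro x y z _ _ _ h1 h2; rw [add_mul]; exact Submodule.add_mem _ h1 h2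
    · intro x y z _ _ _ h1 h2; rw [mul_add]; exact Submodule.add_mem _ h1 h2
    · intro c x y _ _ h; rw [smul_mul_assoc]; exact Submodule.smul_mem _ c h
    · intro c x y _ _ h; rw [mul_smul_comm]; exact Submodule.smul_mem _ c h
  add_mem' ha hb := Submodule.add_mem _ ha hb
  algebraMap_mem' c := by
    rw [Algebra.algebraMap_eq_smul_one, ← h0]
    exact Submodule.smul_mem _ c (Submodule.subset_span ⟨0, rfl⟩)
  star_mem' {a} ha := by
    refine Submodule.span_induction (p := fun a _ => star a ∈ Submodule.span ℂ (range e))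
      ?_ ?_ ?_ ?_ ha
    · rintro _ ⟨k, rfl⟩
      rw [hs]; exact Submodule.subset_span ⟨_, rfl⟩
    · simp
    · intro x y _ _ h1 h2; rw [star_add]; exact Submodule.add_mem _ h1 h2
    · intro c x _ h; rw [star_smul]; exact Submodule.smul_mem _ _ h

/-- Points which are identified by all characters. -/
def charSetoid (e : κ → C(X, ℂ)) : Setoid X where
  r a b := ∀ k, e k a = e k b
  iseqv := ⟨fun _ _ => rfl, fun h k => (h k).symm, fun h h' k => (h k).trans (h' k)⟩

/-- A function which is orthogonal to a group of characters is orthogonal to all continuous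
functions which do not separate more points than these characters. -/
theorem integral_eq_zero_of_forall_char [CompactSpace X] [MeasurableSpace X] [OpensMeasurableSpace X]
    {μ : Measure X} {e : κ → C(X, ℂ)} (h0 : e 0 = 1)
    (hm : ∀ k l, e k * e l = e (k + l)) (hs : ∀ k, star (e k) = e (-k)) {g : X → ℂ}
    (hg : Integrable g μ) (h : ∀ k, ∫ x, e k x * g x ∂μ = 0) (c : C(X, ℂ))
    (hc : ∀ a b, (∀ k, e k a = e k b) → c a = c b) : ∫ x, c x * g x ∂μ = 0 := by
  let _ : Setoid X := charSetoid e
  let q : C(X, Quotient (charSetoid e)) := ⟨Quotient.mk _, continuous_quotient_mk'⟩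
  let e' : κ → C(Quotient (charSetoid e), ℂ) := fun k =>
    ⟨Quotient.lift (e k) fun a b hab => hab k, (e k).continuous.quotient_lift _⟩
  let c' : C(Quotient (charSetoid e), ℂ) := ⟨Quotient.lift c hc, c.continuous.quotient_lift _⟩
  have hq : Function.Surjective q := Quotient.mk_surjective
  have h0' : e' 0 = 1 := by
    ext y
    obtain ⟨x, rfl⟩ := hq y
    exact DFunLike.congr_fun h0 x
  have hm' : ∀ k l, e' k * e' l = e' (k + l) := fun k l => by
    ext y
    obtain ⟨x, rfl⟩ := hq y
    exact DFunLike.congr_fun (hm k l) x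
  have hs' : ∀ k, star (e' k) = e' (-k) := fun k => by
    ext y
    obtain ⟨x, rfl⟩ := hq y
    exact DFunLike.congr_fun (hs k) x
  -- On the quotient the characters separate points by construction, and `c` descends to it. So `c`
  -- is a uniform limit of trigonometric polynomials even though the characters need not separate
  -- the points of `X`.
  have hsep : (charSubalgebra e' h0' hm' hs').SeparatesPoints := by
    intro x y hxy
    obtain ⟨a, rfl⟩ := hq x
    obtain ⟨b, rfl⟩ := hq y
    have : ∃ k, e k a ≠ e k b := by
      by_contra hcon
      push Not at hcon
      exact hxy (Quotient.sound hcon)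
    obtain ⟨k, hk⟩ := this
    exact ⟨_, ⟨e' k, Submodule.subset_span ⟨k, rfl⟩, rfl⟩, hk⟩
  have hi : ∀ b : C(Quotient (charSetoid e), ℂ), Integrable (fun x => b (q x) * g x) μ := fun b =>
    hg.bdd_mul (b.continuous.comp q.continuous).aestronglyMeasurable
      (Eventually.of_forall fun x => b.norm_coe_le_norm (q x))
  have hspan : ∀ b ∈ Submodule.span ℂ (range e'), ∫ x, b (q x) * g x ∂μ = 0 := by
    intro b hb
    induction hb using Submodule.span_induction with
    | mem b hb =>
      obtain ⟨k, rfl⟩ := hb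
      exact h k
    | zero => simp
    | add a b _ _ ha hb =>
      simp only [ContinuousMap.add_apply, add_mul]
      rw [integral_add (hi a) (hi b), ha, hb, add_zero]
    | smul t a _ ha =>
      simp only [ContinuousMap.smul_apply, smul_eq_mul, mul_assoc]
      rw [integral_const_mul, ha, mul_zero]
  have hcl : c' ∈ (charSubalgebra e' h0' hm' hs').topologicalClosure := by
    rw [ContinuousMap.starSubalgebra_topologicalClosure_eq_top_of_separatesPoints _ hsep]
    trivial
  have hcl' : c' ∈ closure (Submodule.span ℂ (range e') : Set C(Quotient (charSetoid e), ℂ)) := hcl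
  obtain ⟨s, hs, hlim⟩ := mem_closure_iff_seq_limit.1 hcl'
  have hz : Tendsto (fun n => ∫ x, s n (q x) * g x ∂μ) atTop (𝓝 (∫ x, c' (q x) * g x ∂μ)) := by
    refine tendsto_iff_norm_sub_tendsto_zero.2 ?_
    have hb : Tendsto (fun n => ‖s n - c'‖ * ∫ x, ‖g x‖ ∂μ) atTop (𝓝 0) := by
      simpa using (tendsto_iff_norm_sub_tendsto_zero.1 hlim).mul_const (∫ x, ‖g x‖ ∂μ)
    refine squeeze_zero (fun _ => norm_nonneg _) (fun n => ?_) hb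
    rw [← integral_sub (hi _) (hi _), ← integral_const_mul]
    refine norm_integral_le_of_norm_le (hg.norm.const_mul _) (Eventually.of_forall fun x => ?_)
    rw [← sub_mul, norm_mul]
    gcongr
    exact (s n - c').norm_coe_le_norm (q x)
  refine tendsto_nhds_unique hz ?_
  simp only [fun n => hspan (s n) (hs n)]
  exact tendsto_const_nhds

end Characters

/-! ### Totality of Fourier modes times basis functions. -/

section Density

variable {d m : ℕ} {R : ℝ}

/-- The Fourier mode of index `k` as a continuous function on the cube. -/
noncomputable def expMap (R : ℝ) (k : Fin d → ℤ) : C(cube d R, ℂ) :=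
  ⟨fun x => (𝐞 (inner ℝ (freq R k) (x : E d)) : ℂ), by fun_prop⟩

theorem expMap_apply (k : Fin d → ℤ) (x : cube d R) :
    expMap R k x = (𝐞 (inner ℝ (freq R k) (x : E d)) : ℂ) := rfl

theorem expMap_mul (k l : Fin d → ℤ) : expMap R k * expMap R l = expMap R (k + l) := by
  ext x
  simp only [ContinuousMap.mul_apply, expMap_apply]
  rw [freq_add, inner_add_left, AddChar.map_add_eq_mul, Circle.coe_mul]

theorem star_expMap (k : Fin d → ℤ) : star (expMap R k) = expMap R (-k) := by
  ext x
  simp only [ContinuousMap.star_apply, expMap_apply]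
  rw [← zero_sub k, freq_sub, freq_zero, zero_sub, inner_neg_left, AddChar.map_neg_eq_inv,
    Circle.coe_inv_eq_conj]
  rfl

theorem expMap_zero : expMap (d := d) R 0 = 1 := by
  ext x
  simp [expMap, freq_zero]

/-- The characters identify opposite faces of the cube and nothing else: coordinates differ by a
multiple of `2R`, which is zero as soon as one of the points is interior. -/
theorem eq_of_forall_expMap_eq (hR : 0 < R) {x y : cube d R}
    (hx : ∀ i, |(x : E d) i| < R) (h : ∀ k, expMap R k x = expMap R k y) : x = y := by
  refine Subtype.ext ?_
  ext i
  have he := h (Pi.single i 1)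
  have hinner : ∀ z : E d, inner ℝ (freq R (Pi.single i 1)) z = z i / (2 * R) := by
    intro z
    rw [inner_freq, Finset.sum_eq_single i]
    · simp; ring
    · intro j _ hj; simp [Pi.single_eq_of_ne hj]
    · simp
  simp only [expMap_apply, hinner, Real.fourierChar_apply] at he
  obtain ⟨n, hn⟩ := Complex.exp_eq_exp_iff_exists_int.1 he
  have hpi : (2 * Real.pi * Complex.I : ℂ) ≠ 0 := Complex.two_pi_I_ne_zero
  have h1 : (((x : E d) i / (2 * R) : ℝ) : ℂ) = ((y : E d) i / (2 * R) : ℝ) + n := by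
    apply mul_left_cancel₀ hpi
    push_cast at hn ⊢
    linear_combination hn
  have h2 : (x : E d) i / (2 * R) = (y : E d) i / (2 * R) + n := by exact_mod_cast h1
  have h3 : (x : E d) i - (y : E d) i = n * (2 * R) := by field_simp at h2; linarith
  have hx := abs_lt.1 (hx i)
  have hy := y.2 i
  have hn0 : n = 0 := by
    have h4 : (n : ℝ) < 1 := by by_contra hc; push Not at hc; nlinarith [hy.1, hy.2]
    have h5 : (-1 : ℝ) < n := by by_contra hc; push Not at hc; nlinarith [hy.1, hy.2]
    have h4' : n < 1 := by exact_mod_cast h4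
    have h5' : -1 < n := by exact_mod_cast h5
    omega
  rw [hn0] at h3
  simp at h3
  linarith

theorem isOpen_openCube (R : ℝ) : IsOpen {x : E d | ∀ i, |x i| < R} := by
  simp only [ofPred_forall]
  exact isOpen_iInter_of_finite fun i => isOpen_lt (by fun_prop) continuous_const

theorem ae_mem_openCube (R : ℝ) : ∀ᵐ x : E d ∂(volume.restrict (cube d R)), ∀ i, |x i| < R := by
  rw [ae_restrict_iff' (measurableSet_cube R)]
  have h1 : ∀ᵐ y : Fin d → ℝ, ∀ i, y i ≠ R ∧ y i ≠ -R := by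
    rw [ae_all_iff]
    intro i
    have hne : ∀ c : ℝ, ∀ᵐ y : Fin d → ℝ, y i ≠ c := fun c =>
      (Measure.quasiMeasurePreserving_eval (fun _ : Fin d => (volume : Measure ℝ)) i).ae
        (p := fun t => t ≠ c) (by simp [ae_iff])
    filter_upwards [hne R, hne (-R)] with y h1 h2 using ⟨h1, h2⟩
  have h2 := (PiLp.volume_preserving_ofLp (Fin d)).quasiMeasurePreserving.ae h1
  filter_upwards [h2] with x hx hxc i
  have h3 := hxc i
  exact abs_lt.2 ⟨lt_of_le_of_ne h3.1 (hx i).2.symm, lt_of_le_of_ne h3.2 (hx i).1⟩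

/-- An integrable function on a cube is determined by its Fourier coefficients. -/
theorem ae_eq_zero_of_forall_exp (hR : 0 < R)
    {g : E d → ℂ} (hg : IntegrableOn g (cube d R))
    (h : ∀ k, ∫ x in cube d R, (𝐞 (inner ℝ (freq R k) x) : ℂ) * g x = 0) :
    g =ᵐ[volume.restrict (cube d R)] 0 := by
  have hKm : MeasurableSet (cube d R) := measurableSet_cube R
  have : CompactSpace (cube d R) := isCompact_iff_compactSpace.1 (isCompact_cube R)
  have hgK : Integrable (fun x : cube d R => g x) (Measure.comap Subtype.val volume) := by
    have e := MeasurableEmbedding.integrableOn_range_iff_comap (f := g) (μ := volume)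
      (MeasurableEmbedding.subtype_coe hKm)
    rw [Subtype.range_coe] at e
    exact e.1 hg
  have hloc : LocallyIntegrable ((cube d R).indicator g) volume :=
    ((integrable_indicator_iff hKm).2 hg).locallyIntegrable
  have := (isOpen_openCube (d := d) R).ae_eq_zero_of_integral_contDiff_smul_eq_zero
    (hloc.locallyIntegrableOn _) fun c hc _ hcs => by
    have hz : ∀ x : cube d R, ¬ (∀ i, |(x : E d) i| < R) → c x = 0 := fun x hx =>
      image_eq_zero_of_notMem_tsupport fun hcon => hx (hcs hcon)
    -- A test function supported in the open cube vanishes on the faces, so it respects the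
    -- identifications made by the characters; the faces themselves are null.
    have e := integral_eq_zero_of_forall_char expMap_zero expMap_mul star_expMap hgK
      (fun k => by
        rw [← h k, ← integral_subtype_comap hKm]
        rfl) ⟨fun x => (c x : ℂ), by have := hc.continuous; fun_prop⟩ (fun a b hab => by
        by_cases ha : ∀ i, |(a : E d) i| < R
        · rw [eq_of_forall_expMap_eq hR ha hab]
        · by_cases hb : ∀ i, |(b : E d) i| < R
          · rw [eq_of_forall_expMap_eq hR hb fun k => (hab k).symm]
          · simp only [ContinuousMap.coe_mk, hz a ha, hz b hb])
    simp only [ContinuousMap.coe_mk] at e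
    rw [integral_subtype_comap hKm (fun x => (c x : ℂ) * g x), ← integral_indicator hKm] at e
    rw [← e]
    refine integral_congr_ae (Eventually.of_forall fun x => ?_)
    by_cases hx : x ∈ cube d R <;> simp [hx]
  filter_upwards [ae_restrict_of_ae this, ae_mem_openCube R, ae_restrict_mem hKm] with x h1 h2 h3
  simpa [h3] using h1 h2

variable {ι : Type} [Countable ι] {h : ι → E m → ℂ} {l : ι → ℕ}

/-- The Fourier modes tensorized with the basis functions of the annuli of a ball are total in
`L²`. -/
theorem dense_span_mode (hR : 0 < R)
    (hb : IsAnnularBasis h l) (N : ℕ) :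
    Dense (Submodule.span ℂ {f : Lp ℂ 2 (lam (cube d R) m N) | ∃ k i, l i < N ∧
      f = (memLp_mode (isCompact_cube R).measure_lt_top.ne N R k (hb.meas i) (hb.memLp i)).toLp _} :
      Set (Lp ℂ 2 (lam (cube d R) m N))) := by
  set V := Submodule.span ℂ {f : Lp ℂ 2 (lam (cube d R) m N) | ∃ k i, l i < N ∧
      f = (memLp_mode (isCompact_cube R).measure_lt_top.ne N R k (hb.meas i) (hb.memLp i)).toLp _} with hV
  rw [Submodule.dense_iff_topologicalClosure_eq_top, Submodule.topologicalClosure_eq_top_iff]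
  refine (Submodule.eq_bot_iff _).2 fun f hf => ?_
  have hfin := isFiniteMeasure_lam (isCompact_cube (d := d) R).measure_lt_top.ne m N
  set L : Set (E m) := {p | ‖p‖ < N} with hL
  have hLm : MeasurableSet L := measurableSet_normBall m N
  have hKm : MeasurableSet (cube d R) := measurableSet_cube R
  have hK1 : IsFiniteMeasure ((volume : Measure (E d)).restrict (cube d R)) := ⟨by simpa using (isCompact_cube R).measure_lt_top⟩
  have hL1 : IsFiniteMeasure ((volume : Measure (E m)).restrict L) :=
    ⟨by simpa using volume_ball_lt_top m N⟩
  have hfm : Measurable (f : E d × E m → ℂ) := (Lp.stronglyMeasurable f).measurable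
  have horth : ∀ k i, l i < N → ∫ y, conj (mode R k (h i) y) * f y ∂(lam (cube d R) m N) = 0 := by
    intro k i hi
    have h1 : (memLp_mode (isCompact_cube R).measure_lt_top.ne N R k (hb.meas i) (hb.memLp i)).toLp _ ∈ V :=
      Submodule.subset_span ⟨k, i, hi, rfl⟩
    have h2 := (Submodule.mem_orthogonal V f).1 hf _ h1
    have h3 := inner_toLp_toLp (memLp_mode (isCompact_cube R).measure_lt_top.ne N R k (hb.meas i) (hb.memLp i)) (Lp.memLp f)
    rw [Lp.toLp_coeFn] at h3
    rw [← h3, h2]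
  have hint : ∀ i, Integrable (fun y : E d × E m => h i y.2 * f y) (lam (cube d R) m N) := by
    intro i
    have := integrable_mul_conj (μ := lam (cube d R) m N) (k := fun _ => 1) (A := 1) (by fun_prop) (by simp)
      (Lp.memLp f) (memLp_mode (isCompact_cube R).measure_lt_top.ne N R 0 (hb.meas i) (hb.memLp i))
    refine this.congr (Eventually.of_forall fun y => ?_)
    simp [mode, freq_zero, mul_comm]
  -- For `f` orthogonal to all modes, uniqueness of Fourier coefficients in `x` is applied for each
  -- basis function separately; Parseval in `p` at almost every `x` follows.
  have hz : ∀ i, l i < N → (fun x => ∫ p in L, h i p * f (x, p)) =ᵐ[volume.restrict (cube d R)] 0 := by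
    intro i hi
    refine ae_eq_zero_of_forall_exp hR ?_ fun k => ?_
    · exact (hint i : Integrable _ ((volume.restrict (cube d R)).prod (volume.restrict L))).integral_prod_left
    · have e := horth (-k) i hi
      have e1 : ∀ y : E d × E m, conj (mode R (-k) (h i) y) * f y =
          (𝐞 (inner ℝ (freq R k) y.1) : ℂ) * (h i y.2 * f y) := by
        intro y
        rw [mode, map_mul, Complex.conj_conj, ← Circle.coe_inv_eq_conj, ← AddChar.map_neg_eq_inv,
          ← zero_sub k, freq_sub, freq_zero, zero_sub, inner_neg_left, neg_neg, mul_assoc]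
      simp_rw [e1] at e
      have hi2 : Integrable (fun y : E d × E m => (𝐞 (inner ℝ (freq R k) y.1) : ℂ) * (h i y.2 * f y))
          (lam (cube d R) m N) := (hint i).bdd_mul (c := 1) (by fun_prop)
            (Eventually.of_forall fun y => (Circle.norm_coe _).le)
      rw [← e]
      refine Eq.trans ?_ (integral_prod (μ := volume.restrict (cube d R)) (ν := volume.restrict L) _ hi2).symm
      exact integral_congr_ae (Eventually.of_forall fun x => (integral_const_mul _ _).symm)
  have hz' : ∀ᵐ x ∂(volume.restrict (cube d R)), ∀ i, l i < N → ∫ p in L, h i p * f (x, p) = 0 := by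
    rw [ae_all_iff]
    intro i
    by_cases hi : l i < N
    · filter_upwards [hz i hi] with x hx _ using hx
    · exact Eventually.of_forall fun x hx => absurd hx hi
  have hm2 : Measurable fun y : E d × E m => ‖f y‖ₑ ^ 2 := hfm.enorm.pow_const 2
  have hiter : ∫⁻ y, ‖f y‖ₑ ^ 2 ∂(lam (cube d R) m N) = ∫⁻ x in cube d R, ∫⁻ p in L, ‖f (x, p)‖ₑ ^ 2 :=
    lintegral_prod (μ := volume.restrict (cube d R)) (ν := volume.restrict L) _ hm2.aemeasurable
  have hsq : ∀ᵐ x ∂(volume.restrict (cube d R)), ∫⁻ p in L, ‖f (x, p)‖ₑ ^ 2 < ∞ := by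
    have h1 := (memLp_two_iff (Lp.memLp f).1).1 (Lp.memLp f)
    rw [hiter] at h1
    exact ae_lt_top hm2.lintegral_prod_right' h1.ne
  have hzero : ∀ᵐ x ∂(volume.restrict (cube d R)), ∫⁻ p in L, ‖f (x, p)‖ₑ ^ 2 = 0 := by
    filter_upwards [hz', hsq] with x hx hx2
    have hfx : Measurable fun p => f (x, p) := hfm.comp measurable_prodMk_left
    -- The conjugate appears because `mode` carries the conjugate of the basis function.
    set g : E m → ℂ := L.indicator fun p => conj (f (x, p)) with hg
    have hgm : Measurable g := (RCLike.continuous_conj.measurable.comp hfx).indicator hLm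
    have hge : ∀ p, ‖g p‖ₑ ^ 2 = L.indicator (fun p => ‖f (x, p)‖ₑ ^ 2) p := by
      intro p
      by_cases hp : p ∈ L <;> simp [hg, hp]
    have hg2 : MemLp g 2 := by
      refine (memLp_two_iff hgm.aestronglyMeasurable).2 ?_
      simp_rw [hge]
      rwa [lintegral_indicator hLm]
    have := hb.parseval g hg2 N 0 fun I hI => by
      refine (Finset.sum_eq_zero fun i hi => ?_).le
      have e : ∫ p, conj (h i p) * g p = conj (∫ p in L, h i p * f (x, p)) := by
        rw [← integral_conj, ← integral_indicator hLm]
        refine integral_congr_ae (Eventually.of_forall fun p => ?_)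
        by_cases hp : p ∈ L <;> simp [hg, hp]
      rw [e, hx i (hI i hi)]; simp
    refine le_antisymm (le_trans (le_of_eq ?_) this) bot_le
    refine setLIntegral_congr_fun hLm fun p hp => ?_
    simp only [hge]
    rw [indicator_of_mem hp]
  have hfz : ∫⁻ y, ‖f y‖ₑ ^ 2 ∂(lam (cube d R) m N) = 0 := by
    rw [hiter, lintegral_congr_ae hzero, lintegral_zero]
  rw [← enorm_toLp_sq (Lp.memLp f), Lp.toLp_coeFn, ENNReal.ofReal_eq_zero] at hfz
  have : ‖f‖ = 0 := by nlinarith [norm_nonneg f]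
  exact norm_eq_zero.1 this

end Density

/-! ### Functions with prescribed coefficients. -/

section Superposition

theorem summable_of_orthogonal {H ι : Type*} [NormedAddCommGroup H] [InnerProductSpace ℂ H]
    [CompleteSpace H] {e : ι → H} (ho : ∀ i j, i ≠ j → inner ℂ (e i) (e j) = 0)
    (hs : Summable fun i => ‖e i‖ ^ 2) : Summable e := by
  -- The lines spanned by the vectors are used in place of the vectors, so that zero vectors are
  -- allowed.
  have hV : OrthogonalFamily ℂ (fun i => Submodule.span ℂ {e i})
      (fun i => (Submodule.span ℂ {e i}).subtypeₗᵢ) := by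
    intro i j hij v w
    obtain ⟨c, hc⟩ := Submodule.mem_span_singleton.1 v.2
    obtain ⟨c', hc'⟩ := Submodule.mem_span_singleton.1 w.2
    change inner ℂ (v : H) (w : H) = 0
    rw [← hc, ← hc', inner_smul_left, inner_smul_right, ho i j hij]
    simp
  exact (hV.summable_iff_norm_sq_summable
    (fun i => ⟨e i, Submodule.mem_span_singleton_self (e i)⟩)).2 hs

variable {X : Type*} [MeasurableSpace X] {μ : Measure X} {m : ℕ} {ι : Type*}
  {h : ι → E m → ℂ} {l : ι → ℕ}

theorem memLp_tensor [SFinite μ] {a : X → ℂ} {g : E m → ℂ} (ha : Measurable a) (hg : Measurable g)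
    (ha2 : MemLp a 2 μ) (hg2 : MemLp g 2) :
    MemLp (fun y : X × E m => a y.1 * g y.2) 2 (μ.prod volume) := by
  refine (memLp_two_iff ((ha.comp measurable_fst).mul
    (hg.comp measurable_snd)).aestronglyMeasurable).2 ?_
  change ∫⁻ y : X × E m, ‖a y.1 * g y.2‖ₑ ^ 2 ∂(μ.prod volume) < ∞
  simp_rw [enorm_mul, mul_pow]
  rw [lintegral_prod_mul (ha.enorm.pow_const 2).aemeasurable (hg.enorm.pow_const 2).aemeasurable]
  exact ENNReal.mul_lt_top ((memLp_two_iff ha2.1).1 ha2) ((memLp_two_iff hg2.1).1 hg2)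

theorem IsAnnularBasis.lintegral_sq (hb : IsAnnularBasis h l) (i : ι) : ∫⁻ p, ‖h i p‖ₑ ^ 2 = 1 := by
  have h1 := inner_toLp_toLp (hb.memLp i) (hb.memLp i)
  rw [hb.norm_one] at h1
  rw [← enorm_toLp_sq (hb.memLp i)]
  have h2 : ‖(hb.memLp i).toLp (h i)‖ ^ 2 = 1 := by
    rw [← inner_self_eq_norm_sq (𝕜 := ℂ), h1, RCLike.one_re]
  rw [h2, ENNReal.ofReal_one]

/-- A function with prescribed coefficients with respect to an orthonormal basis. -/
theorem exists_superposition [IsFiniteMeasure μ] (hb : IsAnnularBasis h l) {a : ι → X → ℂ}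
    (ha : ∀ i, Measurable (a i)) {M : ℝ≥0∞} (hM' : M ≠ ∞)
    (hM : ∀ I : Finset ι, ∑ i ∈ I, ∫⁻ x, ‖a i x‖ₑ ^ 2 ∂μ ≤ M) :
    ∃ F : X × E m → ℂ, Measurable F ∧ MemLp F 2 (μ.prod volume) ∧
      ∀ i, ∀ᵐ x ∂μ, ∫ p, conj (h i p) * F (x, p) = a i x := by
  have ha2 : ∀ i, MemLp (a i) 2 μ := fun i => by
    refine (memLp_two_iff (ha i).aestronglyMeasurable).2 (lt_of_le_of_lt ?_ hM'.lt_top)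
    simpa using hM {i}
  have hm : ∀ i, MemLp (fun y : X × E m => a i y.1 * h i y.2) 2 (μ.prod volume) := fun i =>
    memLp_tensor (ha i) (hb.meas i) (ha2 i) (hb.memLp i)
  set e : ι → Lp ℂ 2 (μ.prod (volume : Measure (E m))) := fun i => (hm i).toLp _ with he
  have hinner : ∀ (b : X → ℂ) (j i : ι) (hbm : MemLp (fun y : X × E m => b y.1 * h j y.2) 2 (μ.prod volume)),
      inner ℂ (hbm.toLp _) (e i) = (∫ x, conj (b x) * a i x ∂μ) * ∫ p, conj (h j p) * h i p := by
    intro b j i hbm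
    rw [he, inner_toLp_toLp, ← integral_prod_mul (fun x => conj (b x) * a i x)
      (fun p => conj (h j p) * h i p)]
    refine integral_congr_ae (Eventually.of_forall fun y => ?_)
    simp only [map_mul]; ring
  have ho : ∀ i j, i ≠ j → inner ℂ (e i) (e j) = 0 := fun i j hij => by
    rw [hinner (a i) i j (hm i), hb.orth i j hij, mul_zero]
  have hnorm : ∀ i, ENNReal.ofReal (‖e i‖ ^ 2) = ∫⁻ x, ‖a i x‖ₑ ^ 2 ∂μ := fun i => by
    rw [he, enorm_toLp_sq]
    simp_rw [enorm_mul, mul_pow]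
    rw [lintegral_prod_mul ((ha i).enorm.pow_const 2).aemeasurable
      ((hb.meas i).enorm.pow_const 2).aemeasurable, hb.lintegral_sq, mul_one]
  have hs : Summable fun i => ‖e i‖ ^ 2 := by
    refine summable_of_sum_le (c := M.toReal) (fun i => sq_nonneg _) fun I => ?_
    rw [← ENNReal.ofReal_le_iff_le_toReal hM', ENNReal.ofReal_sum_of_nonneg fun i _ => sq_nonneg _]
    simp_rw [hnorm]
    exact hM I
  -- The functions `a i ⊗ h i` are orthogonal in `L²` of the product, and the bound `M` makes their
  -- squared norms summable, so the series converges to `F`.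
  have hsum := (summable_of_orthogonal ho hs).hasSum
  set F := ∑' i, e i
  have hFm : Measurable (F : X × E m → ℂ) := (Lp.stronglyMeasurable F).measurable
  refine ⟨F, hFm, Lp.memLp F, fun i => ?_⟩
  have hcF : ∀ b : X → ℂ, MemLp (fun y : X × E m => b y.1 * h i y.2) 2 (μ.prod volume) →
      Integrable (fun y : X × E m => conj (b y.1 * h i y.2) * F y) (μ.prod volume) := by
    intro b hbm
    refine (integrable_mul_conj (k := fun _ => 1) (A := 1) (by fun_prop) (by simp)
      (Lp.memLp F) hbm).congr (Eventually.of_forall fun y => ?_)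
    simp [mul_comm]
  have h1m : MemLp (fun y : X × E m => (1 : ℂ) * h i y.2) 2 (μ.prod volume) :=
    memLp_tensor measurable_const (hb.meas i) (memLp_const 1) (hb.memLp i)
  have hint : Integrable (fun x => ∫ p, conj (h i p) * F (x, p)) μ := by
    have := (hcF (fun _ => 1) h1m).integral_prod_left
    simpa using this
  refine Integrable.ae_eq_of_forall_setIntegral_eq _ _ hint (integrable_of_memLp_two (ha2 i))
    fun s hs _ => ?_
  -- Testing the series against the indicator of `s` times `h i` leaves only its `i`-th term; this
  -- identifies the coefficient almost everywhere.
  have hbm : MemLp (fun y : X × E m => s.indicator (fun _ => (1 : ℂ)) y.1 * h i y.2) 2 (μ.prod volume) :=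
    memLp_tensor (measurable_const.indicator hs) (hb.meas i) ((memLp_const 1).indicator hs) (hb.memLp i)
  have h1 : HasSum (fun j => inner ℂ (hbm.toLp _) (e j)) (inner ℂ (hbm.toLp _) F) :=
    (innerSL ℂ (hbm.toLp _)).hasSum hsum
  have h2 : inner ℂ (hbm.toLp _) F = inner ℂ (hbm.toLp _) (e i) := by
    refine h1.unique (hasSum_single i fun j hj => ?_)
    rw [hinner _ i j hbm, hb.orth i j hj.symm, mul_zero]
  rw [hinner _ i i hbm, hb.norm_one, mul_one] at h2
  have h3 := inner_toLp_toLp hbm (Lp.memLp F)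
  rw [Lp.toLp_coeFn, h2, integral_prod _ (hcF _ hbm)] at h3
  rw [← integral_indicator hs, ← integral_indicator hs]
  refine Eq.trans ?_ (h3.symm.trans ?_)
  · refine integral_congr_ae (Eventually.of_forall fun x => ?_)
    by_cases hx : x ∈ s <;> simp [hx]
  · refine integral_congr_ae (Eventually.of_forall fun x => ?_)
    by_cases hx : x ∈ s <;> simp [hx]

end Superposition

/-! ### Profiles and the limiting sesquilinear form. -/

section LimitForm

variable {d m : ℕ} {ι : Type} {R : ℝ}

/-- A finite measure on the state space and a function `F` on it with values in `L²(ℝᵐ)`, which is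
bounded on each ball. -/
structure IsProfile (R : ℝ) (C₁ : ℝ≥0∞) (A : ℕ → ℝ≥0∞) (N : Measure (State d ι))
    (F : State d ι × E m → ℂ) : Prop where
  finite : IsFiniteMeasure N
  const_ne_top : C₁ ≠ ∞
  marg : N.map (fun y => y.1.1) ≤ C₁ • volume.restrict (cube d R)
  meas : Measurable F
  memLp : MemLp F 2 (N.prod volume)
  bound_ne_top : ∀ n, A n ≠ ∞
  bound : ∀ n : ℕ, ∀ᵐ X ∂N, ∫⁻ p in {p : E m | ‖p‖ < n}, ‖F (X, p)‖ₑ ^ 2 ≤ A n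

/-- The pairing of `φ` and `F` over a ball. -/
noncomputable def pair (n : ℕ) (F : State d ι × E m → ℂ) (φ : E d × E m → ℂ) (X : State d ι) : ℂ :=
  ∫ p in {p : E m | ‖p‖ < n}, φ (X.1.1, p) * F (X, p)

/-- The limit of the amplitudes. -/
noncomputable def limitForm (N : Measure (State d ι)) (n : ℕ) (F : State d ι × E m → ℂ)
    (φ : ℝ → ℂ) (ψ : S d → ℂ) (φ₁ φ₂ : E d × E m → ℂ) : ℂ :=
  ∫ X, (𝓕 φ X.2.1 * ψ X.1.2) * (pair n F φ₁ X * conj (pair n F φ₂ X)) ∂N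

variable {C₁ : ℝ≥0∞} {A : ℕ → ℝ≥0∞} {N : Measure (State d ι)} {F : State d ι × E m → ℂ}

theorem measurable_pair (hF : Measurable F) (n : ℕ) {φ : E d × E m → ℂ} (hφ : Measurable φ) :
    Measurable (pair n F φ) := by
  have h1 : Measurable fun w : State d ι × E m => φ (w.1.1.1, w.2) * F w :=
    (hφ.comp (measurable_fst.fst.fst.prodMk measurable_snd)).mul hF
  have h2 : StronglyMeasurable fun X : State d ι => ∫ p in {p : E m | ‖p‖ < n}, φ (X.1.1, p) * F (X, p) :=
    h1.stronglyMeasurable.integral_prod_right'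
  exact h2.measurable

theorem IsProfile.lintegral_fst_le (hP : IsProfile R C₁ A N F) {g : E d → ℝ≥0∞} (hg : Measurable g) :
    ∫⁻ X, g X.1.1 ∂N ≤ C₁ * ∫⁻ x in cube d R, g x := by
  rw [← lintegral_map (g := fun y : State d ι => y.1.1) hg (by fun_prop)]
  refine (lintegral_mono' hP.marg le_rfl).trans ?_
  rw [lintegral_smul_measure]; rfl

theorem IsProfile.ae_fst (hP : IsProfile R C₁ A N F) {p : E d → Prop}
    (hp : ∀ᵐ x ∂(volume.restrict (cube d R)), p x) : ∀ᵐ X ∂N, p X.1.1 := by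
  have h1 : N.map (fun y => y.1.1) ≪ volume.restrict (cube d R) :=
    (Measure.absolutelyContinuous_of_le hP.marg).trans
      (Measure.smul_absolutelyContinuous (c := C₁))
  exact ae_of_ae_map (by fun_prop) (h1.ae_le hp)

/-- Cauchy–Schwarz in `p`, the bound of `F` on the ball at almost every state, and domination of the
spatial marginal by Lebesgue measure. It makes the pairing continuous in `φ` for the `L²` norm on
cube times ball. -/
theorem IsProfile.lintegral_sq_lintegral_le (hP : IsProfile R C₁ A N F) (n : ℕ)
    {φ : E d × E m → ℂ} (hφ : Measurable φ) :
    ∫⁻ X, (∫⁻ p in {p : E m | ‖p‖ < n}, ‖φ (X.1.1, p)‖ₑ * ‖F (X, p)‖ₑ) ^ 2 ∂N ≤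
      C₁ * A n * ∫⁻ y, ‖φ y‖ₑ ^ 2 ∂(lam (cube d R) m n) := by
  have hm2 : Measurable fun y : E d × E m => ‖φ y‖ₑ ^ 2 := hφ.enorm.pow_const 2
  have hgm : Measurable fun x => ∫⁻ p in {p : E m | ‖p‖ < n}, ‖φ (x, p)‖ₑ ^ 2 :=
    hm2.lintegral_prod_right'
  calc ∫⁻ X, (∫⁻ p in {p : E m | ‖p‖ < n}, ‖φ (X.1.1, p)‖ₑ * ‖F (X, p)‖ₑ) ^ 2 ∂N
      ≤ ∫⁻ X, A n * (∫⁻ p in {p : E m | ‖p‖ < n}, ‖φ (X.1.1, p)‖ₑ ^ 2) ∂N := by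
        refine lintegral_mono_ae ?_
        filter_upwards [hP.bound n] with X hX
        have h2 := sq_lintegral_mul_le (μ := volume.restrict {p : E m | ‖p‖ < n})
          (f := fun p => ‖φ (X.1.1, p)‖ₑ) (g := fun p => ‖F (X, p)‖ₑ)
          (hφ.comp measurable_prodMk_left).enorm.aemeasurable
          (hP.meas.comp measurable_prodMk_left).enorm.aemeasurable
        calc _ ≤ _ := h2
          _ ≤ _ := by rw [mul_comm]; gcongr
    _ = A n * ∫⁻ X, (∫⁻ p in {p : E m | ‖p‖ < n}, ‖φ (X.1.1, p)‖ₑ ^ 2) ∂N :=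
        lintegral_const_mul' _ _ (hP.bound_ne_top n)
    _ ≤ A n * (C₁ * ∫⁻ x in cube d R, ∫⁻ p in {p : E m | ‖p‖ < n}, ‖φ (x, p)‖ₑ ^ 2) := by
        gcongr
        exact hP.lintegral_fst_le hgm
    _ = _ := by
        have e : ∫⁻ y, ‖φ y‖ₑ ^ 2 ∂(lam (cube d R) m n) =
            ∫⁻ x in cube d R, ∫⁻ p in {p : E m | ‖p‖ < n}, ‖φ (x, p)‖ₑ ^ 2 :=
          lintegral_prod (μ := volume.restrict (cube d R)) (ν := volume.restrict _) _ hm2.aemeasurable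
        rw [e, ← mul_assoc, mul_comm (A n)]

theorem IsProfile.lintegral_pair_sq_le (hP : IsProfile R C₁ A N F) (n : ℕ) {φ : E d × E m → ℂ}
    (hφ : Measurable φ) :
    ∫⁻ X, ‖pair n F φ X‖ₑ ^ 2 ∂N ≤ C₁ * A n * ∫⁻ y, ‖φ y‖ₑ ^ 2 ∂(lam (cube d R) m n) := by
  refine (lintegral_mono fun X => pow_le_pow_left' ?_ 2).trans (hP.lintegral_sq_lintegral_le n hφ)
  refine (enorm_integral_le_lintegral_enorm _).trans (le_of_eq ?_)
  simp_rw [enorm_mul]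

theorem IsProfile.ae_slice (hP : IsProfile R C₁ A N F) {n : ℕ} {p : E d × E m → Prop}
    (hp : ∀ᵐ y ∂(lam (cube d R) m n), p y) :
    ∀ᵐ X ∂N, ∀ᵐ q ∂(volume.restrict {q : E m | ‖q‖ < n}), p (X.1.1, q) :=
  hP.ae_fst (Measure.ae_ae_of_ae_prod hp)

/-- Absolute continuity of the spatial marginal makes the pairing well defined on `L²` classes,
although `N` lives on a larger space. -/
theorem IsProfile.pair_congr (hP : IsProfile R C₁ A N F) {n : ℕ} {φ φ' : E d × E m → ℂ}
    (h : φ =ᵐ[lam (cube d R) m n] φ') : pair n F φ =ᵐ[N] pair n F φ' := by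
  filter_upwards [hP.ae_slice h] with X hX
  refine integral_congr_ae ?_
  filter_upwards [hX] with p hp
  rw [hp]

theorem IsProfile.ae_integrable (hP : IsProfile R C₁ A N F) {n : ℕ} {φ : E d × E m → ℂ}
    (hφ : Measurable φ) (hφ2 : MemLp φ 2 (lam (cube d R) m n)) :
    ∀ᵐ X ∂N, Integrable (fun p => φ (X.1.1, p) * F (X, p)) (volume.restrict {p : E m | ‖p‖ < n}) := by
  have hm2 : Measurable fun y : E d × E m => ‖φ y‖ₑ ^ 2 := hφ.enorm.pow_const 2
  have h1 : ∀ᵐ x ∂(volume.restrict (cube d R)), ∫⁻ p in {p : E m | ‖p‖ < n}, ‖φ (x, p)‖ₑ ^ 2 < ∞ := by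
    refine ae_lt_top hm2.lintegral_prod_right' (ne_of_lt ?_)
    have := (memLp_two_iff hφ2.1).1 hφ2
    rwa [lam, lintegral_prod _ hm2.aemeasurable] at this
  filter_upwards [hP.ae_fst h1, hP.bound n] with X h2 h3
  have h4 : MemLp (fun p => φ (X.1.1, p)) 2 (volume.restrict {p : E m | ‖p‖ < n}) :=
    (memLp_two_iff (hφ.comp measurable_prodMk_left).aestronglyMeasurable).2 h2
  have h5 : MemLp (fun p => F (X, p)) 2 (volume.restrict {p : E m | ‖p‖ < n}) :=
    (memLp_two_iff (hP.meas.comp measurable_prodMk_left).aestronglyMeasurable).2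
      (h3.trans_lt (hP.bound_ne_top n).lt_top)
  exact h4.integrable_mul h5

theorem IsProfile.memLp_pair (hP : IsProfile R C₁ A N F) {n : ℕ} {φ : E d × E m → ℂ}
    (hφ : Measurable φ) (hφ2 : MemLp φ 2 (lam (cube d R) m n)) : MemLp (pair n F φ) 2 N := by
  refine (memLp_two_iff (measurable_pair hP.meas n hφ).aestronglyMeasurable).2
    ((hP.lintegral_pair_sq_le n hφ).trans_lt ?_)
  exact ENNReal.mul_lt_top (ENNReal.mul_lt_top hP.const_ne_top.lt_top (hP.bound_ne_top n).lt_top)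
    ((memLp_two_iff hφ2.1).1 hφ2)

theorem IsProfile.isBddSesq_limitForm (hP : IsProfile R C₁ A N F) {φ : ℝ → ℂ} (hφ : Integrable φ)
    {ψ : S d → ℂ} (hψ : Continuous ψ) (n : ℕ) {B : ℝ} (hB0 : 0 ≤ B) (hB : ∀ ξ, ‖ψ ξ‖ ≤ B) :
    IsBddSesq (fun f g : Lp ℂ 2 (lam (cube d R) m n) => limitForm N n F φ ψ f g)
      (((∫ x, ‖φ x‖) * B) * (C₁ * A n).toReal) := by
  have hfin := hP.finite
  have hL := fun f : Lp ℂ 2 (lam (cube d R) m n) => (Lp.stronglyMeasurable f).measurable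
  have hm := fun f : Lp ℂ 2 (lam (cube d R) m n) => hP.memLp_pair (hL f) (Lp.memLp f)
  have hkm : Measurable fun X : State d ι => 𝓕 φ X.2.1 * ψ X.1.2 :=
    ((continuous_fourier hφ).measurable.comp measurable_snd.fst).mul
      (hψ.measurable.comp measurable_fst.snd)
  have hb : ∀ X : State d ι, ‖𝓕 φ X.2.1 * ψ X.1.2‖ ≤ (∫ x, ‖φ x‖) * B := fun X => by
    rw [norm_mul]
    exact mul_le_mul (norm_fourier_le _ _) (hB _) (norm_nonneg _)
      (integral_nonneg fun _ => norm_nonneg _)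
  have hi := fun f g => integrable_mul_conj hkm.aestronglyMeasurable hb (hm f) (hm g)
  have hadd : ∀ f g : Lp ℂ 2 (lam (cube d R) m n),
      pair n F (f + g : Lp ℂ 2 (lam (cube d R) m n)) =ᵐ[N] pair n F f + pair n F g := by
    intro f g
    filter_upwards [hP.ae_slice (Lp.coeFn_add f g), hP.ae_integrable (hL f) (Lp.memLp f),
      hP.ae_integrable (hL g) (Lp.memLp g)] with X h1 h2 h3
    rw [Pi.add_apply, pair, pair, pair, ← integral_add h2 h3]
    refine integral_congr_ae ?_
    filter_upwards [h1] with p hp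
    rw [hp, Pi.add_apply]; ring
  have hsmul : ∀ (c : ℂ) (f : Lp ℂ 2 (lam (cube d R) m n)),
      pair n F (c • f : Lp ℂ 2 (lam (cube d R) m n)) =ᵐ[N] fun X => c * pair n F f X := by
    intro c f
    filter_upwards [hP.ae_slice (Lp.coeFn_smul c f)] with X h1
    rw [pair, pair, ← integral_const_mul]
    refine integral_congr_ae ?_
    filter_upwards [h1] with p hp
    rw [hp, Pi.smul_apply, smul_eq_mul]; ring
  refine ⟨fun f g h => ?_, fun c f h => ?_, fun f g h => ?_, fun c f h => ?_, fun f g => ?_⟩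
  · simp only [limitForm]
    rw [← integral_add (hi f h) (hi g h)]
    refine integral_congr_ae ?_
    filter_upwards [hadd f g] with X hX
    rw [hX, Pi.add_apply]; ring
  · simp only [limitForm]
    rw [← integral_const_mul]
    refine integral_congr_ae ?_
    filter_upwards [hsmul c f] with X hX
    rw [hX]; ring
  · simp only [limitForm]
    rw [← integral_add (hi f g) (hi f h)]
    refine integral_congr_ae ?_
    filter_upwards [hadd g h] with X hX
    rw [hX, Pi.add_apply, map_add]; ring
  · simp only [limitForm]
    rw [← integral_const_mul]
    refine integral_congr_ae ?_
    filter_upwards [hsmul c h] with X hX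
    rw [hX, map_mul]; ring
  · have hB1 : 0 ≤ (∫ x, ‖φ x‖) * B := mul_nonneg (integral_nonneg fun _ => norm_nonneg _) hB0
    have h1 := norm_integral_mul_conj_le (μ := N) hb
      (measurable_pair hP.meas n (hL f)).aemeasurable (measurable_pair hP.meas n (hL g)).aemeasurable
      (hP.lintegral_pair_sq_le n (hL f)) (hP.lintegral_pair_sq_le n (hL g))
    have e : ∀ f : Lp ℂ 2 (lam (cube d R) m n),
        ∫⁻ y, ‖f y‖ₑ ^ 2 ∂(lam (cube d R) m n) = ENNReal.ofReal (‖f‖ ^ 2) := by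
      intro f
      rw [← enorm_toLp_sq (Lp.memLp f), Lp.toLp_coeFn]
    have hV : C₁ * A n ≠ ∞ := ENNReal.mul_ne_top hP.const_ne_top (hP.bound_ne_top n)
    rw [e, e, ← ENNReal.ofReal_toReal hV, ← ENNReal.ofReal_mul ENNReal.toReal_nonneg,
      ← ENNReal.ofReal_mul ENNReal.toReal_nonneg, ← ENNReal.ofReal_mul (by positivity),
      ENNReal.ofReal_rpow_of_nonneg (by positivity) (by positivity), ← ENNReal.ofReal_mul hB1,
      ← ofReal_norm, ENNReal.ofReal_le_ofReal_iff (by positivity)] at h1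
    refine h1.trans (le_of_eq ?_)
    have e2 : (C₁ * A n).toReal * ‖f‖ ^ 2 * ((C₁ * A n).toReal * ‖g‖ ^ 2) =
        ((C₁ * A n).toReal * ‖f‖ * ‖g‖) ^ 2 := by ring
    rw [e2, ← Real.sqrt_eq_rpow, Real.sqrt_sq (by positivity)]
    ring

end LimitForm

/-! ### Existence of a limit profile. -/

section Profile

/-- The exponent `m + 1` exceeds the dimension. Replacing `‖p‖` by its integer part costs `2 ^ (m +
1)`, since `1 + ‖p‖ ≤ 2 (1 + ⌊‖p‖⌋)`. -/
theorem exists_weight (m : ℕ) :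
    ∃ W : ℕ → ℝ, (∀ n, 0 < W n) ∧ ∫⁻ p : E m, ENNReal.ofReal (W ⌊‖p‖⌋₊) < ∞ := by
  refine ⟨fun n => ((1 + n : ℝ) ^ (m + 1))⁻¹, fun n => by positivity, ?_⟩
  have h1 : Integrable fun p : E m => (1 + ‖p‖) ^ (-((m : ℝ) + 1)) :=
    integrable_one_add_norm (by simp)
  have h2 := (h1.const_mul (2 ^ (m + 1))).lintegral_lt_top
  refine lt_of_le_of_lt (lintegral_mono fun p => ENNReal.ofReal_le_ofReal ?_) h2
  have e : (1 + ‖p‖) ^ (-((m : ℝ) + 1)) = ((1 + ‖p‖) ^ (m + 1))⁻¹ := by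
    rw [Real.rpow_neg (by positivity)]
    norm_cast
  dsimp only
  rw [e, ← div_eq_mul_inv, inv_eq_one_div, div_le_div_iff₀ (by positivity) (by positivity), one_mul,
    ← mul_pow]
  gcongr
  have := (Nat.lt_floor_add_one ‖p‖).le
  linarith [norm_nonneg p, (Nat.cast_nonneg ⌊‖p‖⌋₊ : (0 : ℝ) ≤ _)]

variable {d m : ℕ} {ι : Type} [Countable ι] {R T : ℝ} {W : ℕ → ℝ} {h : ι → E m → ℂ} {l : ι → ℕ}
  {C₁ M : ℝ≥0∞} {N : Measure (State d ι)}

/-- The coefficients of the limit profile. -/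
noncomputable def profileCoef (W : ℕ → ℝ) (l : ι → ℕ) (i : ι) (X : State d ι) : ℂ :=
  ((Real.sqrt (W (l i)))⁻¹ : ℝ) * X.2.2 i

omit [Countable ι] in
theorem norm_profileCoef_sq (hW : ∀ n, 0 < W n) (i : ι) (X : State d ι) :
    ‖profileCoef W l i X‖ ^ 2 = (W (l i))⁻¹ * ‖X.2.2 i‖ ^ 2 := by
  rw [profileCoef, norm_mul, mul_pow, Complex.norm_real, Real.norm_eq_abs, sq_abs, inv_pow,
    Real.sq_sqrt (hW _).le]

/-- The energy bound is the summability needed for `exists_superposition`. On the ball of radius `n`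
only annuli `k < n` matter, and there `(W k)⁻¹` is at most the sum of all these inverses; as the
normalised coefficients have square sum at most `1`, this sum serves as `A n`. -/
theorem exists_profile_of_isPacketMeasure (hb : IsAnnularBasis h l) (hW : ∀ n, 0 < W n)
    (hC₁ : C₁ ≠ ∞) (hM : M ≠ ∞) (hN : IsPacketMeasure W l R T C₁ M N) :
    ∃ (A : ℕ → ℝ≥0∞) (F : State d ι × E m → ℂ), IsProfile R C₁ A N F ∧
      ∀ᵐ X ∂N, ∀ i, ∫ p, conj (h i p) * F (X, p) = profileCoef W l i X := by
  have hfin : IsFiniteMeasure N := ⟨hN.measure_univ_le.trans_lt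
    (ENNReal.mul_lt_top hC₁.lt_top (isCompact_cube R).measure_lt_top)⟩
  have hsq : ∀ (X : State d ι) (i : ι), ‖profileCoef W l i X‖ₑ ^ 2 =
      ENNReal.ofReal ((W (l i))⁻¹ * ‖X.2.2 i‖ ^ 2) := fun X i => by
    rw [← norm_profileCoef_sq hW, ENNReal.ofReal_pow (norm_nonneg _), ofReal_norm]
  have hmc : ∀ i, Measurable (profileCoef W l i : State d ι → ℂ) := fun i =>
    measurable_const.mul ((measurable_pi_apply i).comp measurable_snd.snd)
  obtain ⟨F, hFm, hF2, hF⟩ := exists_superposition (μ := N) hb hmc hM fun I => by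
    refine le_trans (le_of_eq ?_) (hN.energy I)
    rw [← lintegral_finsetSum _ fun i _ => (hmc i).enorm.pow_const 2]
    refine lintegral_congr fun X => ?_
    rw [ENNReal.ofReal_sum_of_nonneg fun i _ => mul_nonneg (inv_nonneg.2 (hW _).le) (sq_nonneg _)]
    exact Finset.sum_congr rfl fun i _ => hsq X i
  have hF' := ae_all_iff.2 hF
  refine ⟨fun n => ENNReal.ofReal (∑ k ∈ Finset.range n, (W k)⁻¹), F, ⟨hfin, hC₁, hN.map_fst_le hC₁,
    hFm, hF2, fun n => ENNReal.ofReal_ne_top, fun n => ?_⟩, hF'⟩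
  have hF3 : ∀ᵐ X ∂N, ∫⁻ p, ‖F (X, p)‖ₑ ^ 2 < ∞ := by
    have h1 := (memLp_two_iff hF2.1).1 hF2
    have hm2 : Measurable fun y : State d ι × E m => ‖F y‖ₑ ^ 2 := hFm.enorm.pow_const 2
    rw [lintegral_prod _ hm2.aemeasurable] at h1
    exact ae_lt_top hm2.lintegral_prod_right' h1.ne
  filter_upwards [hF', hF3, mem_ae_iff.2 hN.supp] with X h1 h2 h3
  refine hb.parseval (fun p => F (X, p)) ((memLp_two_iff
    (hFm.comp measurable_prodMk_left).aestronglyMeasurable).2 h2) n _ fun I hI => ?_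
  simp_rw [h1, hsq]
  rw [← ENNReal.ofReal_sum_of_nonneg fun i _ => mul_nonneg (inv_nonneg.2 (hW _).le) (sq_nonneg _)]
  refine ENNReal.ofReal_le_ofReal ?_
  have hS : 0 ≤ ∑ k ∈ Finset.range n, (W k)⁻¹ := Finset.sum_nonneg fun k _ => inv_nonneg.2 (hW _).le
  calc ∑ i ∈ I, (W (l i))⁻¹ * ‖X.2.2 i‖ ^ 2
      ≤ ∑ i ∈ I, (∑ k ∈ Finset.range n, (W k)⁻¹) * ‖X.2.2 i‖ ^ 2 := by
        refine Finset.sum_le_sum fun i hi => ?_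
        gcongr
        exact Finset.single_le_sum (f := fun k => (W k)⁻¹) (fun k _ => inv_nonneg.2 (hW k).le)
          (Finset.mem_range.2 (hI i hi))
    _ = (∑ k ∈ Finset.range n, (W k)⁻¹) * ∑ i ∈ I, ‖X.2.2 i‖ ^ 2 := (Finset.mul_sum _ _ _).symm
    _ ≤ _ := by
        nlinarith [h3.2.2 I]

omit [Countable ι] in
theorem pair_mode (hb : IsAnnularBasis h l) {i : ι} {n : ℕ} (hi : l i < n) (k : Fin d → ℤ)
    (F : State d ι × E m → ℂ) (X : State d ι) :
    pair n F (mode R k (h i)) X =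
      (𝐞 (inner ℝ (freq R k) X.1.1) : ℂ) * ∫ p, conj (h i p) * F (X, p) := by
  rw [pair, ← integral_const_mul, ← integral_indicator (measurableSet_normBall m n)]
  refine integral_congr_ae (Eventually.of_forall fun p => ?_)
  by_cases hp : p ∈ {p : E m | ‖p‖ < (n : ℝ)}
  · rw [indicator_of_mem hp, mode, mul_assoc]
  · simp [indicator_of_notMem hp, hb.eq_zero hi p (not_lt.1 hp)]

omit [Countable ι] in
-- Pairing `F` with a mode gives the character of the mode times one coefficient of `F`. The weights
-- cancel against those in `profileCoef`, and the two characters combine to index `η - ζ`.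
theorem limitForm_mode (hb : IsAnnularBasis h l) (hW : ∀ n, 0 < W n) {F : State d ι × E m → ℂ}
    (hF : ∀ᵐ X ∂N, ∀ i, ∫ p, conj (h i p) * F (X, p) = profileCoef W l i X) {i j : ι} {n : ℕ}
    (hi : l i < n) (hj : l j < n) (η ζ : Fin d → ℤ) (φ : ℝ → ℂ) (ψ : S d → ℂ) :
    ((Real.sqrt (W (l i)) * Real.sqrt (W (l j)) : ℝ) : ℂ) *
      limitForm N n F φ ψ (mode R η (h i)) (mode R ζ (h j)) =
    ∫ y, observable φ ψ R (η - ζ) i j y ∂N := by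
  rw [limitForm, ← integral_const_mul]
  refine integral_congr_ae ?_
  filter_upwards [hF] with X hX
  have h1 : ∀ i, (Real.sqrt (W (l i)) : ℂ) ≠ 0 := fun i => by
    exact_mod_cast (Real.sqrt_pos.2 (hW (l i))).ne'
  have he : (𝐞 (inner ℝ (freq R (η - ζ)) X.1.1) : ℂ) =
      (𝐞 (inner ℝ (freq R η) X.1.1) : ℂ) * conj (𝐞 (inner ℝ (freq R ζ) X.1.1) : ℂ) := by
    rw [freq_sub, inner_sub_left, AddChar.map_sub_eq_div, Circle.coe_div, ← Circle.coe_inv_eq_conj,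
      Circle.coe_inv, div_eq_mul_inv]
  rw [pair_mode hb hi, pair_mode hb hj, hX, hX, observable, he]
  simp only [profileCoef, map_mul, Complex.conj_ofReal]
  have := h1 i
  have := h1 j
  push_cast
  field_simp

/-- Along a subsequence, the amplitudes converge to a form which is given by a profile. -/
theorem IsTameSeq.exists_profile {α : Type*} [MeasurableSpace α] {ρ : Measure α} [IsFiniteMeasure ρ]
    {C : ℝ} {u : ℕ → α → E d × E m → ℂ} (hR : 0 < R) (hu : IsTameSeq ρ (cube d R) C u)
    {τ : α → ℝ} (hτ : Measurable τ) (hT : ∀ s, τ s ∈ Icc 0 T) (hM' : M ≠ ∞)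
    (hM : ∀ n, ∫⁻ s, (∫⁻ y, ‖u n s y‖ₑ ^ 2) ∂ρ ≤ M) :
    ∃ σ : ℕ → ℕ, StrictMono σ ∧ ∃ (ι : Type) (C₁ : ℝ≥0∞) (A : ℕ → ℝ≥0∞) (N : Measure (State d ι))
      (F : State d ι × E m → ℂ), Countable ι ∧ IsProfile R C₁ A N F ∧
      ∀ (φ : ℝ → ℂ) (ψ : S d → ℂ), Integrable φ → Continuous ψ → ∀ (n : ℕ) (φ₁ φ₂ : E d × E m → ℂ),
        MemLp φ₁ 2 (lam (cube d R) m n) → MemLp φ₂ 2 (lam (cube d R) m n) →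
        Tendsto (fun k => amplitude ρ τ (cube d R) n φ ψ (u (σ k)) φ₁ φ₂) atTop
          (𝓝 (limitForm N n F φ ψ φ₁ φ₂)) := by
  obtain ⟨ι, hι, h, l, hb⟩ := exists_annularBasis m
  obtain ⟨W, hW, hWf⟩ := exists_weight m
  have hKm : MeasurableSet (cube d R) := measurableSet_cube R
  have hK : volume (cube d R) ≠ ∞ := (isCompact_cube R).measure_lt_top.ne
  obtain ⟨σ, hσ, C₁, N, hC₁, hN, ht⟩ := exists_subseq_amplitude hu hKm hK hb hR subset_rfl hW hWf hτ hT hM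
  obtain ⟨A, F, hP, hF⟩ := exists_profile_of_isPacketMeasure hb hW hC₁ hM' hN
  refine ⟨σ, hσ, ι, C₁, A, N, F, hι, hP, fun φ ψ hφ hψ n φ₁ φ₂ h1 h2 => ?_⟩
  obtain ⟨B, hB0, hB⟩ := exists_bound_sphere hψ
  set a : ℝ := (B * ∫ x, ‖φ x‖) * (vhatBound ρ m C n).toReal
  set b : ℝ := ((∫ x, ‖φ x‖) * B) * (C₁ * A n).toReal
  -- Amplitudes and limit form come with different constants; the density argument requires a common
  -- one.
  have hmono : ∀ {f : Lp ℂ 2 (lam (cube d R) m n) → Lp ℂ 2 (lam (cube d R) m n) → ℂ} {c : ℝ},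
      c ≤ max a b → IsBddSesq f c → IsBddSesq f (max a b) := fun hc hf =>
    ⟨hf.add_left, hf.smul_left, hf.add_right, hf.smul_right, fun x y =>
      (hf.bound x y).trans (by gcongr)⟩
  have hlim := IsBddSesq.tendsto_of_dense
    (fun k => hmono (le_max_left a b) (isBddSesq_amplitude hu hKm hK hτ hφ hψ n hB0 hB (σ k)))
    (hmono (le_max_right a b) (hP.isBddSesq_limitForm hφ hψ n hB0 hB)) (dense_span_mode hR hb n)
    (by
      rintro _ ⟨η, i, hi, rfl⟩ _ ⟨ζ, j, hj, rfl⟩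
      have e1 := (memLp_mode hK n R η (hb.meas i) (hb.memLp i)).coeFn_toLp
      have e2 := (memLp_mode hK n R ζ (hb.meas j) (hb.memLp j)).coeFn_toLp
      have h0 : ((Real.sqrt (W (l i)) * Real.sqrt (W (l j)) : ℝ) : ℂ) ≠ 0 := by
        have := Real.sqrt_pos.2 (hW (l i))
        have := Real.sqrt_pos.2 (hW (l j))
        exact_mod_cast (by positivity : Real.sqrt (W (l i)) * Real.sqrt (W (l j)) ≠ 0)
      have h3 := ht φ ψ hφ hψ η ζ i j n hi hj
      rw [← limitForm_mode hb hW hF hi hj] at h3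
      have h4 := h3.const_mul ((Real.sqrt (W (l i)) * Real.sqrt (W (l j)) : ℝ) : ℂ)⁻¹
      simp only [← mul_assoc, inv_mul_cancel₀ h0, one_mul] at h4
      have e3 : limitForm N n F φ ψ (mode R η (h i)) (mode R ζ (h j)) = limitForm N n F φ ψ
          ((memLp_mode hK n R η (hb.meas i) (hb.memLp i)).toLp _)
          ((memLp_mode hK n R ζ (hb.meas j) (hb.memLp j)).toLp _) := by
        refine integral_congr_ae ?_
        filter_upwards [hP.pair_congr e1, hP.pair_congr e2] with X h5 h6
        rw [h5, h6]
      rw [e3] at h4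
      refine h4.congr fun k => integral_congr_ae (Eventually.of_forall fun w => ?_)
      simp only [vhat_congr e1, vhat_congr e2]) (h1.toLp φ₁) (h2.toLp φ₂)
  have e3 : limitForm N n F φ ψ φ₁ φ₂ = limitForm N n F φ ψ (h1.toLp φ₁) (h2.toLp φ₂) := by
    refine integral_congr_ae ?_
    filter_upwards [hP.pair_congr h1.coeFn_toLp, hP.pair_congr h2.coeFn_toLp] with X h5 h6
    rw [h5, h6]
  rw [e3]
  refine hlim.congr fun k => integral_congr_ae (Eventually.of_forall fun w => ?_)
  simp only [vhat_congr h1.coeFn_toLp, vhat_congr h2.coeFn_toLp]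

end Profile

/-! ### Absolute convergence and exchange of integrals. -/

section Fubini

/-- Reorders `ω, ((ξ₀, ξ'), (p, q)), t`, as in the expectation, into `((ω, t), ξ'), (ξ₀, (p, q))`,
as in the amplitude. -/
theorem measurePreserving_rearrange {A B C D F : Type*} [MeasurableSpace A] [MeasurableSpace B]
    [MeasurableSpace C] [MeasurableSpace D] [MeasurableSpace F] (a : Measure A) (b : Measure B)
    (c : Measure C) (e : Measure D) (t : Measure F) [SFinite a] [SFinite b] [SFinite c] [SFinite e]
    [SFinite t] :
    MeasurePreserving (fun w : (A × ((B × C) × D)) × F =>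
      (((w.1.1, w.2), w.1.2.1.2), (w.1.2.1.1, w.1.2.2)))
      ((a.prod ((b.prod c).prod e)).prod t) (((a.prod t).prod c).prod (b.prod e)) := by
  have h1 := measurePreserving_prodAssoc a ((b.prod c).prod e) t
  have h2 : MeasurePreserving _ ((b.prod c).prod e) (c.prod (b.prod e)) :=
    (measurePreserving_prodAssoc c b e).comp
      ((Measure.measurePreserving_swap (μ := b) (ν := c)).prod (MeasurePreserving.id e))
  have h3 := ((MeasurePreserving.id t).prod h2).comp
    (Measure.measurePreserving_swap (μ := (b.prod c).prod e) (ν := t))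
  have h4 := ((MeasurePreserving.id a).prod h3).comp h1
  have h5 := (measurePreserving_prodAssoc (a.prod t) c (b.prod e)).symm
  have h6 := (measurePreserving_prodAssoc a t (c.prod (b.prod e))).symm
  exact (h5.comp h6).comp h4

variable {α : Type*} [MeasurableSpace α] {d m : ℕ} {K : Set (E d)} {C : ℝ} {n : ℕ}

theorem measurable_uncurry_mul {u : α → E d × E m → ℂ} (hu : Measurable (Function.uncurry u))
    {φ₁ : E d × E m → ℂ} (hφ₁ : Measurable φ₁) :
    Measurable (Function.uncurry fun s y => φ₁ y * u s y) :=
  (hφ₁.comp measurable_snd).mul hu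

theorem ftx_eq_zero {v φ₁ : E d × E m → ℂ} (hs : ∀ y, (n : ℝ) ≤ ‖y.2‖ → φ₁ y = 0) {p : E m}
    (hp : (n : ℝ) ≤ ‖p‖) (ξ : E d) : ftx (fun y => φ₁ y * v y) p ξ = 0 := by
  have : (fun x => φ₁ (x, p) * v (x, p)) = fun _ => 0 := by
    ext x
    rw [hs (x, p) hp, zero_mul]
  rw [ftx, this, Real.fourier_eq]
  simp

theorem integral_ftx {v : E d × E m → ℂ} (hv : IsTameFun K C v) (hKm : MeasurableSet K)
    (hK : volume K ≠ ∞) {φ₁ : E d × E m → ℂ}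
    (hφ2 : MemLp φ₁ 2 (lam K m n)) (hs : ∀ y, (n : ℝ) ≤ ‖y.2‖ → φ₁ y = 0) (ξ : E d) :
    ∫ p, ftx (fun y => φ₁ y * v y) p ξ = vhat K n φ₁ v ξ := by
  have hfin := isFiniteMeasure_lam hK m n
  have hi : Integrable (fun y : E d × E m => (𝐞 (-(inner ℝ y.1 ξ)) : ℂ) * (φ₁ y * v y))
      ((volume.restrict K).prod (volume.restrict {p : E m | ‖p‖ < n})) :=
    integrable_exp_mul (hv.integrable_mul (integrable_of_memLp_two hφ2)) ξ
  rw [vhat, lam, integral_prod_symm _ hi, ← integral_indicator (measurableSet_normBall m n)]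
  refine integral_congr_ae (Eventually.of_forall fun p => ?_)
  by_cases hp : p ∈ {p : E m | ‖p‖ < (n : ℝ)}
  · rw [indicator_of_mem hp, ← integral_indicator hKm]
    dsimp only
    rw [ftx, Real.fourier_eq]
    refine integral_congr_ae (Eventually.of_forall fun x => ?_)
    by_cases hx : x ∈ K
    · rw [indicator_of_mem hx]; rfl
    · simp [hv.supp (x, p) hx, hx]
  · rw [indicator_of_notMem hp]
    exact ftx_eq_zero hs (not_lt.1 hp) ξ

/-- In contrast to the bound for `vhat`, the modulus is inside the integral in `p`, as absolute
convergence demands. Cauchy–Schwarz over the ball comes first, then Plancherel in `x` for almost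
every `p`. -/
theorem lintegral_sq_lintegral_ftx_le {v : E d × E m → ℂ} (hv : IsTameFun K C v)
    (hKm : MeasurableSet K) (hK : volume K ≠ ∞) {φ₁ : E d × E m → ℂ} (hφ : Measurable φ₁)
    (hφ2 : MemLp φ₁ 2 (lam K m n)) (hs : ∀ y, (n : ℝ) ≤ ‖y.2‖ → φ₁ y = 0) :
    ∫⁻ ξ, (∫⁻ p, ‖ftx (fun y => φ₁ y * v y) p ξ‖ₑ) ^ 2 ≤
      volume {p : E m | ‖p‖ < (n : ℝ)} * (ENNReal.ofReal C ^ 2 * ∫⁻ y, ‖φ₁ y‖ₑ ^ 2 ∂(lam K m n)) := by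
  set L : Set (E m) := {p | ‖p‖ < n}
  have hL : MeasurableSet L := measurableSet_normBall m n
  have hfin := isFiniteMeasure_lam hK m n
  have hvol : volume L ≠ ∞ := (volume_ball_lt_top m n).ne
  have hwm : Measurable fun y : E d × E m => φ₁ y * v y := hφ.mul hv.meas
  have hm : Measurable fun w : E d × E m => ftx (fun y => φ₁ y * v y) w.2 w.1 :=
    measurable_ftx_comp (u := fun _ : Unit => fun y => φ₁ y * v y) (hwm.comp measurable_snd)
      (f := fun _ => ()) measurable_const measurable_snd measurable_fst
  have h1 : ∀ ξ, (∫⁻ p, ‖ftx (fun y => φ₁ y * v y) p ξ‖ₑ) ^ 2 ≤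
      volume L * ∫⁻ p in L, ‖ftx (fun y => φ₁ y * v y) p ξ‖ₑ ^ 2 := by
    intro ξ
    have e : ∫⁻ p, ‖ftx (fun y => φ₁ y * v y) p ξ‖ₑ = ∫⁻ p in L, ‖ftx (fun y => φ₁ y * v y) p ξ‖ₑ := by
      rw [← lintegral_indicator hL]
      refine lintegral_congr fun p => ?_
      by_cases hp : p ∈ L
      · simp [hp]
      · simp [hp, ftx_eq_zero hs (not_lt.1 hp) ξ]
    rw [e]
    exact sq_setLIntegral_le (hm.comp measurable_prodMk_left).enorm.aemeasurable
  refine (lintegral_mono h1).trans ?_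
  rw [lintegral_const_mul' _ _ hvol]
  gcongr
  rw [lintegral_lintegral_swap (hm.enorm.pow_const 2).aemeasurable]
  have hφsq : Measurable fun y : E d × E m => ‖φ₁ y‖ₑ ^ 2 := hφ.enorm.pow_const 2
  have e : ∫⁻ y, ‖φ₁ y‖ₑ ^ 2 ∂(lam K m n) = ∫⁻ p in L, ∫⁻ x in K, ‖φ₁ (x, p)‖ₑ ^ 2 :=
    lintegral_prod_symm' (μ := volume.restrict K) (ν := volume.restrict L) _ hφsq
  have hlt : ∫⁻ p in L, ∫⁻ x in K, ‖φ₁ (x, p)‖ₑ ^ 2 < ∞ := by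
    rw [← e]; exact (memLp_two_iff hφ2.1).1 hφ2
  rw [e, ← lintegral_const_mul' _ _ (by simp)]
  have hae := ae_lt_top (μ := volume.restrict L) hφsq.lintegral_prod_left' hlt.ne
  refine lintegral_mono_ae ?_
  filter_upwards [hae] with p hp
  have hle : ∫⁻ x, ‖φ₁ (x, p) * v (x, p)‖ₑ ^ 2 ≤ ENNReal.ofReal C ^ 2 * ∫⁻ x in K, ‖φ₁ (x, p)‖ₑ ^ 2 := by
    rw [← lintegral_const_mul' _ _ (by simp), ← lintegral_indicator hKm]
    refine lintegral_mono fun x => ?_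
    by_cases hx : x ∈ K
    · rw [indicator_of_mem hx, enorm_mul, mul_pow, mul_comm]
      gcongr
      rw [← ofReal_norm]; exact ENNReal.ofReal_le_ofReal (hv.bound _)
    · simp [hv.supp (x, p) hx]
  have hsm : AEStronglyMeasurable (fun x => φ₁ (x, p) * v (x, p)) :=
    (hwm.comp measurable_prodMk_right).aestronglyMeasurable
  have hL2 : MemLp (fun x => φ₁ (x, p) * v (x, p)) 2 :=
    (memLp_two_iff hsm).2 (hle.trans_lt (ENNReal.mul_lt_top (by simp) hp))
  have hL1 : Integrable (fun x => φ₁ (x, p) * v (x, p)) := by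
    have hKf : IsFiniteMeasure ((volume : Measure (E d)).restrict K) := ⟨by simpa using hK.lt_top⟩
    have h2 : IntegrableOn (fun x => φ₁ (x, p) * v (x, p)) K :=
      integrable_of_memLp_two (hL2.restrict K)
    have h3 : K.indicator (fun x => φ₁ (x, p) * v (x, p)) = fun x => φ₁ (x, p) * v (x, p) := by
      refine indicator_eq_self.2 fun x hx => ?_
      by_contra hcon
      exact hx (by simp [hv.supp (x, p) hcon])
    rw [← h3]
    exact (integrable_indicator_iff hKm).2 h2
  simp only [ftx]
  rw [lintegral_enorm_sq_fourier hL1 hL2]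
  exact hle

variable {ρ : Measure α} [IsFiniteMeasure ρ]

/-- The integrand of the amplitude before the integrations in `ξ₀`, `p` and `q`. -/
noncomputable def fullIntegrand (τ : α → ℝ) (φ : ℝ → ℂ) (ψ : S d → ℂ) (u : α → E d × E m → ℂ)
    (φ₁ φ₂ : E d × E m → ℂ) (w : (α × E d) × (ℝ × (E m × E m))) : ℂ :=
  ((𝐞 (-(w.2.1 * τ w.1.1)) : ℂ) * (radialSymbol ψ (joinFreq w.2.1 w.1.2) * φ w.2.1)) *
    (ftx (fun y => φ₁ y * u w.1.1 y) w.2.2.1 w.1.2 *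
      conj (ftx (fun y => φ₂ y * u w.1.1 y) w.2.2.2 w.1.2))

/-- The modulus is at most a product of functions of `ξ₀`, `p` and `q` once `(s, ξ')` is fixed. The
`ξ₀` factor is integrable, and Cauchy–Schwarz in `(s, ξ')` treats the other two. -/
theorem integrable_fullIntegrand {u : α → E d × E m → ℂ} (hu : Measurable (Function.uncurry u))
    (hv : ∀ s, IsTameFun K C (u s)) (hKm : MeasurableSet K) (hK : volume K ≠ ∞)
    {τ : α → ℝ} (hτ : Measurable τ) {φ : ℝ → ℂ} (hφ : Integrable φ) {ψ : S d → ℂ}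
    (hψ : Continuous ψ) {φ₁ φ₂ : E d × E m → ℂ} (h1m : Measurable φ₁) (h2m : Measurable φ₂)
    (h1 : MemLp φ₁ 2 (lam K m n)) (h2 : MemLp φ₂ 2 (lam K m n))
    (h1s : ∀ y, (n : ℝ) ≤ ‖y.2‖ → φ₁ y = 0) (h2s : ∀ y, (n : ℝ) ≤ ‖y.2‖ → φ₂ y = 0) :
    Integrable (fullIntegrand τ φ ψ u φ₁ φ₂) ((ρ.prod volume).prod volume) := by
  obtain ⟨B, hB0, hB⟩ := exists_bound_sphere hψ
  have hmf : ∀ {φ' : E d × E m → ℂ}, Measurable φ' → Measurable fun w : (α × E d) × E m =>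
      ftx (fun y => φ' y * u w.1.1 y) w.2 w.1.2 := fun hφ' =>
    measurable_ftx_comp (measurable_uncurry_mul hu hφ') (f := fun w : (α × E d) × E m => w.1.1)
      measurable_fst.fst measurable_snd measurable_fst.snd
  have hφc : AEStronglyMeasurable (fun w : (α × E d) × (ℝ × (E m × E m)) => φ w.2.1)
      ((ρ.prod volume).prod volume) := by
    have : AEStronglyMeasurable (fun w : ℝ × (E m × E m) => φ w.1) (volume.prod volume) := hφ.1.comp_fst
    exact this.comp_snd
  have hsm : AEStronglyMeasurable (fullIntegrand τ φ ψ u φ₁ φ₂) ((ρ.prod volume).prod volume) := by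
    have e1 : Measurable fun w : (α × E d) × (ℝ × (E m × E m)) => (𝐞 (-(w.2.1 * τ w.1.1)) : ℂ) :=
      measurable_char.comp (measurable_snd.fst.mul (hτ.comp measurable_fst.fst)).neg
    have e2 : Measurable fun w : (α × E d) × (ℝ × (E m × E m)) =>
        radialSymbol ψ (joinFreq w.2.1 w.1.2) := (measurable_radialSymbol hψ).comp
      (continuous_joinFreq.measurable.comp (measurable_snd.fst.prodMk measurable_fst.snd))
    have e3 : Measurable fun w : (α × E d) × (ℝ × (E m × E m)) =>
        ftx (fun y => φ₁ y * u w.1.1 y) w.2.2.1 w.1.2 :=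
      (hmf h1m).comp (measurable_fst.prodMk measurable_snd.snd.fst)
    have e4 : Measurable fun w : (α × E d) × (ℝ × (E m × E m)) =>
        conj (ftx (fun y => φ₂ y * u w.1.1 y) w.2.2.2 w.1.2) :=
      RCLike.continuous_conj.measurable.comp
        ((hmf h2m).comp (measurable_fst.prodMk measurable_snd.snd.snd))
    exact (e1.aestronglyMeasurable.mul (e2.aestronglyMeasurable.mul hφc)).mul
      (e3.mul e4).aestronglyMeasurable
  refine ⟨hsm, ?_⟩
  set a : (α × E d) → ℝ≥0∞ := fun w => ∫⁻ p, ‖ftx (fun y => φ₁ y * u w.1 y) p w.2‖ₑ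
  set b : (α × E d) → ℝ≥0∞ := fun w => ∫⁻ p, ‖ftx (fun y => φ₂ y * u w.1 y) p w.2‖ₑ
  have ha : Measurable a := (hmf h1m).enorm.lintegral_prod_right'
  have hb : Measurable b := (hmf h2m).enorm.lintegral_prod_right'
  have hsq : ∀ {φ' : E d × E m → ℂ} (hm' : Measurable φ') (h' : MemLp φ' 2 (lam K m n))
      (hs' : ∀ y, (n : ℝ) ≤ ‖y.2‖ → φ' y = 0),
      ∫⁻ w, (∫⁻ p, ‖ftx (fun y => φ' y * u w.1 y) p w.2‖ₑ) ^ 2 ∂(ρ.prod volume) < ∞ := by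
    intro φ' hm' h' hs'
    rw [lintegral_prod _ ((hmf hm').enorm.lintegral_prod_right'.pow_const 2).aemeasurable]
    refine lt_of_le_of_lt (lintegral_mono fun s =>
      lintegral_sq_lintegral_ftx_le (hv s) hKm hK hm' h' hs') ?_
    rw [lintegral_const]
    exact ENNReal.mul_lt_top (ENNReal.mul_lt_top (volume_ball_lt_top m n)
      (ENNReal.mul_lt_top (by simp) ((memLp_two_iff h'.1).1 h'))) (measure_lt_top _ _)
  have hab : ∫⁻ w, a w * b w ∂(ρ.prod volume) < ∞ := by
    refine (lintegral_mul_le_sqrt ha.aemeasurable hb.aemeasurable le_rfl le_rfl).trans_lt ?_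
    exact ENNReal.rpow_lt_top_of_nonneg (by norm_num)
      (ENNReal.mul_lt_top (hsq h1m h1 h1s) (hsq h2m h2 h2s)).ne
  have hφfin : ∫⁻ x, ‖φ x‖ₑ < ∞ := hφ.2
  calc ∫⁻ w, ‖fullIntegrand τ φ ψ u φ₁ φ₂ w‖ₑ ∂((ρ.prod volume).prod volume)
      ≤ ∫⁻ w : (α × E d) × (ℝ × (E m × E m)), ENNReal.ofReal B * (‖φ w.2.1‖ₑ * (‖ftx (fun y => φ₁ y * u w.1.1 y) w.2.2.1 w.1.2‖ₑ *
          ‖ftx (fun y => φ₂ y * u w.1.1 y) w.2.2.2 w.1.2‖ₑ)) ∂((ρ.prod volume).prod volume) := by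
        refine lintegral_mono fun w => ?_
        rw [fullIntegrand, enorm_mul, enorm_mul, enorm_mul, enorm_mul, RCLike.enorm_conj,
          ← ofReal_norm (𝐞 (-(w.2.1 * τ w.1.1)) : ℂ), Circle.norm_coe, ENNReal.ofReal_one, one_mul,
          mul_assoc]
        gcongr
        rw [← ofReal_norm]; exact ENNReal.ofReal_le_ofReal (norm_radialSymbol_le hB0 hB _)
    _ = ENNReal.ofReal B * ∫⁻ w : (α × E d) × (ℝ × (E m × E m)), (‖φ w.2.1‖ₑ * (‖ftx (fun y => φ₁ y * u w.1.1 y) w.2.2.1 w.1.2‖ₑ *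
          ‖ftx (fun y => φ₂ y * u w.1.1 y) w.2.2.2 w.1.2‖ₑ)) ∂((ρ.prod volume).prod volume) :=
        lintegral_const_mul' _ _ ENNReal.ofReal_ne_top
    _ = ENNReal.ofReal B * ∫⁻ w, (∫⁻ x, ‖φ x‖ₑ) * (a w * b w) ∂(ρ.prod volume) := by
        congr 1
        have e3 : Measurable fun w : (α × E d) × (ℝ × (E m × E m)) =>
            ‖ftx (fun y => φ₁ y * u w.1.1 y) w.2.2.1 w.1.2‖ₑ *
              ‖ftx (fun y => φ₂ y * u w.1.1 y) w.2.2.2 w.1.2‖ₑ :=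
          ((hmf h1m).comp (measurable_fst.prodMk measurable_snd.snd.fst)).enorm.mul
            ((hmf h2m).comp (measurable_fst.prodMk measurable_snd.snd.snd)).enorm
        refine (lintegral_prod _ (hφc.enorm.mul e3.aemeasurable)).trans (lintegral_congr fun w => ?_)
        have h1w : Measurable fun p => ‖ftx (fun y => φ₁ y * u w.1 y) p w.2‖ₑ :=
          ((hmf h1m).comp (measurable_prodMk_left (x := w))).enorm
        have h2w : Measurable fun p => ‖ftx (fun y => φ₂ y * u w.1 y) p w.2‖ₑ :=
          ((hmf h2m).comp (measurable_prodMk_left (x := w))).enorm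
        have h12 : Measurable fun z : E m × E m => ‖ftx (fun y => φ₁ y * u w.1 y) z.1 w.2‖ₑ *
            ‖ftx (fun y => φ₂ y * u w.1 y) z.2 w.2‖ₑ :=
          (h1w.comp measurable_fst).mul (h2w.comp measurable_snd)
        have e5 := lintegral_prod_mul (μ := (volume : Measure ℝ)) (ν := (volume : Measure (E m × E m)))
          hφ.1.enorm h12.aemeasurable
        have e6 := lintegral_prod_mul (μ := (volume : Measure (E m))) (ν := (volume : Measure (E m)))
          h1w.aemeasurable h2w.aemeasurable
        exact e5.trans (congrArg _ e6)
    _ = ENNReal.ofReal B * ((∫⁻ x, ‖φ x‖ₑ) * ∫⁻ w, a w * b w ∂(ρ.prod volume)) := by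
        rw [lintegral_const_mul' _ _ hφfin.ne]
    _ < ∞ := ENNReal.mul_lt_top ENNReal.ofReal_lt_top (ENNReal.mul_lt_top hφfin hab)

theorem integral_fullIntegrand {u : α → E d × E m → ℂ} (hu : Measurable (Function.uncurry u))
    (hv : ∀ s, IsTameFun K C (u s)) (hKm : MeasurableSet K) (hK : volume K ≠ ∞)
    {τ : α → ℝ} (hτ : Measurable τ) {φ : ℝ → ℂ} (hφ : Integrable φ) {ψ : S d → ℂ}
    (hψ : Continuous ψ) {φ₁ φ₂ : E d × E m → ℂ} (h1m : Measurable φ₁) (h2m : Measurable φ₂)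
    (h1 : MemLp φ₁ 2 (lam K m n)) (h2 : MemLp φ₂ 2 (lam K m n))
    (h1s : ∀ y, (n : ℝ) ≤ ‖y.2‖ → φ₁ y = 0) (h2s : ∀ y, (n : ℝ) ≤ ‖y.2‖ → φ₂ y = 0) :
    ∫ w, fullIntegrand τ φ ψ u φ₁ φ₂ w ∂((ρ.prod volume).prod volume) =
      amplitude ρ τ K n φ ψ u φ₁ φ₂ := by
  rw [integral_prod _ (integrable_fullIntegrand hu hv hKm hK hτ hφ hψ h1m h2m h1 h2 h1s h2s), amplitude]
  refine integral_congr_ae (Eventually.of_forall fun w => ?_)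
  dsimp only
  rw [← integral_ftx (hv w.1) hKm hK h1 h1s, ← integral_ftx (hv w.1) hKm hK h2 h2s, ← integral_conj,
    symMul]
  have e6 := integral_prod_mul (μ := (volume : Measure (E m))) (ν := (volume : Measure (E m)))
    (fun p => ftx (fun y => φ₁ y * u w.1 y) p w.2)
    (fun p => conj (ftx (fun y => φ₂ y * u w.1 y) p w.2))
  have e5 := integral_prod_mul (μ := (volume : Measure ℝ)) (ν := (volume : Measure (E m × E m)))
    (fun ξ₀ : ℝ => (𝐞 (-(ξ₀ * τ w.1)) : ℂ) * (radialSymbol ψ (joinFreq ξ₀ w.2) * φ ξ₀))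
    (fun z => ftx (fun y => φ₁ y * u w.1 y) z.1 w.2 * conj (ftx (fun y => φ₂ y * u w.1 y) z.2 w.2))
  exact e5.trans (congrArg _ e6)

end Fubini

/-! ### Expectations as amplitudes. -/

section Expectation

variable {Ω : Type*} [MeasurableSpace Ω] {P : Measure Ω} [IsProbabilityMeasure P] {d m : ℕ} {T : ℝ}

/-- A random real function as a family of complex functions of `(x, p)`. -/
def toFamily (v : Ω → ℝ → E d → E m → ℝ) (s : Ω × ℝ) (y : E d × E m) : ℂ := (v s.1 s.2 y.1 y.2 : ℂ)

/-- The law of the parameters `(ω, t)`. -/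
noncomputable def paramMeasure (P : Measure Ω) (T : ℝ) : Measure (Ω × ℝ) :=
  P.prod (volume.restrict (Ioo 0 T))

instance : IsFiniteMeasure (paramMeasure P T) := by
  rw [paramMeasure]; infer_instance

omit [MeasurableSpace Ω] in
theorem integrand_eq_integral (v : Ω → ℝ → E d → E m → ℝ) (φ : ℝ → ℂ) (φ₁ φ₂ : E d × E m → ℂ)
    (ψ : S d → ℂ) {τ : Ω × ℝ → ℝ} (hτ : ∀ s, s.2 ∈ Ioo 0 T → τ s = s.2)
    (w : Ω × (ℝ × E d) × E m × E m) :
    integrand T (v w.1) φ φ₁ φ₂ ψ w.2.1.1 w.2.1.2 w.2.2.1 w.2.2.2 =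
      ∫ t in Ioo 0 T, fullIntegrand τ φ ψ (toFamily v) φ₁ φ₂ (((w.1, t), w.2.1.2), (w.2.1.1, w.2.2)) := by
  rw [integrand, Real.fourier_real_eq, ← integral_const_mul, ← integral_indicator measurableSet_Ioo]
  refine integral_congr_ae (Eventually.of_forall fun t => ?_)
  by_cases ht : t ∈ Ioo 0 T
  · simp only [indicator_of_mem ht, fullIntegrand, hτ (w.1, t) ht]
    rw [ftx, ftx, Circle.smul_def, smul_eq_mul, mul_comm t]
    simp only [toFamily]
    ring
  · simp [indicator_of_notMem ht]

/-- The integrand is the integral in `t` of `fullIntegrand`, so both claims follow from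
integrability of the latter and Fubini in the two orders. -/
theorem integrable_integrand_and_expectation_eq {K : Set (E d)} {C : ℝ} {n : ℕ}
    (hKm : MeasurableSet K) (hK : volume K ≠ ∞) {v : Ω → ℝ → E d → E m → ℝ}
    (hv : Measurable (Function.uncurry (toFamily v)))
    (hvt : ∀ s, IsTameFun K C (toFamily v s)) {τ : Ω × ℝ → ℝ} (hτm : Measurable τ)
    (hτ : ∀ s, s.2 ∈ Ioo 0 T → τ s = s.2) {φ : ℝ → ℂ} (hφ : Integrable φ) {ψ : S d → ℂ}
    (hψ : Continuous ψ) {φ₁ φ₂ : E d × E m → ℂ} (h1m : Measurable φ₁) (h2m : Measurable φ₂)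
    (h1 : MemLp φ₁ 2 (lam K m n)) (h2 : MemLp φ₂ 2 (lam K m n))
    (h1s : ∀ y, (n : ℝ) ≤ ‖y.2‖ → φ₁ y = 0) (h2s : ∀ y, (n : ℝ) ≤ ‖y.2‖ → φ₂ y = 0) :
    Integrable (fun w : Ω × (ℝ × E d) × E m × E m =>
      integrand T (v w.1) φ φ₁ φ₂ ψ w.2.1.1 w.2.1.2 w.2.2.1 w.2.2.2) (P.prod volume) ∧
    expectation P T v φ φ₁ φ₂ ψ = amplitude (paramMeasure P T) τ K n φ ψ (toFamily v) φ₁ φ₂ := by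
  have hmp := measurePreserving_rearrange P (volume : Measure ℝ) (volume : Measure (E d))
    (volume : Measure (E m × E m)) (volume.restrict (Ioo 0 T))
  have hi : Integrable (fullIntegrand τ φ ψ (toFamily v) φ₁ φ₂)
      (((P.prod (volume.restrict (Ioo 0 T))).prod (volume : Measure (E d))).prod
        ((volume : Measure ℝ).prod (volume : Measure (E m × E m)))) :=
    integrable_fullIntegrand (ρ := paramMeasure P T) hv hvt hKm hK hτm hφ hψ h1m h2m h1 h2 h1s h2s
  have hi2 := hmp.integrable_comp_of_integrable hi
  have e := integral_fullIntegrand (ρ := paramMeasure P T) hv hvt hKm hK hτm hφ hψ h1m h2m h1 h2 h1s h2s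
  have heq : ∀ w : Ω × (ℝ × E d) × E m × E m,
      integrand T (v w.1) φ φ₁ φ₂ ψ w.2.1.1 w.2.1.2 w.2.2.1 w.2.2.2 = _ :=
    integrand_eq_integral v φ φ₁ φ₂ ψ hτ
  have hi3 : Integrable (fun w : Ω × (ℝ × E d) × E m × E m =>
      integrand T (v w.1) φ φ₁ φ₂ ψ w.2.1.1 w.2.1.2 w.2.2.1 w.2.2.2) (P.prod volume) :=
    hi2.integral_prod_left.congr (Eventually.of_forall fun w => (heq w).symm)
  refine ⟨hi3, ?_⟩
  rw [expectation, ← e]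
  refine (integral_prod _ hi3).symm.trans ?_
  simp_rw [heq]
  refine (integral_prod _ hi2).symm.trans ?_
  have hmap := integral_map hmp.measurable.aemeasurable (f := fullIntegrand τ φ ψ (toFamily v) φ₁ φ₂)
    (by rw [hmp.map_eq]; exact hi.1)
  rw [hmp.map_eq] at hmap
  exact hmap.symm

theorem ae_slice_of_ae {p : Ω × ℝ × E d × E m → Prop}
    (hp : ∀ᵐ w ∂(P.prod ((volume.restrict (Ioo 0 T)).prod (volume : Measure (E d × E m)))), p w) :
    ∀ᵐ z ∂(P.prod (volume : Measure (E m))), ∀ᵐ t ∂(volume.restrict (Ioo 0 T)), ∀ᵐ x : E d,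
      p (z.1, t, x, z.2) := by
  have h1 := ((MeasurePreserving.id P).prod
    ((measurePreserving_prodAssoc (volume.restrict (Ioo 0 T)) (volume : Measure (E d))
      (volume : Measure (E m))).comp (Measure.measurePreserving_swap (μ := (volume : Measure (E m)))
        (ν := (volume.restrict (Ioo 0 T)).prod (volume : Measure (E d)))))).comp
    (measurePreserving_prodAssoc P (volume : Measure (E m))
      ((volume.restrict (Ioo 0 T)).prod (volume : Measure (E d))))
  have h2 := h1.quasiMeasurePreserving.ae hp
  filter_upwards [Measure.ae_ae_of_ae_prod h2] with z hz
  exact Measure.ae_ae_of_ae_prod hz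

/-- The integrand depends on the products `φ₁ v` and `φ₂ v` only up to null sets. -/
theorem integrand_congr {v v' : Ω → ℝ → E d → E m → ℝ} {φ₁ φ₁' φ₂ φ₂' : E d × E m → ℂ}
    (h1 : ∀ᵐ w ∂(P.prod ((volume.restrict (Ioo 0 T)).prod (volume : Measure (E d × E m)))),
      φ₁ w.2.2 * (v w.1 w.2.1 w.2.2.1 w.2.2.2 : ℂ) = φ₁' w.2.2 * (v' w.1 w.2.1 w.2.2.1 w.2.2.2 : ℂ))
    (h2 : ∀ᵐ w ∂(P.prod ((volume.restrict (Ioo 0 T)).prod (volume : Measure (E d × E m)))),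
      φ₂ w.2.2 * (v w.1 w.2.1 w.2.2.1 w.2.2.2 : ℂ) = φ₂' w.2.2 * (v' w.1 w.2.1 w.2.2.1 w.2.2.2 : ℂ))
    (φ : ℝ → ℂ) (ψ : S d → ℂ) :
    ∀ᵐ w : Ω × (ℝ × E d) × E m × E m ∂(P.prod volume),
      integrand T (v w.1) φ φ₁ φ₂ ψ w.2.1.1 w.2.1.2 w.2.2.1 w.2.2.2 =
        integrand T (v' w.1) φ φ₁' φ₂' ψ w.2.1.1 w.2.1.2 w.2.2.1 w.2.2.2 := by
  have q0 : Measure.QuasiMeasurePreserving (Prod.snd : (ℝ × E d) × E m × E m → E m × E m)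
      volume volume := Measure.quasiMeasurePreserving_snd
  have q1 : Measure.QuasiMeasurePreserving (fun w : Ω × (ℝ × E d) × E m × E m => (w.1, w.2.2.1))
      (P.prod volume) (P.prod volume) :=
    QuasiMeasurePreserving.prodMap (Measure.QuasiMeasurePreserving.id P) (Measure.quasiMeasurePreserving_fst.comp q0)
  have q2 : Measure.QuasiMeasurePreserving (fun w : Ω × (ℝ × E d) × E m × E m => (w.1, w.2.2.2))
      (P.prod volume) (P.prod volume) :=
    QuasiMeasurePreserving.prodMap (Measure.QuasiMeasurePreserving.id P) (Measure.quasiMeasurePreserving_snd.comp q0)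
  filter_upwards [q1.ae (ae_slice_of_ae h1), q2.ae (ae_slice_of_ae h2)] with w hw1 hw2
  rw [integrand, integrand, Real.fourier_real_eq, Real.fourier_real_eq]
  congr 1
  rw [ae_restrict_iff' measurableSet_Ioo] at hw1 hw2
  refine integral_congr_ae ?_
  filter_upwards [hw1, hw2] with t ht1 ht2
  by_cases ht : t ∈ Ioo 0 T
  · simp only [indicator_of_mem ht]
    have e1 : 𝓕 (fun x : E d => φ₁ (x, w.2.2.1) * (v w.1 t x w.2.2.1 : ℂ)) w.2.1.2 =
        𝓕 (fun x : E d => φ₁' (x, w.2.2.1) * (v' w.1 t x w.2.2.1 : ℂ)) w.2.1.2 := by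
      rw [Real.fourier_eq, Real.fourier_eq]
      refine integral_congr_ae ?_
      filter_upwards [ht1 ht] with x hx
      rw [hx]
    have e2 : 𝓕 (fun x : E d => φ₂ (x, w.2.2.2) * (v w.1 t x w.2.2.2 : ℂ)) w.2.1.2 =
        𝓕 (fun x : E d => φ₂' (x, w.2.2.2) * (v' w.1 t x w.2.2.2 : ℂ)) w.2.1.2 := by
      rw [Real.fourier_eq, Real.fourier_eq]
      refine integral_congr_ae ?_
      filter_upwards [ht2 ht] with x hx
      rw [hx]
    rw [e1, e2]
  · simp [indicator_of_notMem ht]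

omit [IsProbabilityMeasure P] in
theorem expectation_congr {v v' : Ω → ℝ → E d → E m → ℝ} {φ₁ φ₁' φ₂ φ₂' : E d × E m → ℂ}
    {φ : ℝ → ℂ} {ψ : S d → ℂ}
    (h : ∀ᵐ w : Ω × (ℝ × E d) × E m × E m ∂(P.prod volume),
      integrand T (v w.1) φ φ₁ φ₂ ψ w.2.1.1 w.2.1.2 w.2.2.1 w.2.2.2 =
        integrand T (v' w.1) φ φ₁' φ₂' ψ w.2.1.1 w.2.1.2 w.2.2.1 w.2.2.2) :
    expectation P T v φ φ₁ φ₂ ψ = expectation P T v' φ φ₁' φ₂' ψ := by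
  refine integral_congr_ae ?_
  filter_upwards [Measure.ae_ae_of_ae_prod h] with ω hω
  exact integral_congr_ae hω

end Expectation

/-! ### The functional defined by a density. -/

section Functional

variable {d m : ℕ} {ν : Kernel (E d) (S d)} {f : E m × E m → E d × S d → ℂ}

/-- Evaluation of a `C₀` function at a point is jointly continuous. -/
theorem measurable_eval (Φ : TestSpace d m) :
    StronglyMeasurable fun w : (E m × E m) × (E d × S d) => Φ w.1 w.2 := by
  have hc : Continuous fun w : C₀(E d × S d, ℂ) × (E d × S d) => w.1 w.2 := by
    have h1 : Continuous fun w : C₀(E d × S d, ℂ) × (E d × S d) => (w.1.toBCF, w.2) :=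
      ((ZeroAtInftyContinuousMap.isometry_toBCF).continuous.comp continuous_fst).prodMk continuous_snd
    exact (continuous_eval (F := BoundedContinuousFunction (E d × S d) ℂ)).comp h1
  exact hc.comp_stronglyMeasurable (((Lp.stronglyMeasurable Φ).comp_measurable measurable_fst).prodMk
    measurable_snd.stronglyMeasurable)

theorem enorm_eval_le (Φ : C₀(E d × S d, ℂ)) (y : E d × S d) : ‖Φ y‖ₑ ≤ ‖Φ‖ₑ := by
  have h := (Φ.toBCF).norm_coe_le_norm y
  rw [← ofReal_norm, ← ofReal_norm]
  exact ENNReal.ofReal_le_ofReal h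

/-- The sup norm in `(x, ξ)` is paired with the `L¹` norm of the density, then Cauchy–Schwarz in
`(p, q)`. This gives absolute convergence and continuity at once. -/
theorem IsDensity.lintegral_le [IsSFiniteKernel ν] (hf : IsDensity ν f) (Φ : TestSpace d m) :
    ∫⁻ w, ‖Φ w.1 w.2 * f w.1 w.2‖ₑ ∂((volume : Measure (E m × E m)).prod (total ν)) ≤
      ‖Φ‖ₑ * (∫⁻ z, (∫⁻ y, ‖f z y‖ₑ ∂(total ν)) ^ 2) ^ (1 / 2 : ℝ) := by
  have : SFinite (total ν) := by rw [total]; infer_instance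
  have hm : Measurable fun w : (E m × E m) × (E d × S d) => Φ w.1 w.2 * f w.1 w.2 :=
    (measurable_eval Φ).measurable.mul hf.measurable
  have hm2 : Measurable fun w : (E m × E m) × (E d × S d) => ‖f w.1 w.2‖ₑ := hf.measurable.enorm
  rw [lintegral_prod _ hm.enorm.aemeasurable]
  have hA : ∫⁻ z, ‖Φ z‖ₑ ^ 2 ≤ ‖Φ‖ₑ ^ 2 := by
    have h := eLpNorm_nnreal_pow_eq_lintegral (μ := (volume : Measure (E m × E m))) (f := Φ)
      (p := 2) two_ne_zero
    rw [Lp.enorm_def]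
    have h2 : ((2 : NNReal) : ℝ) = (2 : ℕ) := by norm_num
    simp only [h2, ENNReal.rpow_natCast] at h
    exact h.ge
  calc _ ≤ ∫⁻ z, ‖Φ z‖ₑ * ∫⁻ y, ‖f z y‖ₑ ∂(total ν) := by
        refine lintegral_mono fun z => ?_
        rw [← lintegral_const_mul' _ _ enorm_ne_top]
        refine lintegral_mono fun y => ?_
        simp only [enorm_mul]
        gcongr
        exact enorm_eval_le _ _
    _ ≤ (‖Φ‖ₑ ^ 2 * ∫⁻ z, (∫⁻ y, ‖f z y‖ₑ ∂(total ν)) ^ 2) ^ (1 / 2 : ℝ) :=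
        lintegral_mul_le_sqrt (Lp.stronglyMeasurable Φ).enorm.aemeasurable
          hm2.lintegral_prod_right'.aemeasurable hA le_rfl
    _ = _ := by
        rw [ENNReal.mul_rpow_of_nonneg _ _ (by norm_num), ← ENNReal.rpow_natCast,
          ← ENNReal.rpow_mul]
        norm_num

theorem IsDensity.integrable [IsSFiniteKernel ν] (hf : IsDensity ν f) (Φ : TestSpace d m) :
    Integrable (fun w : (E m × E m) × (E d × S d) => Φ w.1 w.2 * f w.1 w.2)
      ((volume : Measure (E m × E m)).prod (total ν)) := by
  have hm : Measurable fun w : (E m × E m) × (E d × S d) => Φ w.1 w.2 * f w.1 w.2 :=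
    (measurable_eval Φ).measurable.mul hf.measurable
  exact ⟨hm.aestronglyMeasurable, (hf.lintegral_le Φ).trans_lt (ENNReal.mul_lt_top enorm_lt_top
    (ENNReal.rpow_lt_top_of_nonneg (by norm_num) hf.finite.ne))⟩

theorem IsDensity.exists_isRepresentedBy [IsSFiniteKernel ν] (hf : IsDensity ν f) :
    ∃ M : TestSpace d m →L[ℂ] ℂ, IsRepresentedBy M f ν := by
  have : SFinite (total ν) := by rw [total]; infer_instance
  set B := (∫⁻ z, (∫⁻ y, ‖f z y‖ₑ ∂(total ν)) ^ 2) ^ (1 / 2 : ℝ) with hB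
  have hBt : B ≠ ∞ := ENNReal.rpow_ne_top_of_nonneg (by norm_num) hf.finite.ne
  have q : Measure.QuasiMeasurePreserving (Prod.fst : (E m × E m) × (E d × S d) → E m × E m)
      ((volume : Measure (E m × E m)).prod (total ν)) volume := Measure.quasiMeasurePreserving_fst
  let M₀ : TestSpace d m →ₗ[ℂ] ℂ :=
    { toFun := fun Φ => ∫ w, Φ w.1 w.2 * f w.1 w.2 ∂((volume : Measure (E m × E m)).prod (total ν))
      map_add' := fun Φ Ψ => by
        rw [← integral_add (hf.integrable Φ) (hf.integrable Ψ)]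
        refine integral_congr_ae ?_
        filter_upwards [q.ae (Lp.coeFn_add Φ Ψ)] with w hw
        rw [hw, Pi.add_apply, ZeroAtInftyContinuousMap.add_apply, add_mul]
      map_smul' := fun c Φ => by
        rw [RingHom.id_apply, smul_eq_mul, ← integral_const_mul]
        refine integral_congr_ae ?_
        filter_upwards [q.ae (Lp.coeFn_smul c Φ)] with w hw
        rw [hw, Pi.smul_apply, ZeroAtInftyContinuousMap.smul_apply, smul_eq_mul, mul_assoc] }
  have hM₀ : ∀ Φ, ‖M₀ Φ‖ ≤ B.toReal * ‖Φ‖ := fun Φ => by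
    have h1 := (enorm_integral_le_lintegral_enorm _).trans (hf.lintegral_le Φ)
    have h2 := ENNReal.toReal_mono (ENNReal.mul_ne_top enorm_ne_top hBt) h1
    rw [ENNReal.toReal_mul, toReal_enorm, toReal_enorm, mul_comm] at h2
    exact h2
  refine ⟨M₀.mkContinuous _ hM₀, fun Φ => ⟨hf.integrable Φ, ?_⟩⟩
  exact integral_prod _ (hf.integrable Φ)

end Functional

/-! ### Conditional means along the fibres. -/

section Fiber

variable {α Y Z : Type*} [MeasurableSpace α] [MeasurableSpace Y] [MeasurableSpace Z]
  [StandardBorelSpace Z] [Nonempty Z] (N : Measure (Y × Z)) [IsFiniteMeasure N]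

/-- The conditional mean of a function given the first coordinate. -/
noncomputable def fiberMean (H : α → Y × Z → ℂ) (a : α) (y : Y) : ℂ :=
  ∫ ζ, H a (y, ζ) ∂(N.condKernel y)

variable {N} {H : α → Y × Z → ℂ} (hH : Measurable (Function.uncurry H))
include hH

theorem measurable_fiberMean : Measurable (Function.uncurry (fiberMean N H)) := by
  have h1 : StronglyMeasurable fun w : (α × Y) × Z => H w.1.1 (w.1.2, w.2) := by
    refine Measurable.stronglyMeasurable ?_
    exact hH.comp (measurable_fst.fst.prodMk (measurable_fst.snd.prodMk measurable_snd))
  have h2 := h1.integral_kernel_prod_right' (κ := Kernel.prodMkLeft α N.condKernel)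
  exact h2.measurable

theorem lintegral_fiberMean_le (a : α) :
    ∫⁻ y, ‖fiberMean N H a y‖ₑ ∂N.fst ≤ ∫⁻ X, ‖H a X‖ₑ ∂N := by
  have hm : Measurable fun X => ‖H a X‖ₑ := (hH.comp measurable_prodMk_left).enorm
  conv_rhs => rw [← N.disintegrate N.condKernel, Measure.lintegral_compProd hm]
  exact lintegral_mono fun y => enorm_integral_le_lintegral_enorm _

omit [MeasurableSpace α] hH in
theorem integral_fiberMean {a : α} (hi : Integrable (H a) N) :
    ∫ y, fiberMean N H a y ∂N.fst = ∫ X, H a X ∂N := by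
  have hi2 : Integrable (H a) (N.fst ⊗ₘ N.condKernel) := by
    rwa [N.disintegrate N.condKernel]
  conv_rhs => rw [← N.disintegrate N.condKernel, Measure.integral_compProd hi2]
  rfl

theorem integrable_fiberMean {μ : Measure α} [SFinite μ]
    (hi : Integrable (Function.uncurry H) (μ.prod N)) :
    Integrable (Function.uncurry (fiberMean N H)) (μ.prod N.fst) := by
  refine ⟨(measurable_fiberMean hH).aestronglyMeasurable, ?_⟩
  have e1 := lintegral_prod (μ := μ) (ν := N.fst) (fun w => ‖Function.uncurry (fiberMean N H) w‖ₑ)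
    (measurable_fiberMean (N := N) hH).enorm.aemeasurable
  have e2 := lintegral_prod (μ := μ) (ν := N) (fun w => ‖Function.uncurry H w‖ₑ) hH.enorm.aemeasurable
  refine lt_of_le_of_lt (e1.trans_le ((lintegral_mono fun a => ?_).trans_eq e2.symm)) hi.2
  exact lintegral_fiberMean_le hH a

omit hH in
theorem integral_integral_fiberMean {μ : Measure α} [SFinite μ]
    (hi : Integrable (Function.uncurry H) (μ.prod N)) :
    ∫ a, ∫ y, fiberMean N H a y ∂N.fst ∂μ = ∫ a, ∫ X, H a X ∂N ∂μ := by
  refine integral_congr_ae ?_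
  filter_upwards [hi.prod_right_ae] with a ha
  exact integral_fiberMean ha

end Fiber

/-! ### The limit density and its pairing with tensors. -/

section Density

variable {d m : ℕ} {ι : Type} [Countable ι] {R : ℝ} {C₁ : ℝ≥0∞} {A : ℕ → ℝ≥0∞}
  {N : Measure (State d ι)} {F : State d ι × E m → ℂ} {φ : ℝ → ℂ}

/-- The density of the limit functional on the state space. -/
noncomputable def stateDensity (φ : ℝ → ℂ) (F : State d ι × E m → ℂ) (z : E m × E m)
    (X : State d ι) : ℂ :=
  𝓕 φ X.2.1 * (F (X, z.1) * conj (F (X, z.2)))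

omit [Countable ι] in
theorem measurable_stateDensity (hφ : Integrable φ) (hF : Measurable F) :
    Measurable (Function.uncurry (stateDensity φ F)) := by
  have h1 : Measurable fun w : (E m × E m) × State d ι => F (w.2, w.1.1) :=
    hF.comp (measurable_snd.prodMk measurable_fst.fst)
  have h2 : Measurable fun w : (E m × E m) × State d ι => conj (F (w.2, w.1.2)) :=
    Complex.continuous_conj.measurable.comp (hF.comp (measurable_snd.prodMk measurable_fst.snd))
  have h3 : Measurable fun w : (E m × E m) × State d ι => 𝓕 φ w.2.2.1 :=
    (continuous_fourier hφ).measurable.comp measurable_snd.snd.fst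
  exact h3.mul (h1.mul h2)

omit [Countable ι] in
theorem enorm_stateDensity_le (z : E m × E m) (X : State d ι) :
    ‖stateDensity φ F z X‖ₑ ≤ ENNReal.ofReal (∫ x, ‖φ x‖) * (‖F (X, z.1)‖ₑ * ‖F (X, z.2)‖ₑ) := by
  rw [stateDensity, enorm_mul, enorm_mul, RCLike.enorm_conj]
  gcongr
  rw [← ofReal_norm]
  exact ENNReal.ofReal_le_ofReal (norm_fourier_le _ _)

/-- Conditional means contract `L¹`. Cauchy–Schwarz over the states at fixed `(p, q)` then separates
`p` from `q`, and the square integral is at most a constant times the fourth power of the `L²` norm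
of `F`. -/
theorem IsProfile.isDensity [IsFiniteMeasure N] {ν : Kernel (E d) (S d)} (hP : IsProfile R C₁ A N F)
    (hφ : Integrable φ) (hν : total ν = N.fst) : IsDensity ν (fiberMean N (stateDensity φ F)) := by
  have hFm := measurable_stateDensity hφ hP.meas
  have hsl : ∀ p, Measurable fun X => ‖F (X, p)‖ₑ := fun p =>
    (hP.meas.comp measurable_prodMk_right).enorm
  have ham : Measurable fun p => ∫⁻ X, ‖F (X, p)‖ₑ ^ 2 ∂N :=
    (hP.meas.enorm.pow_const 2).lintegral_prod_left'
  refine ⟨measurable_fiberMean hFm, ?_⟩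
  rw [hν]
  set b := ENNReal.ofReal (∫ x, ‖φ x‖)
  have hfin : ∫⁻ p, ∫⁻ X, ‖F (X, p)‖ₑ ^ 2 ∂N < ∞ := by
    have h := (memLp_two_iff hP.memLp.1).1 hP.memLp
    rwa [lintegral_prod_symm _ (hP.meas.enorm.pow_const 2).aemeasurable] at h
  calc ∫⁻ z, (∫⁻ y, ‖fiberMean N (stateDensity φ F) z y‖ₑ ∂N.fst) ^ 2
      ≤ ∫⁻ z : E m × E m, b ^ 2 * ((∫⁻ X, ‖F (X, z.1)‖ₑ ^ 2 ∂N) * ∫⁻ X, ‖F (X, z.2)‖ₑ ^ 2 ∂N) := by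
        refine lintegral_mono fun z => ?_
        have h1 : ∫⁻ y, ‖fiberMean N (stateDensity φ F) z y‖ₑ ∂N.fst ≤
            b * ∫⁻ X, ‖F (X, z.1)‖ₑ * ‖F (X, z.2)‖ₑ ∂N := by
          refine (lintegral_fiberMean_le hFm z).trans ?_
          rw [← lintegral_const_mul' _ _ ENNReal.ofReal_ne_top]
          exact lintegral_mono fun X => enorm_stateDensity_le z X
        refine (pow_le_pow_left' h1 2).trans ?_
        rw [mul_pow]
        gcongr
        exact sq_lintegral_mul_le (hsl _).aemeasurable (hsl _).aemeasurable
    _ = b ^ 2 * ((∫⁻ p, ∫⁻ X, ‖F (X, p)‖ₑ ^ 2 ∂N) * ∫⁻ p, ∫⁻ X, ‖F (X, p)‖ₑ ^ 2 ∂N) := by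
        rw [lintegral_const_mul' _ _ (by finiteness)]
        congr 1
        exact lintegral_prod_mul ham.aemeasurable ham.aemeasurable
    _ < ∞ := by finiteness

omit [Countable ι] in
theorem setLIntegral_ball_eq {n : ℕ} {g : E m → ℝ≥0∞} (hg : ∀ p, (n : ℝ) ≤ ‖p‖ → g p = 0) :
    ∫⁻ p in {p : E m | ‖p‖ < n}, g p = ∫⁻ p, g p := by
  rw [← lintegral_indicator (measurableSet_normBall m n)]
  refine lintegral_congr fun p => ?_
  by_cases hp : ‖p‖ < n
  · exact indicator_of_mem (show p ∈ {p : E m | ‖p‖ < n} from hp) _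
  · rw [indicator_of_notMem (show p ∉ {p : E m | ‖p‖ < n} from hp), hg p (not_lt.1 hp)]

omit [Countable ι] in
theorem pair_eq_integral {n : ℕ} {g : E d × E m → ℂ} (hg : ∀ y, (n : ℝ) ≤ ‖y.2‖ → g y = 0)
    (X : State d ι) : pair n F g X = ∫ p, g (X.1.1, p) * F (X, p) := by
  rw [pair, setIntegral_eq_integral_of_forall_compl_eq_zero]
  intro p hp
  rw [hg (X.1.1, p) (not_lt.1 hp), zero_mul]

variable {n : ℕ} {ψ : S d → ℂ} {φ₁ φ₂ : E d × E m → ℂ}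

omit [Countable ι] in
theorem measurable_tensor_mul (hF : Measurable F) (hφ : Integrable φ) (hψ : Continuous ψ)
    (h1m : Measurable φ₁) (h2m : Measurable φ₂) :
    Measurable (Function.uncurry fun (z : E m × E m) (X : State d ι) =>
      tensor φ₁ φ₂ ψ z X.1 * stateDensity φ F z X) := by
  refine Measurable.mul ?_ (measurable_stateDensity hφ hF)
  have e1 : Measurable fun w : (E m × E m) × State d ι => φ₁ (w.2.1.1, w.1.1) :=
    h1m.comp (measurable_snd.fst.fst.prodMk measurable_fst.fst)
  have e2 : Measurable fun w : (E m × E m) × State d ι => conj (φ₂ (w.2.1.1, w.1.2)) :=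
    Complex.continuous_conj.measurable.comp
      (h2m.comp (measurable_snd.fst.fst.prodMk measurable_fst.snd))
  have e3 : Measurable fun w : (E m × E m) × State d ι => ψ w.2.1.2 :=
    hψ.measurable.comp measurable_snd.fst.snd
  exact (e1.mul e2).mul e3

omit [Countable ι] in
-- A tensor need not lie in `TestSpace`, so `IsDensity` does not suffice. At a fixed state the
-- integral over `(p, q)` factors, and the bound of `F` on balls controls each factor in `L²(N)`.
theorem IsProfile.integrable_tensor_mul (hP : IsProfile R C₁ A N F) (hφ : Integrable φ)
    (hψ : Continuous ψ) (h1m : Measurable φ₁) (h2m : Measurable φ₂)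
    (h1 : MemLp φ₁ 2 (lam (cube d R) m n)) (h2 : MemLp φ₂ 2 (lam (cube d R) m n))
    (h1s : ∀ y, (n : ℝ) ≤ ‖y.2‖ → φ₁ y = 0) (h2s : ∀ y, (n : ℝ) ≤ ‖y.2‖ → φ₂ y = 0) :
    Integrable (Function.uncurry fun (z : E m × E m) (X : State d ι) =>
      tensor φ₁ φ₂ ψ z X.1 * stateDensity φ F z X) (volume.prod N) := by
  have hfin := hP.finite
  obtain ⟨B, hB0, hB⟩ := exists_bound_sphere hψ
  have hm := measurable_tensor_mul (φ₁ := φ₁) (φ₂ := φ₂) (ψ := ψ) hP.meas hφ hψ h1m h2m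
  have hg : ∀ {g : E d × E m → ℂ}, Measurable g →
      Measurable fun w : State d ι × E m => ‖g (w.1.1.1, w.2)‖ₑ * ‖F w‖ₑ := fun hg =>
    (hg.comp (measurable_fst.fst.fst.prodMk measurable_snd)).enorm.mul hP.meas.enorm
  have hG : ∀ {g : E d × E m → ℂ}, Measurable g → MemLp g 2 (lam (cube d R) m n) →
      (∀ y, (n : ℝ) ≤ ‖y.2‖ → g y = 0) →
      ∫⁻ X, (∫⁻ p, ‖g (X.1.1, p)‖ₑ * ‖F (X, p)‖ₑ) ^ 2 ∂N < ∞ := by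
    intro g hgm hg2 hgs
    have h := hP.lintegral_sq_lintegral_le n hgm
    have e : ∀ X : State d ι, ∫⁻ p in {p : E m | ‖p‖ < n}, ‖g (X.1.1, p)‖ₑ * ‖F (X, p)‖ₑ =
        ∫⁻ p, ‖g (X.1.1, p)‖ₑ * ‖F (X, p)‖ₑ := fun X =>
      setLIntegral_ball_eq fun p hp => by rw [hgs (X.1.1, p) hp, enorm_zero, zero_mul]
    simp_rw [e] at h
    exact h.trans_lt (ENNReal.mul_lt_top (ENNReal.mul_lt_top hP.const_ne_top.lt_top
      (hP.bound_ne_top n).lt_top) ((memLp_two_iff hg2.1).1 hg2))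
  refine ⟨hm.aestronglyMeasurable, ?_⟩
  have e := lintegral_prod_symm (μ := (volume : Measure (E m × E m))) (ν := N) _ hm.enorm.aemeasurable
  refine e.trans_lt ?_
  set b := ENNReal.ofReal (∫ x, ‖φ x‖)
  have hle : ∀ X : State d ι, ∫⁻ z : E m × E m, ‖tensor φ₁ φ₂ ψ z X.1 * stateDensity φ F z X‖ₑ ≤
      (ENNReal.ofReal B * b) * ((∫⁻ p, ‖φ₁ (X.1.1, p)‖ₑ * ‖F (X, p)‖ₑ) *
        ∫⁻ p, ‖φ₂ (X.1.1, p)‖ₑ * ‖F (X, p)‖ₑ) := by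
    intro X
    have hX : ∀ {g : E d × E m → ℂ}, Measurable g →
        AEMeasurable fun p => ‖g (X.1.1, p)‖ₑ * ‖F (X, p)‖ₑ := fun hgm =>
      ((hg hgm).comp (measurable_prodMk_left (x := X))).aemeasurable
    rw [← lintegral_prod_mul (hX h1m) (hX h2m),
      ← lintegral_const_mul' _ _ (ENNReal.mul_ne_top ENNReal.ofReal_ne_top ENNReal.ofReal_ne_top)]
    refine lintegral_mono fun z => ?_
    rw [tensor, enorm_mul, enorm_mul, enorm_mul, RCLike.enorm_conj]
    have hψB : ‖ψ X.1.2‖ₑ ≤ ENNReal.ofReal B := by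
      rw [← ofReal_norm]; exact ENNReal.ofReal_le_ofReal (hB _)
    calc _ ≤ ‖φ₁ (X.1.1, z.1)‖ₑ * ‖φ₂ (X.1.1, z.2)‖ₑ * ENNReal.ofReal B *
          (b * (‖F (X, z.1)‖ₑ * ‖F (X, z.2)‖ₑ)) := by
          gcongr
          exact enorm_stateDensity_le z X
      _ = _ := by ring
  refine (lintegral_mono hle).trans_lt ?_
  rw [lintegral_const_mul' _ _ (ENNReal.mul_ne_top ENNReal.ofReal_ne_top ENNReal.ofReal_ne_top)]
  refine ENNReal.mul_lt_top (ENNReal.mul_lt_top ENNReal.ofReal_lt_top ENNReal.ofReal_lt_top) ?_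
  refine (lintegral_mul_le_sqrt (hg h1m).lintegral_prod_right'.aemeasurable
    (hg h2m).lintegral_prod_right'.aemeasurable le_rfl le_rfl).trans_lt ?_
  exact ENNReal.rpow_lt_top_of_nonneg (by norm_num)
    (ENNReal.mul_lt_top (hG h1m h1 h1s) (hG h2m h2 h2s)).ne

omit [Countable ι] in
theorem IsProfile.integral_tensor_mul (hP : IsProfile R C₁ A N F) (hφ : Integrable φ)
    (hψ : Continuous ψ) (h1m : Measurable φ₁) (h2m : Measurable φ₂)
    (h1 : MemLp φ₁ 2 (lam (cube d R) m n)) (h2 : MemLp φ₂ 2 (lam (cube d R) m n))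
    (h1s : ∀ y, (n : ℝ) ≤ ‖y.2‖ → φ₁ y = 0) (h2s : ∀ y, (n : ℝ) ≤ ‖y.2‖ → φ₂ y = 0) :
    ∫ z : E m × E m, ∫ X, tensor φ₁ φ₂ ψ z X.1 * stateDensity φ F z X ∂N =
      limitForm N n F φ ψ φ₁ φ₂ := by
  have hfin := hP.finite
  have hi := hP.integrable_tensor_mul hφ hψ h1m h2m h1 h2 h1s h2s
  rw [integral_integral_swap hi, limitForm]
  refine integral_congr_ae (Eventually.of_forall fun X => ?_)
  dsimp only
  rw [pair_eq_integral h1s, pair_eq_integral h2s, ← integral_conj, ← integral_prod_mul,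
    ← integral_const_mul]
  refine integral_congr_ae (Eventually.of_forall fun z => ?_)
  simp only [tensor, stateDensity, map_mul]
  ring

/-- The density against a tensor. -/
theorem IsProfile.integrable_and_integral_eq [IsFiniteMeasure N] (hP : IsProfile R C₁ A N F)
    (hφ : Integrable φ)
    (hψ : Continuous ψ) (h1m : Measurable φ₁) (h2m : Measurable φ₂)
    (h1 : MemLp φ₁ 2 (lam (cube d R) m n)) (h2 : MemLp φ₂ 2 (lam (cube d R) m n))
    (h1s : ∀ y, (n : ℝ) ≤ ‖y.2‖ → φ₁ y = 0) (h2s : ∀ y, (n : ℝ) ≤ ‖y.2‖ → φ₂ y = 0) :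
    Integrable (fun w : (E m × E m) × (E d × S d) =>
      tensor φ₁ φ₂ ψ w.1 w.2 * fiberMean N (stateDensity φ F) w.1 w.2) (volume.prod N.fst) ∧
    ∫ z : E m × E m, ∫ y, tensor φ₁ φ₂ ψ z y * fiberMean N (stateDensity φ F) z y ∂N.fst =
      limitForm N n F φ ψ φ₁ φ₂ := by
  have hi := hP.integrable_tensor_mul hφ hψ h1m h2m h1 h2 h1s h2s
  have e : ∀ (z : E m × E m) (y : E d × S d),
      fiberMean N (fun z (X : State d ι) => tensor φ₁ φ₂ ψ z X.1 * stateDensity φ F z X) z y =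
        tensor φ₁ φ₂ ψ z y * fiberMean N (stateDensity φ F) z y := fun z y => by
    simp only [fiberMean]
    exact integral_const_mul _ _
  have hm := measurable_tensor_mul (φ₁ := φ₁) (φ₂ := φ₂) (ψ := ψ) hP.meas hφ hψ h1m h2m
  refine ⟨(integrable_fiberMean hm hi).congr (Eventually.of_forall fun w => e w.1 w.2), ?_⟩
  rw [← hP.integral_tensor_mul hφ hψ h1m h2m h1 h2 h1s h2s, ← integral_integral_fiberMean hi]
  simp_rw [e]

end Density

/-! ### Representatives which are bounded and supported everywhere, not just almost everywhere. -/

section Truncation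

variable {α : Type*} [MeasurableSpace α] {ρ : Measure α} [IsFiniteMeasure ρ] {d m : ℕ}
  {K : Set (E d)} {C : ℝ} {U : ℕ → α → E d × E m → ℝ}

/-- The points of `K × ℝᵐ` at which not all of the functions vanish almost everywhere. -/
def activeSet (ρ : Measure α) (K : Set (E d)) (U : ℕ → α → E d × E m → ℝ) : Set (E d × E m) :=
  {y | y.1 ∈ K ∧ ∃ n, ¬∀ᵐ s ∂ρ, U n s y = 0}

/-- The functions `U n`, set to zero where they are large and off the active set. -/
noncomputable def truncation (ρ : Measure α) (K : Set (E d)) (C : ℝ) (U : ℕ → α → E d × E m → ℝ)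
    (n : ℕ) (s : α) : E d × E m → ℝ :=
  (activeSet ρ K U).indicator fun y => if |U n s y| ≤ C then U n s y else 0

theorem measurableSet_activeSet (hK : MeasurableSet K)
    (hU : ∀ n, Measurable (Function.uncurry (U n))) : MeasurableSet (activeSet ρ K U) := by
  have e : activeSet ρ K U = (Prod.fst ⁻¹' K) ∩
      ⋃ n, {y | ρ ((fun s => (s, y)) ⁻¹' {w : α × (E d × E m) | Function.uncurry (U n) w ≠ 0}) ≠ 0} := by
    ext y
    simp only [activeSet, mem_ofPred_eq, mem_inter_iff, mem_iUnion, ae_iff]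
    rfl
  rw [e]
  refine (measurable_fst hK).inter (MeasurableSet.iUnion fun n => ?_)
  have h : MeasurableSet {w : α × (E d × E m) | Function.uncurry (U n) w ≠ 0} :=
    (hU n) (measurableSet_singleton 0).compl
  exact (measurable_measure_prodMk_right h) (measurableSet_singleton 0).compl

theorem measurable_truncation (hK : MeasurableSet K) (hU : ∀ n, Measurable (Function.uncurry (U n)))
    (n : ℕ) : Measurable (Function.uncurry (truncation ρ K C U n)) := by
  have e : Function.uncurry (truncation ρ K C U n) = (Prod.snd ⁻¹' activeSet ρ K U).indicator
      (fun w => if |Function.uncurry (U n) w| ≤ C then Function.uncurry (U n) w else 0) := by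
    ext w
    simp only [Function.uncurry, truncation, indicator, mem_preimage]
    rfl
  rw [e]
  refine Measurable.indicator ?_ (measurable_snd (measurableSet_activeSet hK hU))
  exact Measurable.ite (measurableSet_le (hU n).abs measurable_const) (hU n) measurable_const

theorem ae_ae_swap {p : α × (E d × E m) → Prop} (hp : ∀ᵐ w ∂(ρ.prod volume), p w) :
    ∀ᵐ y, ∀ᵐ s ∂ρ, p (s, y) :=
  Measure.ae_ae_of_ae_prod ((Measure.measurePreserving_swap (μ := (volume : Measure (E d × E m)))
    (ν := ρ)).quasiMeasurePreserving.ae hp)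

/-- Off the active set each function vanishes for almost every parameter: by definition for points
over `K`, by the support assumption elsewhere. -/
theorem ae_truncation_eq (hK : MeasurableSet K) (hU : ∀ n, Measurable (Function.uncurry (U n)))
    (hb : ∀ n, ∀ᵐ w ∂(ρ.prod volume), |U n w.1 w.2| ≤ C)
    (hs : ∀ n, ∀ᵐ w ∂(ρ.prod volume), w.2.1 ∉ K → U n w.1 w.2 = 0) (n : ℕ) :
    ∀ᵐ w ∂(ρ.prod volume), truncation ρ K C U n w.1 w.2 = U n w.1 w.2 := by
  have h1 : ∀ᵐ y : E d × E m, ∀ᵐ s ∂ρ, truncation ρ K C U n s y = U n s y := by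
    filter_upwards [ae_ae_swap (hs n), ae_ae_swap (hb n)] with y h2 h3
    by_cases hy : y ∈ activeSet ρ K U
    · filter_upwards [h3] with s h4
      rw [truncation, indicator_of_mem hy, if_pos h4]
    · have h4 : ∀ᵐ s ∂ρ, U n s y = 0 := by
        by_cases hyK : y.1 ∈ K
        · by_contra h5
          exact hy ⟨hyK, n, h5⟩
        · filter_upwards [h2] with s h5
          exact h5 hyK
      filter_upwards [h4] with s h5
      rw [truncation, indicator_of_notMem hy, h5]
  have hm : MeasurableSet {w : (E d × E m) × α | truncation ρ K C U n w.2 w.1 = U n w.2 w.1} :=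
    measurableSet_eq_fun ((measurable_truncation hK hU n).comp measurable_swap)
      ((hU n).comp measurable_swap)
  have h2 := (Measure.ae_prod_mem_iff_ae_ae_mem (μ := (volume : Measure (E d × E m))) (ν := ρ) hm).2 h1
  exact (Measure.measurePreserving_swap (μ := ρ)
    (ν := (volume : Measure (E d × E m)))).quasiMeasurePreserving.ae h2

/-- At an active point some `U n` is nonzero for a set of parameters of positive measure, so the
vanishing of the product forces that of `φ₁`. The support condition on products thus becomes one on
`φ₁` alone. -/
theorem ae_eq_zero_of_mem_activeSet {L : Set (E m)} {φ₁ : E d × E m → ℂ}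
    (h : ∀ n, ∀ᵐ w ∂(ρ.prod volume), w.2.2 ∉ L → φ₁ w.2 * (U n w.1 w.2 : ℂ) = 0) :
    ∀ᵐ y, y ∈ activeSet ρ K U → y.2 ∉ L → φ₁ y = 0 := by
  filter_upwards [ae_all_iff.2 fun n => ae_ae_swap (h n)] with y hy hyW hyL
  by_contra h0
  obtain ⟨-, n, hn⟩ := hyW
  refine hn ?_
  filter_upwards [hy n] with s hs
  simpa [h0] using hs hyL

theorem enorm_sq_le (z : ℂ) : ‖z‖ₑ ^ 2 ≤ ‖z.re‖ₑ ^ 2 + ‖z.im‖ₑ ^ 2 := by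
  rw [← ofReal_norm, ← ofReal_norm, ← ofReal_norm, ← ENNReal.ofReal_pow (norm_nonneg _),
    ← ENNReal.ofReal_pow (norm_nonneg _), ← ENNReal.ofReal_pow (norm_nonneg _),
    ← ENNReal.ofReal_add (by positivity) (by positivity), Complex.sq_norm, Complex.normSq_apply]
  refine ENNReal.ofReal_le_ofReal (le_of_eq ?_)
  rw [Real.norm_eq_abs, Real.norm_eq_abs, sq_abs, sq_abs]
  ring

theorem measurable_enorm_integral_mul_sq {V : α → E d × E m → ℝ} {g : E d × E m → ℝ}
    (hV : Measurable (Function.uncurry V)) (hg : AEStronglyMeasurable g) :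
    Measurable fun s => ‖∫ y, V s y * g y‖ₑ ^ 2 := by
  have e : ∀ s, ∫ y, V s y * g y = ∫ y, V s y * hg.mk g y := fun s => by
    refine integral_congr_ae ?_
    filter_upwards [hg.ae_eq_mk] with y hy
    rw [hy]
  simp_rw [e]
  have h1 : Measurable fun w : α × (E d × E m) => V w.1 w.2 * hg.mk g w.2 :=
    hV.mul (hg.stronglyMeasurable_mk.measurable.comp measurable_snd)
  have h2 : StronglyMeasurable fun s => ∫ y, V s y * hg.mk g y :=
    h1.stronglyMeasurable.integral_prod_right'
  exact h2.measurable.enorm.pow_const 2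

theorem isTameSeq_truncation (hK : MeasurableSet K) (hC : 0 ≤ C)
    (hU : ∀ n, Measurable (Function.uncurry (U n)))
    (hb : ∀ n, ∀ᵐ w ∂(ρ.prod volume), |U n w.1 w.2| ≤ C)
    (hs : ∀ n, ∀ᵐ w ∂(ρ.prod volume), w.2.1 ∉ K → U n w.1 w.2 = 0)
    (hw : ∀ g : E d × E m → ℝ, Integrable g → MemLp g 2 volume →
      Tendsto (fun n => ∫⁻ s, ‖∫ y, U n s y * g y‖ₑ ^ 2 ∂ρ) atTop (𝓝 0)) :
    IsTameSeq ρ K C fun n s y => (truncation ρ K C U n s y : ℂ) := by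
  have hm := measurable_truncation (ρ := ρ) (C := C) hK hU
  have hbd : ∀ n s y, |truncation ρ K C U n s y| ≤ C := by
    intro n s y
    by_cases hy : y ∈ activeSet ρ K U
    · rw [truncation, indicator_of_mem hy]
      split_ifs with h
      · exact h
      · simpa using hC
    · rw [truncation, indicator_of_notMem hy]; simpa using hC
  have hsl : ∀ n s, Measurable (truncation ρ K C U n s) := fun n s =>
    (hm n).comp measurable_prodMk_left
  refine ⟨fun n => Complex.measurable_ofReal.comp (hm n), fun n s => ⟨?_, fun y => ?_, fun y hy => ?_⟩,
    fun g hg1 hg2 => ?_⟩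
  · exact Complex.measurable_ofReal.comp (hsl n s)
  · rw [Complex.norm_real]; exact hbd n s y
  · rw [truncation, indicator_of_notMem fun h => hy h.1, Complex.ofReal_zero]
  · have h1 := (hw _ hg1.re hg2.re).add (hw _ hg1.im hg2.im)
    simp only [RCLike.re_eq_complex_re, RCLike.im_eq_complex_im, add_zero] at h1
    refine tendsto_of_tendsto_of_tendsto_of_le_of_le tendsto_const_nhds h1 (fun n => zero_le)
      fun n => ?_
    have hae := Measure.ae_ae_of_ae_prod (ae_truncation_eq hK hU hb hs n)
    have e : ∀ h : E d × E m → ℝ, ∫⁻ s, ‖∫ y, U n s y * h y‖ₑ ^ 2 ∂ρ =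
        ∫⁻ s, ‖∫ y, truncation ρ K C U n s y * h y‖ₑ ^ 2 ∂ρ := fun h => by
      refine lintegral_congr_ae ?_
      filter_upwards [hae] with s hs
      congr 2
      refine integral_congr_ae ?_
      filter_upwards [hs] with y hy
      rw [hy]
    dsimp only
    rw [e, e]
    have hint : Measurable fun s => ‖∫ y, truncation ρ K C U n s y * (g y).re‖ₑ ^ 2 :=
      measurable_enorm_integral_mul_sq (hm n) hg1.re.1
    have hz : ∀ s, Integrable fun y => (truncation ρ K C U n s y : ℂ) * g y := fun s => by
      refine hg1.bdd_mul (c := C) (Complex.measurable_ofReal.comp (hsl n s)).aestronglyMeasurable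
        (Eventually.of_forall fun y => ?_)
      rw [Complex.norm_real]; exact hbd n s y
    rw [← lintegral_add_left hint]
    refine lintegral_mono fun s => ?_
    refine (enorm_sq_le _).trans (le_of_eq ?_)
    have er := Complex.reCLM.integral_comp_comm (hz s)
    have ei := Complex.imCLM.integral_comp_comm (hz s)
    simp only [Complex.reCLM_apply, Complex.imCLM_apply, Complex.re_ofReal_mul,
      Complex.im_ofReal_mul] at er ei
    rw [← er, ← ei]

end Truncation

/-! ### From almost sure convergence to convergence in mean. -/

section Admissible

variable {Ω : Type*} [MeasurableSpace Ω] {P : Measure Ω} [IsProbabilityMeasure P] {d m : ℕ} {T : ℝ}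
  {u : ℕ → Ω → ℝ → E d → E m → ℝ}

omit [IsProbabilityMeasure P] in
theorem measurePreserving_assoc : MeasurePreserving
    (MeasurableEquiv.prodAssoc : (Ω × ℝ) × (E d × E m) ≃ᵐ Ω × ℝ × E d × E m)
    ((paramMeasure P T).prod volume)
    (P.prod ((volume.restrict (Ioo 0 T)).prod (volume : Measure (E d × E m)))) :=
  measurePreserving_prodAssoc P (volume.restrict (Ioo 0 T)) (volume : Measure (E d × E m))

omit [IsProbabilityMeasure P] in
theorem ae_assoc_iff {p : Ω × ℝ × E d × E m → Prop} :
    (∀ᵐ w ∂(P.prod ((volume.restrict (Ioo 0 T)).prod (volume : Measure (E d × E m)))), p w) ↔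
      ∀ᵐ w : (Ω × ℝ) × (E d × E m) ∂((paramMeasure P T).prod volume), p (w.1.1, w.1.2, w.2) :=
  ⟨fun h => measurePreserving_assoc.quasiMeasurePreserving.ae h, fun h =>
    (measurePreserving_assoc.symm _).quasiMeasurePreserving.ae h⟩

/-- The functions `uₙ` as functions of `(ω, t)` and `(x, λ)`. -/
def uncurried (u : ℕ → Ω → ℝ → E d → E m → ℝ) (n : ℕ) (s : Ω × ℝ) (y : E d × E m) : ℝ :=
  u n s.1 s.2 y.1 y.2

omit [IsProbabilityMeasure P] in
theorem IsAdmissible.measurable_uncurried (hu : IsAdmissible P T u) (n : ℕ) :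
    Measurable (Function.uncurry (uncurried u n)) := by
  have := (hu.measurable n).comp
    (MeasurableEquiv.prodAssoc : (Ω × ℝ) × (E d × E m) ≃ᵐ Ω × ℝ × E d × E m).measurable
  exact this

/-- For integrable `g` the uniform bound on `u` gives the constant majorant `D`, so almost sure
convergence may be integrated over `Ω`. -/
theorem IsAdmissible.tendsto_uncurried (hu : IsAdmissible P T u) {g : E d × E m → ℝ}
    (hg1 : Integrable g) (hg2 : MemLp g 2 volume) :
    Tendsto (fun n => ∫⁻ s, ‖∫ y, uncurried u n s y * g y‖ₑ ^ 2 ∂(paramMeasure P T)) atTop (𝓝 0) := by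
  obtain ⟨C, hC⟩ := hu.bounded
  have hm : ∀ n, Measurable fun s : Ω × ℝ => ‖∫ y, uncurried u n s y * g y‖ₑ ^ 2 := fun n =>
    measurable_enorm_integral_mul_sq (hu.measurable_uncurried n) hg1.1
  have e : ∀ n, ∫⁻ s, ‖∫ y, uncurried u n s y * g y‖ₑ ^ 2 ∂(paramMeasure P T) =
      ∫⁻ ω, (∫⁻ t in Ioo 0 T, ‖∫ z : E d × E m, u n ω t z.1 z.2 * g z‖ₑ ^ 2) ∂P := fun n =>
    lintegral_prod _ (hm n).aemeasurable
  simp_rw [e]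
  set D : ℝ≥0∞ := (ENNReal.ofReal C * ∫⁻ y, ‖g y‖ₑ) ^ 2 * volume (Ioo 0 T) with hD
  have hDt : D ≠ ∞ := by
    have : ∫⁻ y, ‖g y‖ₑ < ∞ := hg1.2
    rw [hD, Real.volume_Ioo]
    finiteness
  have h1 := tendsto_lintegral_of_dominated_convergence (μ := P) (f := fun _ => 0) (fun _ => D)
    (F := fun n ω => ∫⁻ t in Ioo 0 T, ‖∫ z : E d × E m, u n ω t z.1 z.2 * g z‖ₑ ^ 2)
    (fun n => (hm n).lintegral_prod_right') (fun n => ?_) (by simp [hDt]) (hu.tendsto g hg2)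
  · simpa using h1
  · have h2 := Measure.ae_ae_of_ae_prod (hC n)
    filter_upwards [h2] with ω h3
    have h4 := Measure.ae_ae_of_ae_prod h3
    calc _ ≤ ∫⁻ t in Ioo 0 T, (ENNReal.ofReal C * ∫⁻ y, ‖g y‖ₑ) ^ 2 := by
          refine lintegral_mono_ae ?_
          filter_upwards [h4] with t h5
          refine pow_le_pow_left' ((enorm_integral_le_lintegral_enorm _).trans ?_) 2
          rw [← lintegral_const_mul' _ _ ENNReal.ofReal_ne_top]
          refine lintegral_mono_ae ?_
          filter_upwards [h5] with y h6
          rw [enorm_mul]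
          gcongr
          rw [← ofReal_norm]
          exact ENNReal.ofReal_le_ofReal h6
      _ = D := by rw [lintegral_const, Measure.restrict_apply_univ]

end Admissible

/-! ### Restriction of profiles to the active set. -/

section Restriction

variable {d m : ℕ} {ι : Type} {R : ℝ} {C₁ : ℝ≥0∞} {A : ℕ → ℝ≥0∞}
  {N : Measure (State d ι)} {F : State d ι × E m → ℂ} {W : Set (E d × E m)}

/-- The restriction of a function on the state space to a set of points `(x, p)`. -/
noncomputable def restrictTo (W : Set (E d × E m)) (F : State d ι × E m → ℂ) :
    State d ι × E m → ℂ :=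
  {w | (w.1.1.1, w.2) ∈ W}.indicator F

theorem IsProfile.restrictTo (hP : IsProfile R C₁ A N F) (hW : MeasurableSet W) :
    IsProfile R C₁ A N (restrictTo W F) := by
  have hm : MeasurableSet {w : State d ι × E m | (w.1.1.1, w.2) ∈ W} :=
    (measurable_fst.fst.fst.prodMk measurable_snd) hW
  refine ⟨hP.finite, hP.const_ne_top, hP.marg, hP.meas.indicator hm, hP.memLp.indicator hm,
    hP.bound_ne_top, fun n => ?_⟩
  filter_upwards [hP.bound n] with X hX
  refine (lintegral_mono fun p => pow_le_pow_left' ?_ 2).trans hX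
  exact enorm_indicator_le_enorm_self _ _

theorem pair_restrictTo (n : ℕ) (g : E d × E m → ℂ) :
    pair n (restrictTo W F) (W.indicator g) = pair n F (W.indicator g) := by
  ext X
  refine integral_congr_ae (Eventually.of_forall fun p => ?_)
  by_cases hp : (X.1.1, p) ∈ W
  · simp [restrictTo, hp]
  · simp [hp]

theorem stateDensity_restrictTo_eq_zero {φ : ℝ → ℂ} {z : E m × E m} {X : State d ι}
    (h : (X.1.1, z.1) ∉ W ∨ (X.1.1, z.2) ∉ W) : stateDensity φ (restrictTo W F) z X = 0 := by
  rcases h with h | h <;> simp [stateDensity, restrictTo, h]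

theorem fiberMean_restrictTo_eq_zero [Countable ι] [IsFiniteMeasure N] {φ : ℝ → ℂ} {z : E m × E m}
    {y : E d × S d} (h : (y.1, z.1) ∉ W ∨ (y.1, z.2) ∉ W) :
    fiberMean N (stateDensity φ (restrictTo W F)) z y = 0 := by
  simp_rw [fiberMean, stateDensity_restrictTo_eq_zero (X := (y, _)) h, integral_zero]

end Restriction

/-! ### Changing tensors off the active set. -/

section Density

variable {d m : ℕ} {ι : Type} [Countable ι] {R : ℝ} {C₁ : ℝ≥0∞} {A : ℕ → ℝ≥0∞}
  {N : Measure (State d ι)} {F : State d ι × E m → ℂ} {W : Set (E d × E m)}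

omit [Countable ι] in
theorem IsProfile.absolutelyContinuous_fst (hP : IsProfile R C₁ A N F) : N.fst.fst ≪ volume := by
  have e : N.fst.fst = N.map (fun y => y.1.1) := by
    rw [Measure.fst, Measure.fst, Measure.map_map measurable_fst measurable_fst]
    rfl
  rw [e]
  exact ((Measure.absolutelyContinuous_of_le hP.marg).trans
    (Measure.smul_absolutelyContinuous (c := C₁))).trans Measure.restrict_le_self.absolutelyContinuous

theorem quasiMeasurePreserving_point {κ : Measure (E d × S d)} [IsFiniteMeasure κ]
    (hκ : κ.fst ≪ volume) :
    Measure.QuasiMeasurePreserving (fun w : (E m × E m) × (E d × S d) => (w.2.1, w.1.1))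
      (volume.prod κ) volume := by
  have h1 : Measure.QuasiMeasurePreserving (Prod.fst : E d × S d → E d) κ volume :=
    ⟨measurable_fst, hκ⟩
  have h2 : Measure.QuasiMeasurePreserving (Prod.fst : E m × E m → E m) volume volume :=
    Measure.quasiMeasurePreserving_fst
  exact (QuasiMeasurePreserving.prodMap h1 h2).comp
    (Measure.measurePreserving_swap (μ := (volume : Measure (E m × E m)))
      (ν := κ)).quasiMeasurePreserving

/-- Against a density which vanishes off `W`, a tensor may be changed off `W`. -/
theorem ae_tensor_mul_eq [IsFiniteMeasure N] (hP : IsProfile R C₁ A N F) {φ : ℝ → ℂ}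
    {g₁ φ₁ φ₂ : E d × E m → ℂ} {ψ : S d → ℂ} (h : ∀ᵐ y, y ∈ W → φ₁ y = g₁ y) :
    ∀ᵐ w : (E m × E m) × (E d × S d) ∂(volume.prod N.fst),
      tensor (W.indicator g₁) (W.indicator φ₂) ψ w.1 w.2 *
          fiberMean N (stateDensity φ (restrictTo W F)) w.1 w.2 =
        tensor φ₁ φ₂ ψ w.1 w.2 * fiberMean N (stateDensity φ (restrictTo W F)) w.1 w.2 := by
  filter_upwards [(quasiMeasurePreserving_point hP.absolutelyContinuous_fst).ae h] with w hw
  by_cases h1 : (w.2.1, w.1.1) ∈ W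
  · by_cases h2 : (w.2.1, w.1.2) ∈ W
    · simp only [tensor, indicator_of_mem h1, indicator_of_mem h2, hw h1]
    · rw [fiberMean_restrictTo_eq_zero (Or.inr h2), mul_zero, mul_zero]
  · rw [fiberMean_restrictTo_eq_zero (Or.inl h1), mul_zero, mul_zero]

end Density

/-! ### Cut-off of the test functions in `p`. -/

section Cutoff

variable {d m : ℕ}

theorem exists_nat_norm_lt {L : Set (E m)} (hL : IsCompact L) {φ₂ : E d × E m → ℂ}
    (h : HasCompactSupport φ₂) :
    ∃ n : ℕ, (∀ p ∈ L, ‖p‖ < n) ∧ ∀ y, (n : ℝ) ≤ ‖y.2‖ → φ₂ y = 0 := by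
  obtain ⟨r, hr⟩ := (hL.union (h.isCompact.image continuous_snd)).isBounded.exists_norm_le
  obtain ⟨n, hn⟩ := exists_nat_gt r
  refine ⟨n, fun p hp => (hr p (Or.inl hp)).trans_lt hn, fun y hy => ?_⟩
  by_contra h0
  exact absurd (hr y.2 (Or.inr ⟨y, subset_tsupport _ h0, rfl⟩)) (not_le.2 (hn.trans_le hy))

theorem memLp_lam {K : Set (E d)} (hK : volume K ≠ ∞) {n : ℕ} {r : ℝ≥0∞} (hr : 2 ≤ r)
    {g : E d × E m → ℂ} (hg : MemLp g r volume) : MemLp g 2 (lam K m n) := by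
  have := isFiniteMeasure_lam hK m n
  refine MemLp.mono_exponent ?_ hr
  rw [lam_eq_restrict]
  exact hg.restrict _

/-- A measurable representative of `φ₁` is set to zero outside the ball; on `W` this changes nothing
up to null sets. -/
theorem exists_cutoff {d m : ℕ} {K : Set (E d)} (hK : volume K ≠ ∞) {W : Set (E d × E m)}
    {n : ℕ} {r : ℝ≥0∞} (hr : 2 ≤ r) {φ₁ : E d × E m → ℂ}
    (h1 : MemLp φ₁ r volume) (hs : ∀ᵐ y, y ∈ W → (n : ℝ) ≤ ‖y.2‖ → φ₁ y = 0) :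
    ∃ g : E d × E m → ℂ, Measurable g ∧ MemLp g 2 (lam K m n) ∧
      (∀ y, (n : ℝ) ≤ ‖y.2‖ → g y = 0) ∧ ∀ᵐ y, y ∈ W → φ₁ y = g y := by
  have hB : MeasurableSet {y : E d × E m | ‖y.2‖ < n} := measurable_snd (measurableSet_normBall m n)
  have hm := h1.1.stronglyMeasurable_mk.measurable
  refine ⟨{y : E d × E m | ‖y.2‖ < n}.indicator (h1.1.mk φ₁), hm.indicator hB,
    (memLp_lam hK hr (h1.ae_eq h1.1.ae_eq_mk)).indicator hB,
    fun y hy => indicator_of_notMem (show y ∉ {y : E d × E m | ‖y.2‖ < n} from not_lt.2 hy) _, ?_⟩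
  filter_upwards [hs, h1.1.ae_eq_mk] with y hy hy2 hyW
  by_cases hn : ‖y.2‖ < n
  · rw [indicator_of_mem (show y ∈ {y : E d × E m | ‖y.2‖ < n} from hn), hy2]
  · rw [indicator_of_notMem (show y ∉ {y : E d × E m | ‖y.2‖ < n} from hn), hy hyW (not_lt.1 hn)]

end Cutoff
end HMeasure

/-! ### Assembly of the theorem. -/

theorem corollary3p7 {Ω : Type*} [MeasurableSpace Ω] (P : Measure Ω) [IsProbabilityMeasure P]
    (d m : ℕ) (hd : 1 ≤ d) (hm : 1 ≤ m) (T : ℝ) (hT : 0 < T)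
    (u : ℕ → Ω → ℝ → HMeasure.E d → HMeasure.E m → ℝ) (hu : HMeasure.IsAdmissible P T u) :
    ∃ σ : ℕ → ℕ, StrictMono σ ∧ ∀ φ : ℝ → ℂ, Integrable φ →
      ∃ (M : HMeasure.TestSpace d m →L[ℂ] ℂ) (ν : Kernel (HMeasure.E d) (HMeasure.S d))
        (f : HMeasure.E m × HMeasure.E m → HMeasure.E d × HMeasure.S d → ℂ),
        HMeasure.IsLocIntegrableFamily ν ∧ HMeasure.IsDensity ν f ∧
        HMeasure.IsRepresentedBy M f ν ∧
        ∀ (r : ℝ≥0∞), 2 < r →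
        ∀ (φ₁ φ₂ : HMeasure.E d × HMeasure.E m → ℂ) (ψ : HMeasure.S d → ℂ),
          MemLp φ₁ r volume →
          -- `φ₁ uₙ` vanishes for `p` outside of a compact set, which does not depend on `n`
          (∃ L : Set (HMeasure.E m), IsCompact L ∧ ∀ n,
            ∀ᵐ w ∂(P.prod ((volume.restrict (Ioo 0 T)).prod
                (volume : Measure (HMeasure.E d × HMeasure.E m)))),
              w.2.2.2 ∉ L → φ₁ w.2.2 * (u n w.1 w.2.1 w.2.2.1 w.2.2.2 : ℂ) = 0) →
          Continuous φ₂ → HasCompactSupport φ₂ →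
          ContMDiff (𝓡 d) 𝓘(ℝ, ℂ) d ψ →
          -- the expectations are absolutely convergent integrals
          (∀ n, Integrable (fun w : Ω × (ℝ × HMeasure.E d) × HMeasure.E m × HMeasure.E m =>
              HMeasure.integrand T (u n w.1) φ φ₁ φ₂ ψ w.2.1.1 w.2.1.2 w.2.2.1 w.2.2.2)
            (P.prod volume)) ∧
          -- so is the pairing of `f dν` with `φ₁ conj φ₂ ⊗ ψ`, and it is the limit of them
          Integrable (fun w : (HMeasure.E m × HMeasure.E m) × (HMeasure.E d × HMeasure.S d) =>
              HMeasure.tensor φ₁ φ₂ ψ w.1 w.2 * f w.1 w.2)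
            ((volume : Measure (HMeasure.E m × HMeasure.E m)).prod (HMeasure.total ν)) ∧
          Tendsto (fun n => HMeasure.expectation P T (u (σ n)) φ φ₁ φ₂ ψ) atTop
            (𝓝 (∫ z : HMeasure.E m × HMeasure.E m,
              ∫ y, HMeasure.tensor φ₁ φ₂ ψ z y * f z y ∂(HMeasure.total ν))) ∧
          -- in particular the limit is `M Φ` if `Φ = φ₁ conj φ₂ ⊗ ψ` lies in the domain of `M`
          (∀ Φ : HMeasure.TestSpace d m,
            (∀ᵐ z : HMeasure.E m × HMeasure.E m, ∀ y, Φ z y = HMeasure.tensor φ₁ φ₂ ψ z y) →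
            Tendsto (fun n => HMeasure.expectation P T (u (σ n)) φ φ₁ φ₂ ψ) atTop
              (𝓝 (M Φ))) := by
  obtain ⟨C₀, hC₀⟩ := hu.bounded
  obtain ⟨K₀, hK₀, hsupp⟩ := hu.support
  obtain ⟨C₂, hC₂, hL2⟩ := hu.boundedL2
  obtain ⟨R, hR, hKR⟩ := HMeasure.exists_cube_superset hK₀
  set K := HMeasure.cube d R
  set C := max C₀ 0
  set ρ := HMeasure.paramMeasure P T
  set U := HMeasure.uncurried u
  have hK₀K : ∀ x, x ∉ K → x ∉ K₀ := fun x hx h => hx fun i => abs_le.1 (hKR x h i).le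
  have hKm : MeasurableSet K := HMeasure.measurableSet_cube R
  have hK : volume K ≠ ∞ := (HMeasure.isCompact_cube R).measure_lt_top.ne
  have hU : ∀ n, Measurable (Function.uncurry (U n)) := hu.measurable_uncurried
  have hb : ∀ n, ∀ᵐ w ∂(ρ.prod volume), |U n w.1 w.2| ≤ C := fun n => by
    filter_upwards [HMeasure.ae_assoc_iff.1 (hC₀ n)] with w hw using hw.trans (le_max_left _ _)
  have hs : ∀ n, ∀ᵐ w ∂(ρ.prod volume), w.2.1 ∉ K → U n w.1 w.2 = 0 := fun n => by
    filter_upwards [HMeasure.ae_assoc_iff.1 (hsupp n)] with w hw hwK using hw (hK₀K _ hwK)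
  have hae := HMeasure.ae_truncation_eq hKm hU hb hs
  have htame := HMeasure.isTameSeq_truncation hKm (le_max_right C₀ 0) hU hb hs
    fun g hg1 hg2 => hu.tendsto_uncurried hg1 hg2
  set W := HMeasure.activeSet ρ K U
  have hW : MeasurableSet W := HMeasure.measurableSet_activeSet hKm hU
  let v : ℕ → Ω → ℝ → HMeasure.E d → HMeasure.E m → ℝ := fun n ω t x p =>
    HMeasure.truncation ρ K C U n (ω, t) (x, p)
  -- The time is clamped to `[0, T]`, so that the states lie in a compact set for every parameter;
  -- on `(0, T)` this is the identity.
  let τ : Ω × ℝ → ℝ := fun s => max 0 (min T s.2)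
  have hτm : Measurable τ := measurable_const.max (measurable_const.min measurable_snd)
  have hτ : ∀ s : Ω × ℝ, s.2 ∈ Ioo 0 T → τ s = s.2 := fun s h => by
    simp only [τ]; rw [min_eq_right h.2.le, max_eq_right h.1.le]
  have hM : ∀ n, ∫⁻ s, (∫⁻ y, ‖(HMeasure.truncation ρ K C U n s y : ℂ)‖ₑ ^ 2) ∂ρ ≤ C₂ := by
    intro n
    have hm := (Complex.measurable_ofReal.comp
      (HMeasure.measurable_truncation (ρ := ρ) (C := C) hKm hU n)).enorm.pow_const 2
    refine (lintegral_prod (μ := ρ) (ν := volume) _ hm.aemeasurable).symm.trans_le ?_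
    refine le_trans (le_of_eq ?_) (hL2 n)
    rw [← HMeasure.measurePreserving_assoc.lintegral_comp_emb
      (MeasurableEquiv.measurableEmbedding _)]
    refine lintegral_congr_ae ?_
    filter_upwards [hae n] with w hw
    change ‖((HMeasure.truncation ρ K C U n w.1 w.2 : ℝ) : ℂ)‖ₑ ^ 2 = ‖U n w.1 w.2‖ₑ ^ 2
    rw [hw, ← ofReal_norm, Complex.norm_real, ofReal_norm]
  obtain ⟨σ, hσ, ι, C₁, A, N, F, hι, hP, hlim⟩ := htame.exists_profile hR hτm
    (T := T) (fun s => ⟨le_max_left _ _, max_le hT.le (min_le_left _ _)⟩) hC₂.ne hM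
  refine ⟨σ, hσ, fun φ hφ => ?_⟩
  have hN := hP.finite
  -- The density is built from the restricted profile, so it vanishes unless both `(x, p)` and `(x,
  -- q)` are active; values of `φ₁` elsewhere then do not matter.
  have hP' := hP.restrictTo hW
  obtain ⟨ν, hν, hνN⟩ := HMeasure.exists_kernel_total_eq N.fst hP.absolutelyContinuous_fst
  have hf := hP'.isDensity hφ hνN
  have hsf := hν.isSFinite
  obtain ⟨M, hM⟩ := hf.exists_isRepresentedBy
  refine ⟨M, ν, _, hν, hf, hM, ?_⟩
  rintro r hr φ₁ φ₂ ψ h1 ⟨L, hL, h1L⟩ h2c h2s hψ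
  have hψ' : Continuous ψ := hψ.continuous
  obtain ⟨n, hnL, hn2⟩ := HMeasure.exists_nat_norm_lt hL h2s
  have hs1 : ∀ᵐ y, y ∈ W → (n : ℝ) ≤ ‖y.2‖ → φ₁ y = 0 := by
    filter_upwards [HMeasure.ae_eq_zero_of_mem_activeSet (ρ := ρ) (K := K) (U := U) (L := L) (φ₁ := φ₁)
      fun k => HMeasure.ae_assoc_iff.1 (h1L k)] with y hy hyW hyn
    exact hy hyW fun h => absurd (hnL _ h) (not_lt.2 hyn)
  obtain ⟨g, hgm, hg2, hgs, hge⟩ := HMeasure.exists_cutoff hK hr.le h1 hs1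
  have h2L : MemLp φ₂ 2 (HMeasure.lam K m n) :=
    HMeasure.memLp_lam hK le_rfl (h2c.memLp_of_hasCompactSupport h2s)
  have hWs : ∀ {h : HMeasure.E d × HMeasure.E m → ℂ}, (∀ y, (n : ℝ) ≤ ‖y.2‖ → h y = 0) →
      ∀ y, (n : ℝ) ≤ ‖y.2‖ → W.indicator h y = 0 := fun hh y hy => by
    by_cases hyW : y ∈ W <;> simp [hyW, hh y hy]
  -- Off `W` both sides vanish almost everywhere, since the truncation is zero there and agrees with
  -- `u k` almost everywhere.
  have hprod : ∀ {h h' : HMeasure.E d × HMeasure.E m → ℂ}, (∀ᵐ y, y ∈ W → h y = h' y) → ∀ k,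
      ∀ᵐ w ∂(P.prod ((volume.restrict (Ioo 0 T)).prod
        (volume : Measure (HMeasure.E d × HMeasure.E m)))),
      h w.2.2 * (u k w.1 w.2.1 w.2.2.1 w.2.2.2 : ℂ) =
        W.indicator h' w.2.2 * (v k w.1 w.2.1 w.2.2.1 w.2.2.2 : ℂ) := by
    intro h h' hh k
    rw [HMeasure.ae_assoc_iff]
    have q : Measure.QuasiMeasurePreserving (Prod.snd : (Ω × ℝ) × (HMeasure.E d × HMeasure.E m) → _)
        (ρ.prod volume) volume := Measure.quasiMeasurePreserving_snd
    filter_upwards [hae k, q.ae hh] with w hw hw2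
    change h w.2 * (U k w.1 w.2 : ℂ) =
      W.indicator h' w.2 * (HMeasure.truncation ρ K C U k w.1 w.2 : ℂ)
    by_cases hwW : w.2 ∈ W
    · rw [indicator_of_mem hwW, hw, hw2 hwW]
    · rw [← hw, HMeasure.truncation, indicator_of_notMem hwW]
      simp
  have hcongr := fun k => HMeasure.integrand_congr (hprod hge k)
    (hprod (Eventually.of_forall fun y _ => rfl) k : _) φ ψ (φ₂ := φ₂) (φ₂' := W.indicator φ₂)
  have hexp := fun k => HMeasure.integrable_integrand_and_expectation_eq (P := P) (T := T)
    (v := v k) hKm hK (htame.meas k) (htame.tame k) hτm hτ hφ hψ' (hgm.indicator hW)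
    (h2c.measurable.indicator hW) (hg2.indicator hW) (h2L.indicator hW) (hWs hgs) (hWs hn2)
  obtain ⟨hi, he⟩ := hP'.integrable_and_integral_eq hφ hψ' (hgm.indicator hW)
    (h2c.measurable.indicator hW) (hg2.indicator hW) (h2L.indicator hW) (hWs hgs) (hWs hn2)
  have htens := HMeasure.ae_tensor_mul_eq (φ₂ := φ₂) (ψ := ψ) (φ := φ) hP hge
  have hi' := hi.congr htens
  have hlimit : ∫ z : HMeasure.E m × HMeasure.E m, ∫ y, HMeasure.tensor φ₁ φ₂ ψ z y *
      HMeasure.fiberMean N (HMeasure.stateDensity φ (HMeasure.restrictTo W F)) z y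
        ∂(HMeasure.total ν) = HMeasure.limitForm N n F φ ψ (W.indicator g) (W.indicator φ₂) := by
    -- The tensors agree only almost everywhere in all variables jointly, hence the passage through
    -- the product measure.
    rw [hνN, ← integral_prod _ hi', ← integral_congr_ae htens, integral_prod _ hi, he]
    simp only [HMeasure.limitForm, HMeasure.pair_restrictTo]
  have hconv : Tendsto (fun k => HMeasure.expectation P T (u (σ k)) φ φ₁ φ₂ ψ) atTop
      (𝓝 (∫ z : HMeasure.E m × HMeasure.E m, ∫ y, HMeasure.tensor φ₁ φ₂ ψ z y *
        HMeasure.fiberMean N (HMeasure.stateDensity φ (HMeasure.restrictTo W F)) z y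
          ∂(HMeasure.total ν))) := by
    rw [hlimit]
    refine (hlim φ ψ hφ hψ' n _ _ (hg2.indicator hW) (h2L.indicator hW)).congr fun k => ?_
    rw [HMeasure.expectation_congr (hcongr (σ k)), (hexp (σ k)).2]
    rfl
  refine ⟨fun k => (hexp k).1.congr ?_, by rw [hνN]; exact hi', hconv, fun Φ hΦ => ?_⟩
  · filter_upwards [hcongr k] with w hw using hw.symm
  · rw [(hM Φ).2]
    convert hconv using 2
    refine integral_congr_ae ?_
    filter_upwards [hΦ] with z hz
    simp_rw [hz]
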